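/- Throughout, a cube complex is obtained by gluing cubes of finite (possibly unbounded) dimensions along faces by isometries; cubes are embedded and two cubes that meet intersect in a common face. It is CAT(0) if all its vertex links are flag simplicial complexes and it is simply connected (hence non-empty). A CAT(0) cube complex $X$ is identified with its vertex set, $d$ is the graph metric of its one-skeleton, and groups act by isometries for $d$. The median point $\mu(x,y,z)$ is the unique vertex lying on geodesics between any two of $x,y,z$; a *median subalgebra* is a set of vertices stable under $\mu$. A hyperplane is a class of edges for the equivalence relation generated by being opposite in a square; its halfspaces are the components of the one-skeleton deprived of its edges. An isometry *inverts* a hyperplane if it stabilises it and swaps its halfspaces. An isometry $g$ is *elliptic* if its orbits are bounded; *loxodromic* if it has an *axis*, i.e. a bi-infinite geodesic on which $g$ acts as a translation of length $\min_{x} d(x,gx)>0$; *inverting* if its orbits are unbounded and some power of $g$ inverts a hyperplane. Its *median set* $\mathrm{Med}(g)$ is: the union of the cubes of minimal dimension among the cubes stabilised by $g$, if $g$ is elliptic; the union of the axes of $g$, if $g$ is loxodromic; and, if $g$ is inverting, the pre-image under the canonical map $\pi:X\to X/\mathcal J$ of the union of the axes of the isometry induced by $g$ on $X/\mathcal J$,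 where $\mathcal J$ is the set of hyperplanes inverted by powers of $g$. Here $X/\mathcal J$ is the cubulation of the wallspace on $X$ whose walls are the partitions into halfspaces given by the hyperplanes not in $\mathcal J$: its vertices are the orientations (choices of one halfspace in each wall, closed under passing to larger halfspaces) that differ on finitely many walls from a principal orientation $\pi(x)=\{\text{halfspaces containing }x\}$, and two of them are adjacent if they differ on exactly one wall. A *median algebra* is a set $M$ with a ternary operation $\mu$, invariant under permutations, with $\mu(x,y,y)=y$ and $\mu(\mu(x,w,y),w,z)=\mu(x,w,\mu(y,w,z))$; the interval $I(x,y)$ is $\{z:\mu(x,y,z)=z\}$; $M$ is *discrete* if its intervals are finite. A subset is convex if it contains the intervals between its points; a halfspace is a non-empty convex subset with non-empty convex complement; a wall is a halfspace together with its complement. The cubulation of a discrete $M$ has vertex set $M$, two points being adjacent if exactly one wall separates them, and cubes filling all cube subgraphs; $M$ is finite-dimensional if these cubes have bounded dimension. The Roller boundary of $M$ is the set of non-principal orientations of its walls; the median of three orientations is the set of halfspaces belonging to at least two of them. A *median flat* is a non-empty, finite-dimensional, discrete median algebra contained in the interval between two points of its Roller boundary. A *cube of dimension $k$* is a median algebra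 isomorphic to $\{0,1\}^k$ with the coordinatewise majority operation. **Theorem.** Let $G$ be a group acting on a CAT(0) cube complex $X$ and let $g\in G$ be such that $\langle g\rangle$ is a normal subgroup of $G$. Then $\mathrm{Med}(g)$ is a non-empty $G$-invariant median subalgebra of $X$, and it is isomorphic to a product $T\times F\times Q$ of three median algebras such that: - the action of $G$ on $\mathrm{Med}(g)\cong T\times F\times Q$ is the product of three actions of $G$ (by median automorphisms) on $T$, $F$ and $Q$; - $g$ acts trivially on $T$; - $F$ is a single point if $g$ is elliptic; otherwise $F$ is a median flat on which $g$ acts by translations of length $\ell=\lim_{n\to+\infty}\frac1n d(x,g^nx)$, where $\ell$ is a positive integer, independent of the vertex $x\in X$; that is, every point of $F$ lies on a bi-infinite geodesic of the cubulation of $F$ on which $g$ acts as a translation of length $\ell$; - $Q$ is a cube of finite dimension $k$, where $k=0$ if $g$ is loxodromic, $k$ is the minimal dimension of a cube of $X$ stabilised by $g$ if $g$ is elliptic, and otherwise $k$ is the number of hyperplanes of $X$ inverted by powers of $g$. -/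

import Mathlib

open Filter Topology

universe u v

/-! ### Cube complexes -/

/-- The one-skeleton of the `n`-cube: vertices are the points of `{0,1}^n`, and two of them are
adjacent when they differ in exactly one coordinate. -/
def hypercube (n : ℕ) : SimpleGraph (Fin n → Bool) where
  Adj v w := ∃! i, v i ≠ w i
  symm := ⟨fun v w h => by
    obtain ⟨i, hi, hu⟩ := h
    exact ⟨i, hi.symm, fun j hj => hu j (Ne.symm hj)⟩⟩
  loopless := ⟨fun v h => by
    obtain ⟨i, hi, _⟩ := h
    exact hi rfl⟩

/-- `D` is a face of `C`, where `C` spans the one-skeleton of a cube in `Γ`: the set `D` is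
obtained by fixing some of the coordinates of the cube. -/
def IsFaceOf {V : Type*} (Γ : SimpleGraph V) (D C : Set V) : Prop :=
  ∃ (n : ℕ) (e : hypercube n ≃g Γ.induce C) (I : Set (Fin n)) (a : Fin n → Bool),
    D = {x | ∃ v : Fin n → Bool, (∀ i ∈ I, v i = a i) ∧ (e v : V) = x}

/-- A cube complex, given by its vertices, its one-skeleton and its cubes. Cubes are embedded and
two cubes that meet do so along a common face; so a cube is recorded by its set of vertices. Cubes
are finite-dimensional, but their dimensions need not be bounded. -/
structure CubeComplex (V : Type*) where
  graph : SimpleGraph V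
  cubes : Set (Set V)
  exists_dim : ∀ C ∈ cubes, ∃ n : ℕ, Nonempty (hypercube n ≃g graph.induce C)
  vertex_mem : ∀ x : V, {x} ∈ cubes
  edge_mem : ∀ x y : V, graph.Adj x y → {x, y} ∈ cubes
  face_mem : ∀ C ∈ cubes, ∀ D, IsFaceOf graph D C → D ∈ cubes
  inter_face : ∀ C ∈ cubes, ∀ C' ∈ cubes, (C ∩ C').Nonempty → IsFaceOf graph (C ∩ C') C

/-- Elementary homotopies of edge paths: the equivalence relation generated by removing a
backtrack and by pushing a path across a square. -/
inductive CubeComplex.Homotopic {V : Type*} (X : CubeComplex V) :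
    ∀ {x y : V}, X.graph.Walk x y → X.graph.Walk x y → Prop
  | refl {x y : V} (p : X.graph.Walk x y) : X.Homotopic p p
  | symm {x y : V} {p q : X.graph.Walk x y} : X.Homotopic p q → X.Homotopic q p
  | trans {x y : V} {p q r : X.graph.Walk x y} :
      X.Homotopic p q → X.Homotopic q r → X.Homotopic p r
  | cons {x y z : V} (h : X.graph.Adj x y) {p q : X.graph.Walk y z} :
      X.Homotopic p q → X.Homotopic (SimpleGraph.Walk.cons h p) (SimpleGraph.Walk.cons h q)
  | backtrack {x y z : V} (h : X.graph.Adj x y) (h' : X.graph.Adj y x) (p : X.graph.Walk x z) :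
      X.Homotopic (SimpleGraph.Walk.cons h (SimpleGraph.Walk.cons h' p)) p
  | square {a b c d z : V} (hab : X.graph.Adj a b) (hbc : X.graph.Adj b c)
      (had : X.graph.Adj a d) (hdc : X.graph.Adj d c) (hsq : ({a, b, c, d} : Set V) ∈ X.cubes)
      (p : X.graph.Walk c z) :
      X.Homotopic (SimpleGraph.Walk.cons hab (SimpleGraph.Walk.cons hbc p))
        (SimpleGraph.Walk.cons had (SimpleGraph.Walk.cons hdc p))

namespace CubeComplex

variable {V : Type*} (X : CubeComplex V)

/-- The cube `C` has dimension `n`. -/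
def HasDim (C : Set V) (n : ℕ) : Prop := Nonempty (hypercube n ≃g X.graph.induce C)

/-- The simplices of the link of the vertex `x`: the finite sets of neighbours of `x` which,
together with `x`, are contained in a cube. -/
def linkSimplices (x : V) : Set (Finset V) :=
  {s | (∀ a ∈ s, X.graph.Adj x a) ∧ ∃ C ∈ X.cubes, x ∈ C ∧ (s : Set V) ⊆ C}

/-- Nonpositive curvature: the link of every vertex is a flag complex. -/
def IsNonpositivelyCurved : Prop :=
  ∀ (x : V) (s : Finset V), (∀ a ∈ s, X.graph.Adj x a) →
    (∀ a ∈ s, ∀ b ∈ s, ∃ t ∈ X.linkSimplices x, a ∈ t ∧ b ∈ t) → s ∈ X.linkSimplices x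

/-- Simple connectivity: the complex is connected (in particular non-empty) and every closed edge
path is homotopic to a constant path. -/
def IsSimplyConnected : Prop :=
  X.graph.Connected ∧ ∀ (x : V) (p : X.graph.Walk x x), X.Homotopic p SimpleGraph.Walk.nil

/-- CAT(0) cube complexes. -/
def IsCAT0 : Prop := X.IsNonpositivelyCurved ∧ X.IsSimplyConnected

/-! ### Hyperplanes -/

/-- `e` and `e'` are parallel (opposite) edges of a square. -/
def Parallel (e e' : Sym2 V) : Prop :=
  ∃ a b c d : V, a ≠ c ∧ b ≠ d ∧ X.graph.Adj a b ∧ X.graph.Adj b c ∧ X.graph.Adj c d ∧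
    X.graph.Adj d a ∧ ({a, b, c, d} : Set V) ∈ X.cubes ∧ e = s(a, b) ∧ e' = s(d, c)

/-- A hyperplane is a class of edges for the equivalence relation generated by parallelism. -/
def IsHyperplane (J : Set (Sym2 V)) : Prop :=
  ∃ e ∈ X.graph.edgeSet, J = {e' | Relation.EqvGen X.Parallel e e'}

/-- The halfspaces delimited by `J`: the connected components of the graph obtained from the
one-skeleton by removing the edges of `J`. -/
def halfspaces (J : Set (Sym2 V)) : Set (Set V) :=
  {D | ∃ c : (X.graph.deleteEdges J).ConnectedComponent, D = c.supp}

/-- `f` inverts `J`: it stabilises `J` and swaps the halfspaces delimited by `J`. -/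
def Inverts (f : Equiv.Perm V) (J : Set (Sym2 V)) : Prop :=
  Sym2.map f '' J = J ∧ ∀ D ∈ X.halfspaces J, f '' D = Dᶜ

/-- The hyperplanes inverted by powers of `f`. -/
def invertedHyperplanes (f : Equiv.Perm V) : Set (Set (Sym2 V)) :=
  {J | X.IsHyperplane J ∧ ∃ n : ℤ, X.Inverts (f ^ n) J}

end CubeComplex

/-! ### Geodesics and axes in graphs -/

/-- A bi-infinite geodesic of a graph. -/
def IsGeodesicLine {W : Type*} (Γ : SimpleGraph W) (γ : ℤ → W) : Prop :=
  ∀ m n : ℤ, Γ.dist (γ m) (γ n) = (m - n).natAbs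

/-- An axis of `f`: a bi-infinite geodesic on which `f` acts as a translation whose length is
positive and equal to the minimal displacement of `f`. -/
def IsAxis {W : Type*} (Γ : SimpleGraph W) (f : W → W) (γ : ℤ → W) : Prop :=
  IsGeodesicLine Γ γ ∧ ∃ l : ℕ, 0 < l ∧ IsLeast (Set.range fun x => Γ.dist x (f x)) l ∧
    ∀ n : ℤ, f (γ n) = γ (n + l)

/-! ### Wallspaces

A collection of walls is given by the set `H` of its halfspaces: the walls are the pairs
`{A, Aᶜ}` with `A ∈ H`. -/

/-- Orientations: coherent choices of one halfspace in each wall. -/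
def IsOrientation {S : Type*} (H : Set (Set S)) (σ : Set (Set S)) : Prop :=
  σ ⊆ H ∧ (∀ A ∈ H, Xor (A ∈ σ) (Aᶜ ∈ σ)) ∧ ∀ A ∈ H, ∀ B ∈ H, A ⊆ B → A ∈ σ → B ∈ σ

/-- The principal orientation defined by a point. -/
def principalOrientation {S : Type*} (H : Set (Set S)) (x : S) : Set (Set S) := {A ∈ H | x ∈ A}

/-- The vertices of the cubulation of a wallspace: the orientations commensurable to principal
orientations. -/
def CubulationVertex {S : Type*} (H : Set (Set S)) : Type _ :=
  {σ : Set (Set S) // IsOrientation H σ ∧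
    ∃ x : S, (symmDiff σ (principalOrientation H x)).Finite}

/-- The one-skeleton of the cubulation of a wallspace. -/
def cubulationGraph {S : Type*} (H : Set (Set S)) : SimpleGraph (CubulationVertex H) where
  Adj σ τ := (symmDiff σ.1 τ.1).ncard = 2
  symm := ⟨fun σ τ h => by rwa [symmDiff_comm] at h⟩
  loopless := ⟨fun σ h => by simp at h⟩

namespace CubeComplex

variable {V : Type*} (X : CubeComplex V)

/-- The halfspaces of the wallspace on the vertices of `X` whose walls are the partitions induced
by the hyperplanes outside `𝒥`. The cubulation of this wallspace is the cubical quotient `X / 𝒥`,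
and the canonical map to it sends a vertex to its principal orientation. -/
def quotientHalfspaces (𝒥 : Set (Set (Sym2 V))) : Set (Set V) :=
  {D | ∃ J, X.IsHyperplane J ∧ J ∉ 𝒥 ∧ D ∈ X.halfspaces J}

/-! ### Isometries and their median sets -/

/-- `f` is elliptic: its orbits are bounded. -/
def IsElliptic (f : Equiv.Perm V) : Prop :=
  ∀ x : V, ∃ N : ℕ, ∀ n : ℤ, X.graph.dist x ((f ^ n) x) ≤ N

/-- `f` is loxodromic: it has an axis. -/
def IsLoxodromic (f : Equiv.Perm V) : Prop := ∃ γ : ℤ → V, IsAxis X.graph f γ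

/-- `f` is inverting: its orbits are unbounded and one of its powers inverts a hyperplane. -/
def IsInverting (f : Equiv.Perm V) : Prop :=
  ¬ X.IsElliptic f ∧ (X.invertedHyperplanes f).Nonempty

/-- The dimensions of the cubes stabilised by `f`. -/
def stableCubeDims (f : Equiv.Perm V) : Set ℕ :=
  {n | ∃ C ∈ X.cubes, X.HasDim C n ∧ f '' C = C}

/-- The union of the cubes of minimal dimension among those stabilised by `f`. -/
def minimalStableCubes (f : Equiv.Perm V) : Set V :=
  {x | ∃ C ∈ X.cubes, ∃ n : ℕ, X.HasDim C n ∧ f '' C = C ∧ IsLeast (X.stableCubeDims f) n ∧ x ∈ C}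

/-- The union of the axes of `f`. -/
def unionOfAxes (f : Equiv.Perm V) : Set V :=
  {x | ∃ γ : ℤ → V, IsAxis X.graph f γ ∧ x ∈ Set.range γ}

/-- The pre-image, under the canonical map to the cubical quotient of `X` by the hyperplanes
inverted by powers of `f`, of the union of the axes of the map `F` induced by `f` on the
quotient. -/
def quotientAxes (f : Equiv.Perm V) : Set V :=
  {x | ∃ F : CubulationVertex (X.quotientHalfspaces (X.invertedHyperplanes f)) →
        CubulationVertex (X.quotientHalfspaces (X.invertedHyperplanes f)),
      (∀ σ, (F σ).1 = (fun D : Set V => f '' D) '' σ.1) ∧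
      ∃ γ : ℤ → CubulationVertex (X.quotientHalfspaces (X.invertedHyperplanes f)),
        IsAxis (cubulationGraph (X.quotientHalfspaces (X.invertedHyperplanes f))) F γ ∧
        ∃ n : ℤ,
          (γ n).1 = principalOrientation (X.quotientHalfspaces (X.invertedHyperplanes f)) x}

/-- The median set of an isometry, which is defined by three mutually exclusive cases. -/
def Med (f : Equiv.Perm V) : Set V :=
  {x | (X.IsElliptic f ∧ x ∈ X.minimalStableCubes f) ∨
    (X.IsLoxodromic f ∧ x ∈ X.unionOfAxes f) ∨
    (X.IsInverting f ∧ x ∈ X.quotientAxes f)}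

/-- `m` is a median point of `x`, `y`, `z`. -/
def IsMedianPoint (x y z m : V) : Prop :=
  X.graph.dist x y = X.graph.dist x m + X.graph.dist m y ∧
  X.graph.dist x z = X.graph.dist x m + X.graph.dist m z ∧
  X.graph.dist y z = X.graph.dist y m + X.graph.dist m z

/-- `Y` is a median subalgebra: any three points of `Y` have a unique median point in the complex,
and it belongs to `Y`. -/
def IsMedianSubalgebra (Y : Set V) : Prop :=
  ∀ x ∈ Y, ∀ y ∈ Y, ∀ z ∈ Y, ∃ m ∈ Y, ∀ m' : V, X.IsMedianPoint x y z m' ↔ m' = m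

end CubeComplex

/-! ### Median algebras -/

class MedianAlgebra (M : Type*) where
  med : M → M → M → M
  med_self : ∀ x y, med x y y = y
  med_rotate : ∀ x y z, med x y z = med z x y
  med_swap : ∀ x y z, med x y z = med x z y
  med_assoc : ∀ x y z w, med (med x w y) w z = med x w (med y w z)

namespace MedianAlgebra

/-- The median structure of `{0, 1}`: the majority vote. -/
instance instBool : MedianAlgebra Bool where
  med x y z := (x && y) || (y && z) || (x && z)
  med_self := by decide
  med_rotate := by decide
  med_swap := by decide
  med_assoc := by decide

instance instPi {ι : Type*} {M : ι → Type*} [∀ i, MedianAlgebra (M i)] :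
    MedianAlgebra (∀ i, M i) where
  med x y z := fun i => med (x i) (y i) (z i)
  med_self x y := funext fun i => med_self (x i) (y i)
  med_rotate x y z := funext fun i => med_rotate (x i) (y i) (z i)
  med_swap x y z := funext fun i => med_swap (x i) (y i) (z i)
  med_assoc x y z w := funext fun i => med_assoc (x i) (y i) (z i) (w i)

instance instProd {M N : Type*} [MedianAlgebra M] [MedianAlgebra N] : MedianAlgebra (M × N) where
  med x y z := (med x.1 y.1 z.1, med x.2 y.2 z.2)
  med_self x y := Prod.ext (med_self x.1 y.1) (med_self x.2 y.2)
  med_rotate x y z := Prod.ext (med_rotate x.1 y.1 z.1) (med_rotate x.2 y.2 z.2)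
  med_swap x y z := Prod.ext (med_swap x.1 y.1 z.1) (med_swap x.2 y.2 z.2)
  med_assoc x y z w := Prod.ext (med_assoc x.1 y.1 z.1 w.1) (med_assoc x.2 y.2 z.2 w.2)

variable (M : Type*) [MedianAlgebra M]

/-- The interval between two points. -/
def interval {M : Type*} [MedianAlgebra M] (x y : M) : Set M := {z | med x y z = z}

/-- Convex subsets. -/
def IsConvex {M : Type*} [MedianAlgebra M] (Y : Set M) : Prop :=
  ∀ x ∈ Y, ∀ y ∈ Y, interval x y ⊆ Y

/-- Discrete median algebras: intervals are finite. -/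
def IsDiscrete : Prop := ∀ x y : M, (interval x y).Finite

/-- The halfspaces of a median algebra (which define its walls): the non-empty convex subsets with
non-empty convex complements. -/
def halfspaces : Set (Set M) := {A | A.Nonempty ∧ Aᶜ.Nonempty ∧ IsConvex A ∧ IsConvex Aᶜ}

/-- The one-skeleton of the cubulation of a discrete median algebra: two points are adjacent when
they are separated by exactly one wall, i.e. when exactly one halfspace contains the first point
but not the second. -/
def graph : SimpleGraph M where
  Adj x y := ∃! A, A ∈ halfspaces M ∧ x ∈ A ∧ y ∉ A
  symm := ⟨fun x y h => by
    obtain ⟨A, ⟨⟨h1, h2, h3, h4⟩, hx, hy⟩, hu⟩ := h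
    refine ⟨Aᶜ, ⟨⟨h2, by rwa [compl_compl], h4, by rwa [compl_compl]⟩, hy, fun h => h hx⟩, ?_⟩
    rintro B ⟨⟨k1, k2, k3, k4⟩, ky, kx⟩
    have := hu Bᶜ ⟨⟨k2, by rwa [compl_compl], k4, by rwa [compl_compl]⟩, kx, fun h => h ky⟩
    rw [← this, compl_compl]⟩
  loopless := ⟨fun x h => by
    obtain ⟨A, ⟨_, hx, hy⟩, _⟩ := h
    exact hy hx⟩

/-- The cubes of the cubulation, which fill in all the subgraphs isomorphic to one-skeleta of
cubes, have bounded dimension. -/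
def IsFiniteDimensional : Prop := ∃ d : ℕ, ∀ n : ℕ, (hypercube n).IsContained (graph M) → n ≤ d

/-- The Roller boundary: the orientations of the wallspace which are not principal. -/
def rollerBoundary : Set (Set (Set M)) :=
  {σ | IsOrientation (halfspaces M) σ ∧ σ ∉ Set.range (principalOrientation (halfspaces M))}

/-- The median operation of the Roller compactification: the halfspaces which belong to at least
two of three orientations. -/
def orientationMed {M : Type*} (σ τ ρ : Set (Set M)) : Set (Set M) := (σ ∩ τ) ∪ (τ ∩ ρ) ∪ (σ ∩ ρ)

/-- Median flats: non-empty finite-dimensional discrete median algebras included in the interval of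
two points of their Roller boundaries. -/
def IsMedianFlat : Prop :=
  Nonempty M ∧ IsFiniteDimensional M ∧ IsDiscrete M ∧
    ∃ ζ ∈ rollerBoundary M, ∃ ξ ∈ rollerBoundary M, ∀ x : M,
      orientationMed ζ ξ (principalOrientation (halfspaces M) x) =
        principalOrientation (halfspaces M) x

/-- `M` is a cube of dimension `d`: it is isomorphic to the median algebra `{0,1}^d`. -/
def IsCube (d : ℕ) : Prop :=
  ∃ e : M ≃ (Fin d → Bool), ∀ x y z : M, e (med x y z) = med (e x) (e y) (e z)

/-- An action on a median algebra by automorphisms. -/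
def IsMedianAction (G : Type*) [Group G] [MulAction G M] : Prop :=
  ∀ (h : G) (x y z : M), h • med x y z = med (h • x) (h • y) (h • z)

/-- `f` acts on the discrete median algebra `M` by translations of length `l`: every point lies on
a bi-infinite geodesic of the cubulation which `f` translates by `l`. -/
def ActsByTranslations (f : M → M) (l : ℕ) : Prop :=
  ∀ x : M, ∃ γ : ℤ → M, IsGeodesicLine (graph M) γ ∧ γ 0 = x ∧ ∀ n : ℤ, f (γ n) = γ (n + l)

end MedianAlgebra

/-! The proof works with halfspaces throughout, and replaces the three definitions of the median set
by a single one.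

Foundations. Edge paths are considered up to pushing across squares. Flag links make this calculus
coherent (`IsNonpositivelyCurved.swapEq_cons_cons`), so walks act on classes of reduced paths, and
simple connectivity makes the reduced path between two vertices unique up to squares
(`IsCAT0.swapEq_of_isReduced`). This gives the quadrangle condition, and with it the usual facts:
hyperplanes are cuts between halfspaces, the distance counts separating halfspaces, and medians
exist (`IsCAT0.isMedianWallspace`).

The median set. Let `f` be the permutation given by `g`. A halfspace is inverted if a power of `f`
exchanges it with its complement, and stable otherwise. There are finitely many inverted walls,
pairwise transverse. Let `medSet` consist of the vertices whose orbit crosses each stable wall at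
most once. It is non-empty (`medSet_nonempty`): the orbit of any vertex can be straightened by
reorienting finitely many walls. At its points the number of stable halfspaces separating `x` from
`f x` is multiplied by `k` when `f` is replaced by its `k`-th power, and inverted walls only
contribute a bounded error. If this number is zero, the points with prescribed stable sides form
minimal stabilised cubes; if it is positive and no wall is inverted, the orbits lie on axes; in the
remaining case the same holds in the cubical quotient, whose metric counts stable halfspaces only.
Hence `IsCAT0.med_eq`.

The product. Two orbits in `medSet` cannot cross a wall in opposite directions, so `medSet` is
stable under medians (`med_mem_medSet`). Stable halfspaces are axial if some orbit in `medSet`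
crosses them, transverse otherwise. A vertex is determined by its sides of the transverse, axial and
inverted walls, and in `medSet` these three data can be prescribed independently
(`exists_transverse_axial`, `exists_inverted`). The factors are the three resulting spaces of
traces. Transverse sides are constant along orbits, so `g` fixes `T`; the inverted walls give all
the coordinates of a cube `Q`. Every axial wall separates the two ends of an orbit, which places `F`
between two points of its Roller boundary; walls adjacent to one point of `F` lie in distinct orbits
of `f`, of which there are finitely many, so `F` is finite-dimensional (`isMedianFlat_axial`). An
element that conjugates `f` to a power preserves each of these classes of halfspaces, hence acts
factor by factor. -/

namespace CubeComplex

variable {V : Type*} {X : CubeComplex V}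

/-! ### Squares -/

/-- `a`, `b`, `c`, `d` are the consecutive vertices of a square. -/
def Sq (X : CubeComplex V) (a b c d : V) : Prop :=
  a ≠ c ∧ b ≠ d ∧ X.graph.Adj a b ∧ X.graph.Adj b c ∧ X.graph.Adj c d ∧ X.graph.Adj d a ∧
    ({a, b, c, d} : Set V) ∈ X.cubes

theorem Sq.rotate {a b c d : V} (h : X.Sq a b c d) : X.Sq b c d a := by
  obtain ⟨h1, h2, h3, h4, h5, h6, h7⟩ := h
  refine ⟨h2, h1.symm, h4, h5, h6, h3, ?_⟩
  convert h7 using 1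
  ext x; simp; tauto

theorem Sq.flip {a b c d : V} (h : X.Sq a b c d) : X.Sq a d c b := by
  obtain ⟨h1, h2, h3, h4, h5, h6, h7⟩ := h
  refine ⟨h1, h2.symm, h6.symm, h5.symm, h4.symm, h3.symm, ?_⟩
  convert h7 using 1
  ext x; simp; tauto

theorem ncard_of_hasDim {C : Set V} {n : ℕ} (h : X.HasDim C n) : C.ncard = 2 ^ n := by
  obtain ⟨e⟩ := h
  rw [← Nat.card_coe_set_eq, ← Nat.card_congr e.toEquiv]
  simp

/-- Two squares sharing `a`, `b`, `c` meet in a face, whose number of vertices is a power of two. It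
is at least three, and would be exactly three if the fourth vertices differed. -/
theorem Sq.eq_of_sq {a b c d d' : V} (h : X.Sq a b c d) (h' : X.Sq a b c d') : d = d' := by
  classical
  obtain ⟨h1, h2, h3, h4, h5, h6, h7⟩ := h
  obtain ⟨-, k2, k3, k4, k5, k6, k7⟩ := h'
  have hne : (({a, b, c, d} : Set V) ∩ {a, b, c, d'}).Nonempty := ⟨a, by simp, by simp⟩
  have hface := X.face_mem _ h7 _ (X.inter_face _ h7 _ k7 hne)
  obtain ⟨n, hn⟩ := X.exists_dim _ hface
  have hcard := ncard_of_hasDim hn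
  have hsub : ({a, b, c} : Set V) ⊆ ({a, b, c, d} : Set V) ∩ {a, b, c, d'} := by
    intro x hx; simp at hx ⊢; tauto
  have h3le : 3 ≤ (({a, b, c, d} : Set V) ∩ {a, b, c, d'}).ncard := by
    have : ({a, b, c} : Set V).ncard = 3 := Set.ncard_eq_three.2 ⟨a, b, c, h3.ne, h1, h4.ne, rfl⟩
    rw [← this]
    exact Set.ncard_le_ncard hsub (Set.toFinite _)
  by_contra hd
  have heq : ({a, b, c, d} : Set V) ∩ {a, b, c, d'} = {a, b, c} := by
    apply Set.Subset.antisymm _ hsub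
    rintro x ⟨hx, hx'⟩
    simp only [Set.mem_insert_iff, Set.mem_singleton_iff] at hx hx' ⊢
    rcases hx with rfl | rfl | rfl | rfl
    · tauto
    · tauto
    · tauto
    · rcases hx' with h | h | h | h <;> tauto
  rw [heq, Set.ncard_eq_three.2 ⟨a, b, c, h3.ne, h1, h4.ne, rfl⟩] at hcard
  rcases n with _ | _ | n
  · simp at hcard
  · simp at hcard
  · rw [pow_succ, pow_succ] at hcard; omega

end CubeComplex

/-! ### Cubes in coordinates -/

/-- The vertex of the `n`-cube which differs from `v` in the coordinate `i` only. -/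
def flipAt {n : ℕ} (i : Fin n) (v : Fin n → Bool) : Fin n → Bool := Function.update v i (!v i)

theorem flipAt_same {n : ℕ} (i : Fin n) (v : Fin n → Bool) : flipAt i v i = !v i := by
  simp [flipAt]

theorem flipAt_of_ne {n : ℕ} {i j : Fin n} (h : j ≠ i) (v : Fin n → Bool) :
    flipAt i v j = v j := by simp [flipAt, h]

theorem hypercube_adj_iff {n : ℕ} {v w : Fin n → Bool} :
    (hypercube n).Adj v w ↔ ∃ i, w = flipAt i v := by
  constructor
  · rintro ⟨i, hi, hu⟩
    refine ⟨i, funext fun j => ?_⟩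
    by_cases hj : j = i
    · subst hj; rw [flipAt_same]
      revert hi; cases v j <;> cases w j <;> simp
    · rw [flipAt_of_ne hj]
      by_contra h
      exact hj (hu j (Ne.symm h))
  · rintro ⟨i, rfl⟩
    refine ⟨i, by simp [flipAt_same], fun j hj => ?_⟩
    by_contra h
    exact hj (flipAt_of_ne h v).symm

theorem flipAt_comm {n : ℕ} {i j : Fin n} (h : i ≠ j) (v : Fin n → Bool) :
    flipAt i (flipAt j v) = flipAt j (flipAt i v) := by
  funext k
  by_cases hi : k = i
  · subst hi; rw [flipAt_same, flipAt_of_ne h, flipAt_of_ne h, flipAt_same]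
  · by_cases hj : k = j
    · subst hj; rw [flipAt_same, flipAt_of_ne hi, flipAt_same, flipAt_of_ne hi]
    · simp [flipAt_of_ne, hi, hj]

theorem flipAt_flipAt {n : ℕ} (i : Fin n) (v : Fin n → Bool) : flipAt i (flipAt i v) = v := by
  funext k
  by_cases hi : k = i
  · subst hi; simp [flipAt_same]
  · simp [flipAt_of_ne, hi]

namespace CubeComplex

variable {V : Type*} {X : CubeComplex V}

theorem adj_flipAt {C : Set V} {n : ℕ} (e : hypercube n ≃g X.graph.induce C)
    (v : Fin n → Bool) (i : Fin n) : X.graph.Adj (e v) (e (flipAt i v)) := by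
  have : (hypercube n).Adj v (flipAt i v) := hypercube_adj_iff.2 ⟨i, rfl⟩
  exact (e.map_rel_iff.2 this)

theorem exists_eq_flipAt {C : Set V} {n : ℕ} (e : hypercube n ≃g X.graph.induce C)
    (v : Fin n → Bool) {y : V} (hy : y ∈ C) (h : X.graph.Adj (e v) y) :
    ∃ i, y = e (flipAt i v) := by
  obtain ⟨w, hw⟩ := e.surjective ⟨y, hy⟩
  have h' : (X.graph.induce C).Adj (e v) (e w) := by
    rw [hw]; exact h
  obtain ⟨i, rfl⟩ := hypercube_adj_iff.1 (e.map_rel_iff.1 h')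
  exact ⟨i, by rw [hw]⟩

theorem sq_flipAt {C : Set V} (hC : C ∈ X.cubes) {n : ℕ} (e : hypercube n ≃g X.graph.induce C)
    (v : Fin n → Bool) {i j : Fin n} (hij : i ≠ j) :
    X.Sq (e v) (e (flipAt i v)) (e (flipAt j (flipAt i v))) (e (flipAt j v)) := by
  have hinj : ∀ {w w'}, (e w : V) = e w' → w = w' := fun h => e.injective (Subtype.ext h)
  refine ⟨fun h => ?_, fun h => ?_, adj_flipAt e _ _, adj_flipAt e _ _, ?_, ?_, ?_⟩
  · have := congrFun (hinj h) i
    rw [flipAt_of_ne hij, flipAt_same] at this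
    revert this; cases v i <;> simp
  · have := congrFun (hinj h) i
    rw [flipAt_of_ne hij, flipAt_same] at this
    revert this; cases v i <;> simp
  · rw [flipAt_comm hij.symm]; exact (adj_flipAt e _ _).symm
  · exact (adj_flipAt e _ _).symm
  · refine X.face_mem C hC _ ⟨n, e, {i, j}ᶜ, v, ?_⟩
    ext x
    simp only [Set.mem_insert_iff, Set.mem_singleton_iff, Set.mem_ofPred_eq]
    constructor
    · rintro (rfl | rfl | rfl | rfl)
      · exact ⟨v, fun _ _ => rfl, rfl⟩
      · refine ⟨_, fun k hk => ?_, rfl⟩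
        simp at hk
        rw [flipAt_of_ne hk.1]
      · refine ⟨_, fun k hk => ?_, rfl⟩
        simp at hk
        rw [flipAt_of_ne hk.2, flipAt_of_ne hk.1]
      · refine ⟨_, fun k hk => ?_, rfl⟩
        simp at hk
        rw [flipAt_of_ne hk.2]
    · rintro ⟨w, hw, rfl⟩
      have hw' : ∀ k, k ≠ i → k ≠ j → w k = v k := fun k h1 h2 => hw k (by simp [h1, h2])
      by_cases h1 : w i = v i <;> by_cases h2 : w j = v j
      · left
        congr 2; funext k
        by_cases hk : k = i
        · rw [hk, h1]
        by_cases hk' : k = j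
        · rw [hk', h2]
        exact hw' k hk hk'
      · right; right; right
        congr 2; funext k
        by_cases hk' : k = j
        · subst hk'; rw [flipAt_same]; revert h2; cases w k <;> cases v k <;> simp
        rw [flipAt_of_ne hk']
        by_cases hk : k = i
        · rw [hk, h1]
        exact hw' k hk hk'
      · right; left
        congr 2; funext k
        by_cases hk' : k = i
        · subst hk'; rw [flipAt_same]; revert h1; cases w k <;> cases v k <;> simp
        rw [flipAt_of_ne hk']
        by_cases hk : k = j
        · rw [hk, h2]
        exact hw' k hk' hk
      · right; right; left
        congr 2; funext k
        by_cases hk' : k = j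
        · subst hk'; rw [flipAt_same, flipAt_of_ne hij.symm]
          revert h2; cases w k <;> cases v k <;> simp
        rw [flipAt_of_ne hk']
        by_cases hk : k = i
        · subst hk; rw [flipAt_same]; revert h1; cases w k <;> cases v k <;> simp
        rw [flipAt_of_ne hk]
        exact hw' k hk hk'

/-- In a nonpositively curved cube complex, neighbours of `c` that pairwise span squares with `c`
span a cube with `c`. -/
theorem IsNonpositivelyCurved.exists_cube (hX : X.IsNonpositivelyCurved) {c : V} {s : Finset V}
    (hs : ∀ a ∈ s, X.graph.Adj c a)
    (hsq : ∀ a ∈ s, ∀ b ∈ s, a ≠ b → ∃ m, X.Sq c a m b) :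
    ∃ C ∈ X.cubes, c ∈ C ∧ (s : Set V) ⊆ C := by
  classical
  refine (hX c s hs fun a ha b hb => ?_).2
  by_cases hab : a = b
  · subst hab
    refine ⟨{a}, ⟨by simpa using hs a ha, {c, a}, X.edge_mem _ _ (hs a ha), by simp, by simp⟩,
      by simp, by simp⟩
  · obtain ⟨m, hm⟩ := hsq a ha b hb hab
    refine ⟨{a, b}, ⟨?_, _, hm.2.2.2.2.2.2, by simp, ?_⟩, by simp, by simp⟩
    · simp [hs a ha, hs b hb]
    · intro x; simp; tauto

/-- The flag condition fills the corner at `c`; `t` is opposite to `c` in the three-dimensional face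
spanned by `p`, `q` and `r`. -/
theorem IsNonpositivelyCurved.sq_cube (hX : X.IsNonpositivelyCurved) {c p q r a b d : V}
    (hpq : X.Sq c p a q) (hqr : X.Sq c q b r) (hpr : X.Sq c p d r) :
    ∃ t, X.Sq p a t d ∧ X.Sq q a t b ∧ X.Sq r b t d := by
  classical
  obtain ⟨C, hC, hcC, hsC⟩ := hX.exists_cube (c := c) (s := {p, q, r})
    (by simp [hpq.2.2.1, hqr.2.2.1, hpr.2.2.2.2.2.1.symm]) (by
      intro x hx y hy hxy
      simp only [Finset.mem_insert, Finset.mem_singleton] at hx hy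
      rcases hx with rfl | rfl | rfl <;> rcases hy with rfl | rfl | rfl <;>
        first
          | exact absurd rfl hxy
          | exact ⟨_, hpq⟩ | exact ⟨_, hqr⟩ | exact ⟨_, hpr⟩
          | exact ⟨_, hpq.flip⟩ | exact ⟨_, hqr.flip⟩ | exact ⟨_, hpr.flip⟩)
  obtain ⟨n, ⟨e⟩⟩ := X.exists_dim C hC
  obtain ⟨v, hv⟩ := e.surjective ⟨c, hcC⟩
  have hc : c = e v := by rw [hv]
  subst hc
  obtain ⟨i, rfl⟩ := exists_eq_flipAt e v (y := p) (hsC (by simp)) hpq.2.2.1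
  obtain ⟨j, rfl⟩ := exists_eq_flipAt e v (y := q) (hsC (by simp)) hqr.2.2.1
  obtain ⟨k, rfl⟩ := exists_eq_flipAt e v (y := r) (hsC (by simp)) hpr.2.2.2.2.2.1.symm
  have hij : i ≠ j := by rintro rfl; exact hpq.2.1 rfl
  have hjk : j ≠ k := by rintro rfl; exact hqr.2.1 rfl
  have hik : i ≠ k := by rintro rfl; exact hpr.2.1 rfl
  have key : ∀ {i j m}, i ≠ j → X.Sq (e v) (e (flipAt i v)) m (e (flipAt j v)) →
      m = e (flipAt j (flipAt i v)) := by
    intro i j m hij h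
    exact h.rotate.rotate.rotate.eq_of_sq (sq_flipAt hC e v hij).rotate.rotate.rotate
  rw [key hij hpq, key hjk hqr, key hik hpr]
  refine ⟨e (flipAt k (flipAt j (flipAt i v))), sq_flipAt hC e _ hjk, ?_, ?_⟩
  · rw [flipAt_comm hij.symm]
    exact sq_flipAt hC e _ hik
  · rw [flipAt_comm hij.symm, flipAt_comm hjk.symm, flipAt_comm hik.symm, flipAt_comm hik.symm,
      flipAt_comm hjk.symm]
    exact sq_flipAt hC e _ hij.symm

/-! ### Edge paths up to squares

An edge path is recorded as the list of its vertices, in reverse order. -/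

/-- Two lists differ by pushing two consecutive edges across a square. -/
inductive Swap (X : CubeComplex V) : List V → List V → Prop
  | head {a b c d : V} (l : List V) : X.Sq a b c d → X.Swap (a :: b :: c :: l) (a :: d :: c :: l)
  | cons (a : V) {l l' : List V} : X.Swap l l' → X.Swap (a :: l) (a :: l')

theorem Swap.symm {l l' : List V} (h : X.Swap l l') : X.Swap l' l := by
  induction h with
  | head l h => exact .head l h.flip
  | cons a _ ih => exact .cons a ih

/-- Equality up to pushing across squares. -/
def SwapEq (X : CubeComplex V) : List V → List V → Prop := Relation.ReflTransGen X.Swap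

theorem SwapEq.refl (l : List V) : X.SwapEq l l := Relation.ReflTransGen.refl

theorem SwapEq.trans {l l' l'' : List V} (h : X.SwapEq l l') (h' : X.SwapEq l' l'') :
    X.SwapEq l l'' := Relation.ReflTransGen.trans h h'

theorem SwapEq.symm {l l' : List V} (h : X.SwapEq l l') : X.SwapEq l' l := by
  induction h with
  | refl => exact .refl _
  | tail _ h ih => exact (Relation.ReflTransGen.single h.symm).trans ih

theorem SwapEq.cons (a : V) {l l' : List V} (h : X.SwapEq l l') :
    X.SwapEq (a :: l) (a :: l') := by
  induction h with
  | refl => exact .refl _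
  | tail _ h ih => exact ih.tail (.cons a h)

theorem SwapEq.head {a b c d : V} (l : List V) (h : X.Sq a b c d) :
    X.SwapEq (a :: b :: c :: l) (a :: d :: c :: l) := .single (.head l h)

theorem Swap.length_eq {l l' : List V} (h : X.Swap l l') : l.length = l'.length := by
  induction h with
  | head l h => rfl
  | cons a _ ih => simp [ih]

theorem SwapEq.length_eq {l l' : List V} (h : X.SwapEq l l') : l.length = l'.length := by
  induction h with
  | refl => rfl
  | tail _ h ih => exact ih.trans h.length_eq

theorem Swap.exists_cons {y : V} {p l : List V} (h : X.Swap (y :: p) l) : ∃ q, l = y :: q := by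
  cases h <;> exact ⟨_, rfl⟩

theorem SwapEq.exists_cons {y : V} {p l : List V} (h : X.SwapEq (y :: p) l) :
    ∃ q, l = y :: q := by
  induction h with
  | refl => exact ⟨_, rfl⟩
  | tail _ h ih => obtain ⟨q, rfl⟩ := ih; exact h.exists_cons

/-- Coherence of square moves: equivalent paths with different last edges are related by one square
at the end, after moves that keep the last edge of each. The proof is by induction on the length,
then on the number of moves. -/
theorem IsNonpositivelyCurved.swapEq_cons_cons (hX : X.IsNonpositivelyCurved) {y z₁ z₂ : V}
    {p q : List V} (h : X.SwapEq (y :: z₁ :: p) (y :: z₂ :: q)) :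
    (z₁ = z₂ ∧ X.SwapEq (z₁ :: p) (z₂ :: q)) ∨
      ∃ v r, X.Sq y z₁ v z₂ ∧ X.SwapEq (z₁ :: p) (z₁ :: v :: r) ∧
        X.SwapEq (z₂ :: q) (z₂ :: v :: r) := by
  induction hn : p.length using Nat.strong_induction_on generalizing y z₁ z₂ p q with
  | _ n IH =>
  subst hn
  generalize hl : y :: z₂ :: q = l at h
  induction h generalizing z₂ q with
  | refl =>
    obtain ⟨-, rfl, rfl⟩ : y = y ∧ z₂ = z₁ ∧ q = p := by simpa using hl
    exact Or.inl ⟨rfl, .refl _⟩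
  | tail hb hs ih =>
    subst hl
    cases hs with
    | @cons _ l' _ hs =>
      obtain ⟨q', rfl⟩ := hs.symm.exists_cons
      have h1 : X.SwapEq (z₂ :: q') (z₂ :: q) := .single hs
      rcases ih rfl with ⟨rfl, h⟩ | ⟨v, r, h, h', h''⟩
      · exact Or.inl ⟨rfl, h.trans h1⟩
      · exact Or.inr ⟨v, r, h, h', h1.symm.trans h''⟩
    | @head _ b v _ r hsq =>
      rcases ih rfl with ⟨rfl, h⟩ | ⟨v', r', h, h', h''⟩
      · exact Or.inr ⟨v, r, hsq, h, .refl _⟩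
      · have hlen := h'.length_eq
        have hlen' := h''.length_eq
        simp only [List.length_cons] at hlen hlen'
        rcases IH r.length (by omega) h'' rfl with ⟨rfl, hr⟩ | ⟨s, t, hs, hr, hr'⟩
        · exact Or.inl ⟨h.flip.eq_of_sq hsq, by
            rw [← h.flip.eq_of_sq hsq]; exact h'.trans (hr.symm.cons _)⟩
        -- Three squares meet at `b`, on its neighbours `y`, `v'` and `v`. The vertex `m` opposite
        -- to `b` in the cube closes the required square at `y`.
        · obtain ⟨m, h1, h2, h3⟩ :=
            hX.sq_cube h.rotate.rotate.rotate hs.flip hsq.rotate.flip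
          exact Or.inr ⟨m, s :: t, h1,
            h'.trans ((hr'.cons _).trans (.head _ h2.flip.rotate.rotate.rotate)),
            (hr.cons _).trans (.head _ h3.rotate.rotate.rotate)⟩

/-- The edge path contains a backtrack. -/
inductive Backtracks : List V → Prop
  | head (a b : V) (l : List V) : Backtracks (a :: b :: a :: l)
  | cons (a : V) {l : List V} : Backtracks l → Backtracks (a :: l)

/-- The edge path cannot be shortened after being pushed across squares. -/
def IsReduced (X : CubeComplex V) (l : List V) : Prop :=
  ∀ l', X.SwapEq l l' → ¬ Backtracks l'

theorem IsReduced.tail {a : V} {l : List V} (h : X.IsReduced (a :: l)) : X.IsReduced l :=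
  fun _ h1 h2 => h _ (h1.cons a) (.cons a h2)

theorem IsReduced.congr {l l' : List V} (h : X.IsReduced l) (h' : X.SwapEq l l') :
    X.IsReduced l' := fun _ h1 h2 => h _ (h'.trans h1) h2

theorem isReduced_singleton (a : V) : X.IsReduced [a] := by
  intro l h hb
  have hl := h.length_eq
  have : ∀ l : List V, Backtracks l → 3 ≤ l.length := by
    intro l h
    induction h with
    | head => simp
    | cons _ _ ih => simp; omega
  have := this l hb
  simp at hl; omega

/-- An edge that spoils reducedness must cancel against the path. By `swapEq_cons_cons`, the
backtrack either uses this edge, or lies in a path obtained by crossing a square, to which the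
induction hypothesis applies after removing the last edge of `y :: p`. -/
theorem IsNonpositivelyCurved.swapEq_of_not_isReduced (hX : X.IsNonpositivelyCurved) {y z : V}
    {p : List V} (hp : X.IsReduced (y :: p)) (h : ¬ X.IsReduced (z :: y :: p)) :
    ∃ u, X.SwapEq (y :: p) (y :: z :: u) := by
  induction hn : p.length using Nat.strong_induction_on generalizing y z p with
  | _ n IH =>
  subst hn
  simp only [IsReduced, not_forall, not_not] at h
  obtain ⟨l, hl, hb⟩ := h
  cases hb with
  | head a b l =>
    obtain ⟨_, h⟩ := hl.exists_cons
    obtain rfl : a = z := by simpa using (List.cons.inj h).1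
    rcases hX.swapEq_cons_cons hl with ⟨rfl, h⟩ | ⟨v, r, hs, h1, h2⟩
    · exact ⟨l, h⟩
    · rcases hX.swapEq_cons_cons h2 with ⟨rfl, -⟩ | ⟨s, t, hs', h3, h4⟩
      · exact absurd rfl hs.1
      · have : y = s := hs.flip.eq_of_sq hs'.flip.rotate.rotate.rotate
        subst this
        exact absurd (.head _ _ _) (hp _ (h1.trans (h4.cons y)))
  | @cons a l hb =>
    obtain ⟨_, h⟩ := hl.exists_cons
    obtain rfl : a = z := by simpa using (List.cons.inj h).1
    obtain ⟨y', q, rfl⟩ : ∃ y' q, l = y' :: q := by cases hb <;> exact ⟨_, _, rfl⟩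
    rcases hX.swapEq_cons_cons hl with ⟨rfl, h⟩ | ⟨v, r, hs, h1, h2⟩
    · exact absurd hb (hp _ h)
    · have hv : X.IsReduced (v :: r) := (hp.congr h1).tail
      have hlen := h1.length_eq
      simp only [List.length_cons] at hlen
      obtain ⟨u, hu⟩ := IH r.length (by omega) hv (fun h => h _ h2.symm hb) rfl
      exact ⟨y' :: u, (h1.trans (hu.cons y)).trans (.head _ hs.rotate)⟩

end CubeComplex

/-! ### The action of walks on reduced paths, and the quadrangle condition -/

namespace CubeComplex

variable {V : Type*} {X : CubeComplex V}

open Classical in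
/-- The reduced path obtained from the reduced path `l` by adding the edge from its end to `z`. -/
noncomputable def step (X : CubeComplex V) (l : List V) (z : V) : List V :=
  match l with
  | [] => [z]
  | y :: p => if h : ∃ u, X.SwapEq (y :: p) (y :: z :: u) then z :: h.choose else z :: y :: p

theorem IsNonpositivelyCurved.swapEq_tail (hX : X.IsNonpositivelyCurved) {y z : V} {p q : List V}
    (h : X.SwapEq (y :: z :: p) (y :: z :: q)) : X.SwapEq (z :: p) (z :: q) := by
  rcases hX.swapEq_cons_cons h with ⟨-, h⟩ | ⟨v, r, hs, -⟩
  · exact h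
  · exact absurd rfl hs.2.1

theorem IsNonpositivelyCurved.step_of_swapEq (hX : X.IsNonpositivelyCurved) {y z : V}
    {p u : List V} (h : X.SwapEq (y :: p) (y :: z :: u)) :
    X.SwapEq (X.step (y :: p) z) (z :: u) := by
  have h' : ∃ u, X.SwapEq (y :: p) (y :: z :: u) := ⟨u, h⟩
  simp only [step, dif_pos h']
  exact hX.swapEq_tail (h'.choose_spec.symm.trans h)

theorem step_of_isReduced {y z : V} {p : List V} (h : X.IsReduced (z :: y :: p)) :
    X.step (y :: p) z = z :: y :: p := by
  have h' : ¬ ∃ u, X.SwapEq (y :: p) (y :: z :: u) := fun ⟨u, hu⟩ => h _ (hu.cons z) (.head _ _ _)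
  simp only [step, dif_neg h']

theorem exists_step_eq_cons (l : List V) (z : V) : ∃ p, X.step l z = z :: p := by
  cases l with
  | nil => exact ⟨_, rfl⟩
  | cons y p =>
    simp only [step]
    split_ifs <;> exact ⟨_, rfl⟩

theorem IsNonpositivelyCurved.isReduced_step (hX : X.IsNonpositivelyCurved) {y : V} {p : List V}
    (h : X.IsReduced (y :: p)) (z : V) : X.IsReduced (X.step (y :: p) z) := by
  by_cases hz : X.IsReduced (z :: y :: p)
  · rwa [step_of_isReduced hz]
  · obtain ⟨u, hu⟩ := hX.swapEq_of_not_isReduced h hz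
    exact (h.congr hu).tail.congr (hX.step_of_swapEq hu).symm

theorem IsNonpositivelyCurved.step_congr (hX : X.IsNonpositivelyCurved) {y z : V} {p q : List V}
    (h : X.IsReduced (y :: p)) (hpq : X.SwapEq (y :: p) (y :: q)) :
    X.SwapEq (X.step (y :: p) z) (X.step (y :: q) z) := by
  by_cases hz : X.IsReduced (z :: y :: p)
  · rw [step_of_isReduced hz, step_of_isReduced (hz.congr (hpq.cons z))]
    exact hpq.cons z
  · obtain ⟨u, hu⟩ := hX.swapEq_of_not_isReduced h hz
    exact (hX.step_of_swapEq hu).trans (hX.step_of_swapEq (hpq.symm.trans hu)).symm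

/-- This is the invariance of the action under the removal of a backtrack. -/
theorem IsNonpositivelyCurved.step_step (hX : X.IsNonpositivelyCurved) {y : V} {p : List V}
    (h : X.IsReduced (y :: p)) (z : V) :
    X.SwapEq (X.step (X.step (y :: p) z) y) (y :: p) := by
  by_cases hz : X.IsReduced (z :: y :: p)
  · rw [step_of_isReduced hz]
    exact hX.step_of_swapEq (.refl _)
  · obtain ⟨u, hu⟩ := hX.swapEq_of_not_isReduced h hz
    have h1 := hX.step_of_swapEq hu
    obtain ⟨q, hq⟩ := X.exists_step_eq_cons (y :: p) z
    have h2 : X.IsReduced (y :: z :: u) := h.congr hu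
    rw [hq] at h1 ⊢
    have h3 := hX.step_congr (z := y) (h2.tail.congr h1.symm) h1
    rw [step_of_isReduced h2] at h3
    exact h3.trans hu.symm

theorem IsNonpositivelyCurved.step_sq_of_isReduced (hX : X.IsNonpositivelyCurved) {y a b c : V}
    {p : List V} (hs : X.Sq y a c b) (ha : X.IsReduced (a :: y :: p)) :
    X.SwapEq (X.step (X.step (y :: p) a) c) (X.step (X.step (y :: p) b) c) := by
  rw [step_of_isReduced ha]
  by_cases hc : X.IsReduced (c :: a :: y :: p)
  · have h1 : X.SwapEq (c :: a :: y :: p) (c :: b :: y :: p) := .head _ hs.rotate.rotate.flip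
    have h2 := hc.congr h1
    rw [step_of_isReduced h2.tail, step_of_isReduced hc, step_of_isReduced h2]
    exact h1
  · obtain ⟨u, hu⟩ := hX.swapEq_of_not_isReduced ha hc
    rcases hX.swapEq_cons_cons hu with ⟨rfl, -⟩ | ⟨s, r, hs', h1, h2⟩
    · exact absurd rfl hs.1
    · have : b = s := hs.rotate.rotate.flip.eq_of_sq hs'.rotate.rotate.rotate
      subst this
      have h3 := hX.step_of_swapEq h1
      have h4 : X.IsReduced (c :: b :: r) := (ha.congr hu).tail.congr h2
      have h5 : X.IsReduced (b :: r) := h4.tail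
      obtain ⟨q, hq⟩ := X.exists_step_eq_cons (y :: p) b
      rw [hq] at h3 ⊢
      have h6 := hX.step_congr (z := c) h5 h3.symm
      rw [step_of_isReduced h4] at h6
      exact (hX.step_of_swapEq hu).trans (h2.trans h6)

/-- This is the invariance of the action under pushing across a square. If both edges at `y` cancel
against the path, then the path can be pushed so as to arrive through the square, and both sides
reduce to the same remainder. -/
theorem IsNonpositivelyCurved.step_sq (hX : X.IsNonpositivelyCurved) {y a b c : V}
    {p : List V} (hs : X.Sq y a c b) (h : X.IsReduced (y :: p)) :
    X.SwapEq (X.step (X.step (y :: p) a) c) (X.step (X.step (y :: p) b) c) := by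
  by_cases ha : X.IsReduced (a :: y :: p)
  · exact hX.step_sq_of_isReduced hs ha
  by_cases hb : X.IsReduced (b :: y :: p)
  · exact (hX.step_sq_of_isReduced hs.flip hb).symm
  obtain ⟨u, hu⟩ := hX.swapEq_of_not_isReduced h ha
  obtain ⟨w, hw⟩ := hX.swapEq_of_not_isReduced h hb
  rcases hX.swapEq_cons_cons (hu.symm.trans hw) with ⟨rfl, -⟩ | ⟨s, r, hs', h1, h2⟩
  · exact absurd rfl hs.2.1
  have : c = s := by
    exact hs.rotate.rotate.rotate.eq_of_sq hs'.rotate.rotate.rotate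
  subst this
  have key : ∀ {a u}, X.SwapEq (y :: p) (y :: a :: u) → X.SwapEq (a :: u) (a :: c :: r) →
      X.SwapEq (X.step (X.step (y :: p) a) c) (c :: r) := by
    intro a u hu h1
    have h3 := (hX.step_of_swapEq hu).trans h1
    obtain ⟨q, hq⟩ := X.exists_step_eq_cons (y :: p) a
    rw [hq] at h3 ⊢
    exact hX.step_of_swapEq h3
  exact (key hu h1).trans (key hw h2).symm

/-- The reduced path obtained from a reduced path by adding the edges of a walk. -/
noncomputable def act (X : CubeComplex V) : ∀ {x y : V}, List V → X.graph.Walk x y → List V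
  | _, _, l, .nil => l
  | _, _, l, .cons (v := z) _ p => X.act (X.step l z) p

theorem IsNonpositivelyCurved.act_spec (hX : X.IsNonpositivelyCurved) {x y : V}
    (w : X.graph.Walk x y) {p : List V} (h : X.IsReduced (x :: p)) :
    X.IsReduced (X.act (x :: p) w) ∧ ∃ q, X.act (x :: p) w = y :: q := by
  induction w generalizing p with
  | nil => exact ⟨h, _, rfl⟩
  | cons hadj w ih =>
    rename_i a b c
    obtain ⟨q, hq⟩ := X.exists_step_eq_cons (a :: p) b
    have := hX.isReduced_step h b
    simp only [act]
    rw [hq] at this ⊢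
    exact ih this

theorem IsNonpositivelyCurved.act_congr (hX : X.IsNonpositivelyCurved) {x y : V}
    (w : X.graph.Walk x y) {p q : List V} (h : X.IsReduced (x :: p))
    (hpq : X.SwapEq (x :: p) (x :: q)) :
    X.SwapEq (X.act (x :: p) w) (X.act (x :: q) w) := by
  induction w generalizing p q with
  | nil => exact hpq
  | cons hadj w ih =>
    rename_i a b c
    have h1 := hX.step_congr (z := b) h hpq
    have h2 := hX.isReduced_step h b
    obtain ⟨p', hp'⟩ := X.exists_step_eq_cons (a :: p) b
    obtain ⟨q', hq'⟩ := X.exists_step_eq_cons (a :: q) b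
    simp only [act]
    rw [hp', hq'] at h1
    rw [hp'] at h2
    rw [hp', hq']
    exact ih h2 h1

theorem act_append {x y z : V} (w : X.graph.Walk x y) (w' : X.graph.Walk y z) (l : List V) :
    X.act l (w.append w') = X.act (X.act l w) w' := by
  induction w generalizing l with
  | nil => rfl
  | cons hadj w ih => simp only [SimpleGraph.Walk.cons_append, act]; exact ih _ _

/-- Degenerate squares. -/
theorem eq_of_square_of_not_sq {a b c d : V} (hab : X.graph.Adj a b) (hbc : X.graph.Adj b c)
    (had : X.graph.Adj a d) (hdc : X.graph.Adj d c) (hsq : ({a, b, c, d} : Set V) ∈ X.cubes)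
    (h : ¬ X.Sq a b c d) : b = d := by
  by_contra hbd
  have hac : a = c := by
    by_contra hac
    exact h ⟨hac, hbd, hab, hbc, hdc.symm, had.symm, hsq⟩
  subst hac
  obtain ⟨n, hn⟩ := X.exists_dim _ hsq
  have hcard := ncard_of_hasDim hn
  have : ({a, b, a, d} : Set V) = {a, b, d} := by ext; simp; tauto
  rw [this, Set.ncard_eq_three.2 ⟨a, b, d, hab.ne, had.ne, hbd, rfl⟩] at hcard
  rcases n with _ | _ | n
  · simp at hcard
  · simp at hcard
  · rw [pow_succ, pow_succ] at hcard; omega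

theorem IsNonpositivelyCurved.act_homotopic (hX : X.IsNonpositivelyCurved) {x y : V}
    {w w' : X.graph.Walk x y} (hw : X.Homotopic w w') {p : List V} (h : X.IsReduced (x :: p)) :
    X.SwapEq (X.act (x :: p) w) (X.act (x :: p) w') := by
  induction hw generalizing p with
  | refl w => exact .refl _
  | symm _ ih => exact (ih h).symm
  | trans _ _ ih ih' => exact (ih h).trans (ih' h)
  | @cons x y z hadj w w' _ ih =>
    have h2 := hX.isReduced_step h y
    obtain ⟨p', hp'⟩ := X.exists_step_eq_cons (x :: p) y
    simp only [act]
    rw [hp'] at h2 ⊢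
    exact ih h2
  | @backtrack x y z _ _ w =>
    have h1 := hX.step_step h y
    obtain ⟨p', hp'⟩ := X.exists_step_eq_cons (X.step (x :: p) y) x
    simp only [act]
    rw [hp'] at h1 ⊢
    exact (hX.act_congr w h h1.symm).symm
  | @square a b c d z hab hbc had hdc hsq w =>
    simp only [act]
    by_cases hs : X.Sq a b c d
    · have h1 := hX.step_sq hs h
      have h2 : X.IsReduced (X.step (X.step (a :: p) b) c) := by
        have := hX.isReduced_step h b
        obtain ⟨p', hp'⟩ := X.exists_step_eq_cons (a :: p) b
        rw [hp'] at this ⊢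
        exact hX.isReduced_step this c
      obtain ⟨p', hp'⟩ := X.exists_step_eq_cons (X.step (a :: p) b) c
      obtain ⟨q', hq'⟩ := X.exists_step_eq_cons (X.step (a :: p) d) c
      rw [hp'] at h1 h2 ⊢
      rw [hq'] at h1 ⊢
      exact hX.act_congr w h2 h1
    · obtain rfl := eq_of_square_of_not_sq hab hbc had hdc hsq hs
      exact .refl _

theorem IsNonpositivelyCurved.act_append_reverse (hX : X.IsNonpositivelyCurved) {x y : V}
    (w : X.graph.Walk x y) {p : List V} (h : X.IsReduced (x :: p)) :
    X.SwapEq (X.act (x :: p) (w.append w.reverse)) (x :: p) := by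
  have hh : X.Homotopic (w.append w.reverse) .nil := by
    clear h
    have key : ∀ {x y z : V} (w : X.graph.Walk x y) (w' : X.graph.Walk x z),
        X.Homotopic (w.append (w.reverse.append w')) w' := by
      intro x y z w
      induction w with
      | nil => intro w'; exact .refl _
      | cons hadj w ih =>
        intro w'
        rw [SimpleGraph.Walk.reverse_cons, SimpleGraph.Walk.cons_append,
          ← SimpleGraph.Walk.append_assoc, SimpleGraph.Walk.cons_append,
          SimpleGraph.Walk.nil_append]
        exact (Homotopic.cons _ (ih _)).trans (.backtrack _ _ _)
    simpa using key w .nil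
  exact hX.act_homotopic hh h

/-- Simple connectivity enters here: `w` followed by the reverse of `w'` is null-homotopic, hence
acts trivially on the constant path. -/
theorem IsCAT0.act_eq (hX : X.IsCAT0) {x y : V} (w w' : X.graph.Walk x y) :
    X.SwapEq (X.act [x] w) (X.act [x] w') := by
  have hr := isReduced_singleton (X := X) x
  obtain ⟨h1, q, hq⟩ := hX.1.act_spec w hr
  have h2 := hX.1.act_append_reverse w'.reverse (hq ▸ h1)
  have h3 := hX.1.act_homotopic (hX.2.2 x (w.append w'.reverse)) hr
  rw [act_append] at h3 h2
  rw [← hq, SimpleGraph.Walk.reverse_reverse] at h2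
  obtain ⟨h4, r, hr'⟩ := hX.1.act_spec w'.reverse (hq ▸ h1)
  rw [← hq] at hr' h4
  rw [hr'] at h3 h2 h4
  exact h2.symm.trans (hX.1.act_congr w' h4 h3)

/-- The list of vertices of a path starting from `x`, in reverse order. -/
def IsPathFrom (X : CubeComplex V) (x : V) : List V → Prop
  | [] => False
  | [y] => y = x
  | y :: z :: l => X.graph.Adj z y ∧ X.IsPathFrom x (z :: l)

theorem IsPathFrom.swap {x : V} {l l' : List V} (h : X.IsPathFrom x l) (hs : X.Swap l l') :
    X.IsPathFrom x l' := by
  induction hs with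
  | @head a b c d l hs =>
    exact ⟨hs.2.2.2.2.2.1, hs.2.2.2.2.1, h.2.2⟩
  | @cons a l l' hs ih =>
    cases l with
    | nil => cases hs
    | cons b l =>
      obtain ⟨l'', rfl⟩ := hs.exists_cons
      exact ⟨h.1, ih h.2⟩

theorem IsPathFrom.swapEq {x : V} {l l' : List V} (h : X.IsPathFrom x l) (hs : X.SwapEq l l') :
    X.IsPathFrom x l' := by
  induction hs with
  | refl => exact h
  | tail _ hs ih => exact ih.swap hs

theorem IsPathFrom.reachable {x y : V} {l : List V} (h : X.IsPathFrom x (y :: l)) :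
    ∃ w : X.graph.Walk x y, w.length = l.length := by
  induction l generalizing y with
  | nil => obtain rfl : y = x := h; exact ⟨.nil, rfl⟩
  | cons z l ih =>
    obtain ⟨w, hw⟩ := ih h.2
    exact ⟨w.concat h.1, by simp [hw]⟩

theorem IsPathFrom.dist_le {x y : V} {l : List V} (h : X.IsPathFrom x (y :: l)) :
    X.graph.dist x y ≤ l.length := by
  obtain ⟨w, hw⟩ := h.reachable
  rw [← hw]; exact SimpleGraph.dist_le w

theorem IsPathFrom.exists_walk {x y : V} {l : List V} (h : X.IsPathFrom x (y :: l))
    (hr : X.IsReduced (y :: l)) : ∃ w : X.graph.Walk x y, X.act [x] w = y :: l := by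
  induction l generalizing y with
  | nil => obtain rfl : y = x := h; exact ⟨.nil, rfl⟩
  | cons z l ih =>
    obtain ⟨w, hw⟩ := ih h.2 hr.tail
    refine ⟨w.append (.cons h.1 .nil), ?_⟩
    rw [act_append, hw]
    exact step_of_isReduced hr

/-- A reduced path is obtained by letting its own edges act on the constant path, so `act_eq`
compares any two of them. -/
theorem IsCAT0.swapEq_of_isReduced (hX : X.IsCAT0) {x y : V} {l l' : List V}
    (h : X.IsPathFrom x (y :: l)) (hr : X.IsReduced (y :: l))
    (h' : X.IsPathFrom x (y :: l')) (hr' : X.IsReduced (y :: l')) :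
    X.SwapEq (y :: l) (y :: l') := by
  obtain ⟨w, hw⟩ := h.exists_walk hr
  obtain ⟨w', hw'⟩ := h'.exists_walk hr'
  rw [← hw, ← hw']
  exact hX.act_eq w w'

theorem IsPathFrom.dist_add_two_le {x y : V} {l : List V} (h : X.IsPathFrom x (y :: l))
    (hb : Backtracks (y :: l)) : X.graph.dist x y + 2 ≤ l.length := by
  induction l generalizing y with
  | nil => cases hb with | cons _ hb => cases hb
  | cons z l ih =>
    cases hb with
    | head _ _ l => have := h.2.2.dist_le; simp; omega
    | cons _ hb =>
      have := ih h.2 hb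
      have h2 : X.graph.dist x y ≤ X.graph.dist x z + 1 := by
        obtain ⟨w, -⟩ := h.2.reachable
        obtain ⟨w', hw'⟩ := w.reachable.exists_walk_length_eq_dist
        rw [← hw', ← SimpleGraph.Walk.length_concat w' h.1]
        exact SimpleGraph.dist_le _
      simp; omega

theorem IsPathFrom.isReduced {x y : V} {l : List V} (h : X.IsPathFrom x (y :: l))
    (hl : l.length = X.graph.dist x y) : X.IsReduced (y :: l) := by
  intro l' hs hb
  obtain ⟨l', rfl⟩ := hs.exists_cons
  have := (h.swapEq hs).dist_add_two_le hb
  have h2 := hs.length_eq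
  simp at h2; omega

theorem IsCAT0.exists_isPathFrom (hX : X.IsCAT0) (x y : V) :
    ∃ l, X.IsPathFrom x (y :: l) ∧ l.length = X.graph.dist x y := by
  obtain ⟨w, hw⟩ := (hX.2.1.preconnected y x).exists_walk_length_eq_dist
  rw [SimpleGraph.dist_comm, ← hw]
  clear hw
  induction w with
  | nil => exact ⟨[], rfl, rfl⟩
  | @cons a b c hadj w ih =>
    obtain ⟨l, hl, hl'⟩ := ih
    exact ⟨b :: l, ⟨hadj.symm, hl⟩, by simp [hl']⟩

/-- A geodesic to `y` is reduced. Adding the edge to `z` either keeps it reduced, so that it has the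
length of a geodesic to `z`, or lets it be shortened to a path to `z`; both contradict equality. -/
theorem IsCAT0.dist_ne_of_adj (hX : X.IsCAT0) (x : V) {y z : V} (h : X.graph.Adj y z) :
    X.graph.dist x y ≠ X.graph.dist x z := by
  intro heq
  obtain ⟨l, hl, hll⟩ := hX.exists_isPathFrom x y
  obtain ⟨l', hl', hll'⟩ := hX.exists_isPathFrom x z
  have hr := hl.isReduced hll
  have hr' := hl'.isReduced hll'
  by_cases hz : X.IsReduced (z :: y :: l)
  · have := (hX.swapEq_of_isReduced (l := y :: l) ⟨h, hl⟩ hz hl' hr').length_eq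
    simp at this; omega
  · obtain ⟨u, hu⟩ := hX.1.swapEq_of_not_isReduced hr hz
    have h1 := (hl.swapEq hu).2.dist_le
    have := hu.length_eq
    simp at this; omega

/-- The geodesics to `y` through `z` and through `z'` are both reduced, hence equivalent, and
`swapEq_cons_cons` provides the square. -/
theorem IsCAT0.quadrangle (hX : X.IsCAT0) {x y z z' : V} {n : ℕ} (hz : X.graph.Adj z y)
    (hz' : X.graph.Adj z' y) (hne : z ≠ z') (hy : X.graph.dist x y = n + 1)
    (hxz : X.graph.dist x z = n) (hxz' : X.graph.dist x z' = n) :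
    ∃ v, X.Sq y z v z' ∧ X.graph.dist x v < n := by
  obtain ⟨l, hl, hll⟩ := hX.exists_isPathFrom x z
  obtain ⟨l', hl', hll'⟩ := hX.exists_isPathFrom x z'
  have h1 : X.IsPathFrom x (y :: z :: l) := ⟨hz, hl⟩
  have h2 : X.IsPathFrom x (y :: z' :: l') := ⟨hz', hl'⟩
  have h3 := hX.swapEq_of_isReduced h1 (h1.isReduced (by simp; omega)) h2
    (h2.isReduced (by simp; omega))
  rcases hX.1.swapEq_cons_cons h3 with ⟨h, -⟩ | ⟨v, r, hs, h4, -⟩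
  · exact absurd h hne
  · refine ⟨v, hs, ?_⟩
    have h5 := (hl.swapEq h4).2.dist_le
    have := h4.length_eq
    simp at this; omega

end CubeComplex

/-! ### Wallspaces of median graphs -/

/-- The elements of `H` that contain `x` but not `y`. -/
def sep {V : Type*} (H : Set (Set V)) (x y : V) : Set (Set V) := {A ∈ H | x ∈ A ∧ y ∉ A}

/-- `H` is the set of halfspaces of the median graph `Γ`. -/
structure IsMedianWallspace {V : Type*} (Γ : SimpleGraph V) (H : Set (Set V)) : Prop where
  connected : Γ.Connected
  nonempty : ∀ A ∈ H, A.Nonempty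
  compl_mem : ∀ A ∈ H, Aᶜ ∈ H
  finite_sep : ∀ x y, (sep H x y).Finite
  dist_eq : ∀ x y, Γ.dist x y = (sep H x y).ncard
  exists_median : ∀ x y z, ∃ m, ∀ A ∈ H,
    (m ∈ A ↔ (x ∈ A ∧ y ∈ A) ∨ (y ∈ A ∧ z ∈ A) ∨ (x ∈ A ∧ z ∈ A))

/-- The set of vertices that are closer to `a` than to `b`. -/
def nearer {V : Type*} (Γ : SimpleGraph V) (a b : V) : Set V := {x | Γ.dist x a < Γ.dist x b}

theorem mem_nearer {V : Type*} {Γ : SimpleGraph V} {a b x : V} :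
    x ∈ nearer Γ a b ↔ Γ.dist x a < Γ.dist x b := Iff.rfl

namespace CubeComplex

variable {V : Type*} {X : CubeComplex V}

/-- The halfspaces of a CAT(0) cube complex. -/
def allHalfspaces (X : CubeComplex V) : Set (Set V) :=
  {A | ∃ a b, X.graph.Adj a b ∧ A = nearer X.graph a b}

theorem IsCAT0.dist_of_adj (hX : X.IsCAT0) (x : V) {y z : V} (h : X.graph.Adj y z) :
    X.graph.dist x z = X.graph.dist x y + 1 ∨ X.graph.dist x y = X.graph.dist x z + 1 := by
  have h1 := hX.dist_ne_of_adj x h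
  have h2 := hX.2.1.dist_triangle (u := x) (v := y) (w := z)
  have h3 := hX.2.1.dist_triangle (u := x) (v := z) (w := y)
  rw [SimpleGraph.dist_eq_one_iff_adj.2 h] at h2
  rw [SimpleGraph.dist_eq_one_iff_adj.2 h.symm] at h3
  omega

theorem IsCAT0.exists_adj_closer (hX : X.IsCAT0) {x y : V} (h : x ≠ y) :
    ∃ y', X.graph.Adj y' y ∧ X.graph.dist x y = X.graph.dist x y' + 1 := by
  obtain ⟨l, hl, hll⟩ := hX.exists_isPathFrom x y
  cases l with
  | nil => exact absurd (show y = x from hl).symm h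
  | cons z l =>
    refine ⟨z, hl.1, ?_⟩
    have h1 := hl.2.dist_le
    have h2 := hX.dist_of_adj x hl.1
    simp at hll; omega

theorem IsCAT0.compl_nearer (hX : X.IsCAT0) {a b : V} (h : X.graph.Adj a b) :
    (nearer X.graph a b)ᶜ = nearer X.graph b a := by
  ext x
  have := hX.dist_of_adj x h
  simp only [Set.mem_compl_iff, mem_nearer]
  omega

/-- If `x` were closer to `c` than to `d`, then `a` and `c` would be equidistant from `x` and both
closer than `b`. The quadrangle condition at `b` would complete them by a vertex closer than `a`; by
uniqueness this is `d`, which is farther than `a`. -/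
theorem IsCAT0.nearer_subset (hX : X.IsCAT0) {a b c d : V} (h : X.Sq a b c d) :
    nearer X.graph a b ⊆ nearer X.graph d c := by
  intro x hx
  rw [mem_nearer] at hx ⊢
  have h1 := hX.dist_of_adj x h.2.2.1
  have h2 := hX.dist_of_adj x h.2.2.2.1
  have h3 := hX.dist_of_adj x h.2.2.2.2.1
  have h4 := hX.dist_of_adj x h.2.2.2.2.2.1
  by_contra hcon
  obtain ⟨v, hv, hvd⟩ := hX.quadrangle (x := x) (n := X.graph.dist x a) h.2.2.1
    h.2.2.2.1.symm h.1 (by omega) rfl (by omega)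
  obtain rfl := hv.rotate.rotate.rotate.eq_of_sq h.rotate.rotate.flip
  omega

theorem IsCAT0.nearer_eq_of_sq (hX : X.IsCAT0) {a b c d : V} (h : X.Sq a b c d) :
    nearer X.graph a b = nearer X.graph d c :=
  (hX.nearer_subset h).antisymm (hX.nearer_subset h.flip.rotate)

theorem Sq.parallel {a b c d : V} (h : X.Sq a b c d) : X.Parallel s(a, b) s(d, c) :=
  ⟨a, b, c, d, h.1, h.2.1, h.2.2.1, h.2.2.2.1, h.2.2.2.2.1, h.2.2.2.2.2.1, h.2.2.2.2.2.2, rfl, rfl⟩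

/-- An edge crossing the cut is moved towards `a` across squares. If `w` precedes `u` on a geodesic
from `a`, then `v` and `w` are both one step closer to `b` than `u`, and the quadrangle condition
based at `b` gives a square whose edge opposite to `uv` starts at `w`. -/
theorem IsCAT0.eqvGen_of_cut (hX : X.IsCAT0) {a b u v : V} (hab : X.graph.Adj a b)
    (huv : X.graph.Adj u v) (hu : u ∈ nearer X.graph a b) (hv : v ∉ nearer X.graph a b) :
    Relation.EqvGen X.Parallel s(a, b) s(u, v) ∧ nearer X.graph u v = nearer X.graph a b := by
  induction hn : X.graph.dist a u generalizing u v with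
  | zero =>
    obtain rfl := (hX.2.1.dist_eq_zero_iff).1 hn
    have h1 : X.graph.dist v a = 1 := SimpleGraph.dist_eq_one_iff_adj.2 huv.symm
    have h2 := hX.dist_of_adj v hab
    rw [mem_nearer] at hv
    have h3 : X.graph.dist v b = 0 := by omega
    obtain rfl := (hX.2.1.dist_eq_zero_iff).1 h3
    exact ⟨.refl _, rfl⟩
  | succ n ih =>
    have hne : a ≠ u := by rintro rfl; simp at hn
    obtain ⟨w, hw, hwd⟩ := hX.exists_adj_closer hne
    rw [mem_nearer] at hu hv
    have e1 := X.graph.dist_comm (u := a) (v := u)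
    have e2 := X.graph.dist_comm (u := b) (v := u)
    have e3 := X.graph.dist_comm (u := a) (v := v)
    have e4 := X.graph.dist_comm (u := b) (v := v)
    have h1 := hX.dist_of_adj u hab
    have h2 := hX.dist_of_adj v hab
    have h3 := hX.dist_of_adj a huv
    have h4 := hX.dist_of_adj b huv
    have h5 := hX.dist_of_adj b hw
    have h6 := hX.dist_of_adj w hab
    have e5 := X.graph.dist_comm (u := a) (v := w)
    have e6 := X.graph.dist_comm (u := b) (v := w)
    obtain ⟨w', hs, hd⟩ := hX.quadrangle (x := b) (y := u) (z := v) (z' := w) (n := n + 1)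
      huv.symm hw (by rintro rfl; omega) (by omega) (by omega) (by omega)
    have h7 := hX.dist_of_adj b hs.2.2.2.1
    have h8 := hX.dist_of_adj a hs.2.2.2.1
    have e7 := X.graph.dist_comm (u := a) (v := w')
    have e8 := X.graph.dist_comm (u := b) (v := w')
    obtain ⟨h9, h10⟩ := ih hs.2.2.2.2.1.symm (by rw [mem_nearer]; omega)
      (by rw [mem_nearer]; omega) (by omega)
    exact ⟨h9.trans _ _ _ (.symm _ _ (.rel _ _ hs.parallel)), (hX.nearer_eq_of_sq hs).trans h10⟩

theorem IsCAT0.eq_nearer (hX : X.IsCAT0) {A : Set V} (hA : A ∈ X.allHalfspaces) {u v : V}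
    (huv : X.graph.Adj u v) (hu : u ∈ A) (hv : v ∉ A) : A = nearer X.graph u v := by
  obtain ⟨a, b, hab, rfl⟩ := hA
  exact (hX.eqvGen_of_cut hab huv hu hv).2.symm

theorem left_mem_nearer {a b : V} (h : X.graph.Adj a b) : a ∈ nearer X.graph a b := by
  rw [mem_nearer, SimpleGraph.dist_self, SimpleGraph.dist_eq_one_iff_adj.2 h]; exact one_pos

theorem right_notMem_nearer {a b : V} : b ∉ nearer X.graph a b := by
  rw [mem_nearer, SimpleGraph.dist_self]; omega

theorem nearer_mem {a b : V} (h : X.graph.Adj a b) : nearer X.graph a b ∈ X.allHalfspaces :=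
  ⟨a, b, h, rfl⟩

theorem IsCAT0.compl_mem (hX : X.IsCAT0) {A : Set V} (hA : A ∈ X.allHalfspaces) :
    Aᶜ ∈ X.allHalfspaces := by
  obtain ⟨a, b, hab, rfl⟩ := hA
  rw [hX.compl_nearer hab]
  exact nearer_mem hab.symm

theorem IsCAT0.sep_eq_insert (hX : X.IsCAT0) {x y y' : V} (h : X.graph.Adj y' y)
    (hd : X.graph.dist x y = X.graph.dist x y' + 1) :
    sep X.allHalfspaces x y = insert (nearer X.graph y' y) (sep X.allHalfspaces x y') := by
  ext A
  simp only [sep, Set.mem_insert_iff, Set.mem_ofPred_eq]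
  constructor
  · rintro ⟨hA, hx, hy⟩
    by_cases hy' : y' ∈ A
    · exact Or.inl (hX.eq_nearer hA h hy' hy)
    · exact Or.inr ⟨hA, hx, hy'⟩
  · rintro (rfl | ⟨hA, hx, hy'⟩)
    · exact ⟨nearer_mem h, by rw [mem_nearer]; omega, right_notMem_nearer⟩
    · refine ⟨hA, hx, fun hy => ?_⟩
      rw [hX.eq_nearer hA h.symm hy hy', mem_nearer] at hx
      omega

/-- By `sep_eq_insert`, each edge of a geodesic crosses exactly one new halfspace. -/
theorem IsCAT0.finite_sep_and_dist (hX : X.IsCAT0) (x y : V) :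
    (sep X.allHalfspaces x y).Finite ∧ X.graph.dist x y = (sep X.allHalfspaces x y).ncard := by
  induction hn : X.graph.dist x y generalizing y with
  | zero =>
    obtain rfl := (hX.2.1.dist_eq_zero_iff).1 hn
    have : sep X.allHalfspaces x x = ∅ := by ext; simp [sep]
    simp [this]
  | succ n ih =>
    have hne : x ≠ y := by rintro rfl; simp at hn
    obtain ⟨y', hy', hd⟩ := hX.exists_adj_closer hne
    obtain ⟨h1, h2⟩ := ih y' (by omega)
    rw [hX.sep_eq_insert hy' hd, Set.ncard_insert_of_notMem (fun h => h.2.2 (left_mem_nearer hy')) h1]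
    exact ⟨h1.insert _, by omega⟩

theorem IsCAT0.mem_of_between (hX : X.IsCAT0) {x y m : V}
    (h : X.graph.dist x y = X.graph.dist x m + X.graph.dist m y) {A : Set V}
    (hA : A ∈ X.allHalfspaces) (hx : x ∈ A) (hy : y ∈ A) : m ∈ A := by
  by_contra hm
  obtain ⟨h1, h2⟩ := hX.finite_sep_and_dist x m
  obtain ⟨h3, h4⟩ := hX.finite_sep_and_dist m y
  obtain ⟨h5, h6⟩ := hX.finite_sep_and_dist x y
  have hsub : insert A (sep X.allHalfspaces x y) ⊆
      sep X.allHalfspaces x m ∪ sep X.allHalfspaces m y := by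
    rintro B (rfl | hB)
    · exact Or.inl ⟨hA, hx, hm⟩
    · by_cases hmB : m ∈ B
      · exact Or.inr ⟨hB.1, hmB, hB.2.2⟩
      · exact Or.inl ⟨hB.1, hB.2.1, hmB⟩
  have := Set.ncard_le_ncard hsub (h1.union h3)
  rw [Set.ncard_insert_of_notMem (fun h => h.2.2 hy) h5] at this
  have := Set.ncard_union_le (sep X.allHalfspaces x m) (sep X.allHalfspaces m y)
  omega

/-- Every vertex has a gate in every halfspace. -/
theorem IsCAT0.exists_gate (hX : X.IsCAT0) {A : Set V} (hA : A ∈ X.allHalfspaces) (m : V) :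
    ∃ a ∈ A, ∀ x ∈ A, X.graph.dist m x = X.graph.dist m a + X.graph.dist a x := by
  have hne : A.Nonempty := by
    obtain ⟨a, b, hab, rfl⟩ := hA
    exact ⟨a, left_mem_nearer hab⟩
  obtain ⟨a, ha, hmin⟩ := Function.argminOn_mem (fun x => X.graph.dist m x) A hne |> fun h =>
    (⟨_, h, fun x hx => Function.argminOn_le (fun x => X.graph.dist m x) A hx⟩ :
      ∃ a ∈ A, ∀ x ∈ A, X.graph.dist m a ≤ X.graph.dist m x)
  refine ⟨a, ha, fun x hx => ?_⟩
  induction hk : X.graph.dist a x using Nat.strong_induction_on generalizing x with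
  | _ k ih =>
  subst hk
  by_cases hax : a = x
  · subst hax; simp
  obtain ⟨y, hy, hyd⟩ := hX.exists_adj_closer hax
  have hyx : X.graph.dist y x = 1 := SimpleGraph.dist_eq_one_iff_adj.2 hy
  have hyA : y ∈ A := hX.mem_of_between (by omega) hA ha hx
  have hmy := ih _ (by omega) y hyA rfl
  have h1 := hX.dist_of_adj m hy
  by_contra hcon
  have hay : a ≠ y := by
    rintro rfl
    have := hmin x hx
    simp at hmy; simp at hyd; omega
  obtain ⟨z, hz, hzd⟩ := hX.exists_adj_closer hay
  have hzy : X.graph.dist z y = 1 := SimpleGraph.dist_eq_one_iff_adj.2 hz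
  have hzA : z ∈ A := hX.mem_of_between (by omega) hA ha hyA
  have hmz := ih _ (by omega) z hzA rfl
  -- If `x` is a counterexample, then `x` and `z` are equidistant from `m`. The fourth vertex `q`
  -- lies in `A` and is closer to `a` than `x`, so by induction it is farther from `m` than `z`,
  -- contrary to `hq`.
  obtain ⟨q, hs, hq⟩ := hX.quadrangle (x := m) (y := y) (z := z) (z' := x)
    (n := X.graph.dist m z) hz hy.symm (by rintro rfl; omega) (by omega) rfl (by omega)
  have h2 := hX.dist_of_adj a hs.2.2.2.1
  have h3 := hX.dist_of_adj a hs.2.2.2.2.1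
  have h4 := hX.dist_of_adj m hs.2.2.2.1
  have hzq : X.graph.dist z q = 1 := SimpleGraph.dist_eq_one_iff_adj.2 hs.2.2.2.1
  have hqx : X.graph.dist q x = 1 := SimpleGraph.dist_eq_one_iff_adj.2 hs.2.2.2.2.1
  have hqA : q ∈ A := hX.mem_of_between (x := a) (y := x) (by omega) hA ha hx
  have hmq := ih _ (by omega) q hqA rfl
  omega

/-- The median minimises the sum of the distances to the three points: if it were outside a
halfspace containing two of them, a step towards its gate would decrease two distances and increase
the third by at most one. -/
theorem IsCAT0.exists_median (hX : X.IsCAT0) (x y z : V) :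
    ∃ m, ∀ A ∈ X.allHalfspaces,
      (m ∈ A ↔ (x ∈ A ∧ y ∈ A) ∨ (y ∈ A ∧ z ∈ A) ∨ (x ∈ A ∧ z ∈ A)) := by
  let S : V → ℕ := fun m => X.graph.dist m x + X.graph.dist m y + X.graph.dist m z
  have : Nonempty V := ⟨x⟩
  let m := Function.argmin S
  have hmin : ∀ m', S m ≤ S m' := fun m' => Function.argmin_le S m'
  have key : ∀ A ∈ X.allHalfspaces, m ∉ A →
      ∃ m', (∀ w ∈ A, X.graph.dist m' w + 1 = X.graph.dist m w) ∧
        ∀ w, X.graph.dist m' w ≤ X.graph.dist m w + 1 := by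
    intro A hA hm
    obtain ⟨a, ha, hg⟩ := hX.exists_gate hA m
    obtain ⟨m', hm', hd⟩ := hX.exists_adj_closer (x := a) (y := m) (by rintro rfl; exact hm ha)
    have hmm : X.graph.dist m m' = 1 := SimpleGraph.dist_eq_one_iff_adj.2 hm'.symm
    rw [SimpleGraph.dist_comm, X.graph.dist_comm (u := a) (v := m')] at hd
    refine ⟨m', fun w hw => ?_, fun w => ?_⟩
    · have h1 := hg w hw
      have h2 := hX.2.1.dist_triangle (u := m') (v := a) (w := w)
      have h3 := hX.2.1.dist_triangle (u := m) (v := m') (w := w)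
      omega
    · have := hX.2.1.dist_triangle (u := m') (v := m) (w := w)
      rw [X.graph.dist_comm (u := m') (v := m)] at this
      omega
  have key2 : ∀ A ∈ X.allHalfspaces,
      ((x ∈ A ∧ y ∈ A) ∨ (y ∈ A ∧ z ∈ A) ∨ (x ∈ A ∧ z ∈ A)) → m ∈ A := by
    intro A hA h
    by_contra hm
    obtain ⟨m', h1, h2⟩ := key A hA hm
    have h3 := hmin m'
    have h4 := h2 x
    have h5 := h2 y
    have h6 := h2 z
    simp only [S] at h3
    rcases h with ⟨h, h'⟩ | ⟨h, h'⟩ | ⟨h, h'⟩ <;>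
      (have h7 := h1 _ h; have h8 := h1 _ h'; omega)
  refine ⟨m, fun A hA => ⟨fun hm => ?_, key2 A hA⟩⟩
  by_contra hcon
  have := key2 Aᶜ (hX.compl_mem hA) (by simp only [Set.mem_compl_iff]; tauto)
  exact this hm

theorem IsCAT0.isMedianWallspace (hX : X.IsCAT0) :
    IsMedianWallspace X.graph X.allHalfspaces where
  connected := hX.2.1
  nonempty := by
    rintro A ⟨a, b, hab, rfl⟩
    exact ⟨a, left_mem_nearer hab⟩
  compl_mem _ hA := hX.compl_mem hA
  finite_sep x y := (hX.finite_sep_and_dist x y).1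
  dist_eq x y := (hX.finite_sep_and_dist x y).2
  exists_median := hX.exists_median

/-! ### Hyperplanes and halfspaces -/

/-- The edges that join a vertex of `A` to a vertex outside `A`. -/
def cutEdges (X : CubeComplex V) (A : Set V) : Set (Sym2 V) :=
  {e | ∃ u v, X.graph.Adj u v ∧ u ∈ A ∧ v ∉ A ∧ e = s(u, v)}

theorem IsCAT0.walls_eq_of_eqvGen (hX : X.IsCAT0) {e e' : Sym2 V}
    (h : Relation.EqvGen X.Parallel e e') :
    ∀ a b, e = s(a, b) → ∃ u v, e' = s(u, v) ∧ (X.graph.Adj a b → X.graph.Adj u v) ∧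
      nearer X.graph a b = nearer X.graph u v := by
  have key : ∀ {e e'}, X.Parallel e e' → ∀ a b, e = s(a, b) →
      ∃ u v, e' = s(u, v) ∧ (X.graph.Adj a b → X.graph.Adj u v) ∧
      nearer X.graph a b = nearer X.graph u v := by
    rintro e e' ⟨a, b, c, d, h1, h2, h3, h4, h5, h6, h7, rfl, rfl⟩ a' b' h
    have hs : X.Sq a b c d := ⟨h1, h2, h3, h4, h5, h6, h7⟩
    rw [Sym2.eq_iff] at h
    rcases h with ⟨rfl, rfl⟩ | ⟨rfl, rfl⟩
    · exact ⟨d, c, rfl, fun _ => h5.symm, hX.nearer_eq_of_sq hs⟩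
    · exact ⟨c, d, Sym2.eq_swap, fun _ => h5, hX.nearer_eq_of_sq hs.flip.rotate.rotate.rotate⟩
  have hsymm : ∀ {e e'}, X.Parallel e e' → X.Parallel e' e := by
    rintro e e' ⟨a, b, c, d, h1, h2, h3, h4, h5, h6, h7, rfl, rfl⟩
    have hs : X.Sq a b c d := ⟨h1, h2, h3, h4, h5, h6, h7⟩
    exact hs.flip.rotate.parallel
  -- Both directions are proved together so that the induction passes through the symmetry
  -- constructor.
  have both : ∀ {e e'}, Relation.EqvGen X.Parallel e e' →
      (∀ a b, e = s(a, b) → ∃ u v, e' = s(u, v) ∧ (X.graph.Adj a b → X.graph.Adj u v) ∧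
        nearer X.graph a b = nearer X.graph u v) ∧
      (∀ a b, e' = s(a, b) → ∃ u v, e = s(u, v) ∧ (X.graph.Adj a b → X.graph.Adj u v) ∧
        nearer X.graph a b = nearer X.graph u v) := by
    have comp : ∀ {e₁ e₂ e₃ : Sym2 V},
        (∀ a b, e₁ = s(a, b) → ∃ u v, e₂ = s(u, v) ∧ (X.graph.Adj a b → X.graph.Adj u v) ∧
          nearer X.graph a b = nearer X.graph u v) →
        (∀ a b, e₂ = s(a, b) → ∃ u v, e₃ = s(u, v) ∧ (X.graph.Adj a b → X.graph.Adj u v) ∧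
          nearer X.graph a b = nearer X.graph u v) →
        (∀ a b, e₁ = s(a, b) → ∃ u v, e₃ = s(u, v) ∧ (X.graph.Adj a b → X.graph.Adj u v) ∧
          nearer X.graph a b = nearer X.graph u v) := by
      intro e₁ e₂ e₃ h h' a b hab
      obtain ⟨u, v, h1, h2, h3⟩ := h a b hab
      obtain ⟨u', v', h4, h5, h6⟩ := h' u v h1
      exact ⟨u', v', h4, fun h => h5 (h2 h), h3.trans h6⟩
    intro e e' h
    induction h with
    | rel _ _ h => exact ⟨key h, key (hsymm h)⟩
    | refl => exact ⟨fun a b h => ⟨a, b, h, id, rfl⟩, fun a b h => ⟨a, b, h, id, rfl⟩⟩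
    | symm _ _ _ ih => exact ⟨ih.2, ih.1⟩
    | trans _ _ _ _ _ ih ih' => exact ⟨comp ih.1 ih'.1, comp ih'.2 ih.2⟩
  exact (both h).1

/-- Together with `halfspaces_cutEdges`, this allows halfspaces to replace hyperplanes from here on.
-/
theorem IsCAT0.eqvGen_class (hX : X.IsCAT0) {a b : V} (hab : X.graph.Adj a b) :
    {e | Relation.EqvGen X.Parallel s(a, b) e} = X.cutEdges (nearer X.graph a b) := by
  ext e
  constructor
  · intro h
    obtain ⟨u, v, rfl, h1, h2⟩ := hX.walls_eq_of_eqvGen h a b rfl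
    have := h1 hab
    exact ⟨u, v, this, h2 ▸ left_mem_nearer this, h2 ▸ right_notMem_nearer, rfl⟩
  · rintro ⟨u, v, huv, hu, hv, rfl⟩
    exact (hX.eqvGen_of_cut hab huv hu hv).1

theorem IsCAT0.isHyperplane_iff (hX : X.IsCAT0) {J : Set (Sym2 V)} :
    X.IsHyperplane J ↔ ∃ A ∈ X.allHalfspaces, J = X.cutEdges A := by
  constructor
  · rintro ⟨e, he, rfl⟩
    induction e with
    | _ a b => exact ⟨_, nearer_mem he, hX.eqvGen_class he⟩
  · rintro ⟨A, ⟨a, b, hab, rfl⟩, rfl⟩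
    exact ⟨s(a, b), hab, (hX.eqvGen_class hab).symm⟩

theorem IsCAT0.reachable_in (hX : X.IsCAT0) {A : Set V} (hA : A ∈ X.allHalfspaces) {x y : V}
    (hx : x ∈ A) (hy : y ∈ A) : (X.graph.deleteEdges (X.cutEdges A)).Reachable x y := by
  induction hn : X.graph.dist x y generalizing y with
  | zero =>
    obtain rfl := (hX.2.1.dist_eq_zero_iff).1 hn
    rfl
  | succ n ih =>
    obtain ⟨z, hz, hd⟩ := hX.exists_adj_closer (x := x) (y := y) (by rintro rfl; simp at hn)
    have hzy : X.graph.dist z y = 1 := SimpleGraph.dist_eq_one_iff_adj.2 hz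
    have hzA : z ∈ A := hX.mem_of_between (by omega) hA hx hy
    refine (ih hzA (by omega)).trans (SimpleGraph.Adj.reachable ?_)
    rw [SimpleGraph.deleteEdges_adj]
    refine ⟨hz, ?_⟩
    rintro ⟨u, v, -, hu, hv, h⟩
    rw [Sym2.eq_iff] at h
    rcases h with ⟨rfl, rfl⟩ | ⟨rfl, rfl⟩
    · exact hv hy
    · exact hv hzA

theorem cutEdges_compl (A : Set V) : X.cutEdges Aᶜ = X.cutEdges A := by
  have : ∀ A : Set V, X.cutEdges A ⊆ X.cutEdges Aᶜ := by
    rintro A _ ⟨u, v, h, hu, hv, rfl⟩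
    exact ⟨v, u, h.symm, hv, fun h => h hu, Sym2.eq_swap⟩
  exact (by simpa using this Aᶜ : X.cutEdges Aᶜ ⊆ X.cutEdges A).antisymm (this A)

theorem mem_of_reachable {A : Set V} {x y : V}
    (h : (X.graph.deleteEdges (X.cutEdges A)).Reachable x y) (hx : x ∈ A) : y ∈ A := by
  obtain ⟨w⟩ := h
  induction w with
  | nil => exact hx
  | @cons a b c hab _ ih =>
    apply ih
    by_contra hb
    rw [SimpleGraph.deleteEdges_adj] at hab
    exact hab.2 ⟨a, b, hab.1, hx, hb, rfl⟩

theorem IsCAT0.halfspaces_cutEdges (hX : X.IsCAT0) {A : Set V} (hA : A ∈ X.allHalfspaces) :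
    X.halfspaces (X.cutEdges A) = {A, Aᶜ} := by
  have key : ∀ {A : Set V}, A ∈ X.allHalfspaces → ∀ x ∈ A,
      ((X.graph.deleteEdges (X.cutEdges A)).connectedComponentMk x).supp = A := by
    intro A hA x hx
    ext y
    rw [SimpleGraph.ConnectedComponent.mem_supp_iff, SimpleGraph.ConnectedComponent.eq]
    exact ⟨fun h => mem_of_reachable h.symm hx, fun h => hX.reachable_in hA h hx⟩
  have key' : ∀ x ∉ A,
      ((X.graph.deleteEdges (X.cutEdges A)).connectedComponentMk x).supp = Aᶜ := by
    intro x hx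
    have := key (hX.compl_mem hA) x hx
    rwa [cutEdges_compl] at this
  ext D
  simp only [halfspaces, Set.mem_ofPred_eq, Set.mem_insert_iff, Set.mem_singleton_iff]
  constructor
  · rintro ⟨c, rfl⟩
    induction c using SimpleGraph.ConnectedComponent.ind with
    | _ x =>
      by_cases hx : x ∈ A
      · exact Or.inl (key hA x hx)
      · exact Or.inr (key' x hx)
  · rintro (rfl | rfl)
    · obtain ⟨x, hx⟩ := hX.isMedianWallspace.nonempty _ hA
      exact ⟨_, (key hA x hx).symm⟩
    · obtain ⟨x, hx⟩ := hX.isMedianWallspace.nonempty _ (hX.compl_mem hA)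
      exact ⟨_, (key' x hx).symm⟩

end CubeComplex

/-! ### Counting separating halfspaces -/

section Sep

variable {V : Type*}

theorem mem_sep {H : Set (Set V)} {x y : V} {A : Set V} :
    A ∈ sep H x y ↔ A ∈ H ∧ x ∈ A ∧ y ∉ A := Iff.rfl

theorem sep_mono {𝓐 H : Set (Set V)} (h : 𝓐 ⊆ H) (x y : V) : sep 𝓐 x y ⊆ sep H x y :=
  fun _ hA => ⟨h hA.1, hA.2⟩

theorem sep_subset_union (H : Set (Set V)) (x y z : V) : sep H x z ⊆ sep H x y ∪ sep H y z := by
  intro A hA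
  by_cases h : y ∈ A
  · exact Or.inr ⟨hA.1, h, hA.2.2⟩
  · exact Or.inl ⟨hA.1, hA.2.1, h⟩

theorem sep_self (H : Set (Set V)) (x : V) : sep H x x = ∅ := by
  ext A; simp only [mem_sep, Set.mem_empty_iff_false, iff_false]; tauto

/-- The set of halfspaces `𝓐` is closed under complementation. -/
def ComplClosed (𝓐 : Set (Set V)) : Prop := ∀ A ∈ 𝓐, Aᶜ ∈ 𝓐

theorem ComplClosed.ncard_sep_comm {𝓐 : Set (Set V)} (h : ComplClosed 𝓐) (x y : V) :
    (sep 𝓐 x y).ncard = (sep 𝓐 y x).ncard := by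
  have : sep 𝓐 y x = compl '' sep 𝓐 x y := by
    ext A
    constructor
    · rintro ⟨h1, h2, h3⟩
      exact ⟨Aᶜ, ⟨h A h1, h3, fun h => h h2⟩, compl_compl A⟩
    · rintro ⟨B, ⟨h1, h2, h3⟩, rfl⟩
      exact ⟨h B h1, h3, fun h => h h2⟩
  rw [this, Set.ncard_image_of_injective _ compl_injective]

theorem ComplClosed.mem_iff_of_sep_eq_empty {𝓐 : Set (Set V)} (h : ComplClosed 𝓐) {x y : V}
    (hs : sep 𝓐 x y = ∅) {A : Set V} (hA : A ∈ 𝓐) : x ∈ A ↔ y ∈ A := by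
  constructor
  · intro hx
    by_contra hy
    exact (hs ▸ (⟨hA, hx, hy⟩ : A ∈ sep 𝓐 x y) : A ∈ (∅ : Set (Set V)))
  · intro hy
    by_contra hx
    exact (hs ▸ (⟨h A hA, hx, fun h => h hy⟩ : Aᶜ ∈ sep 𝓐 x y) : Aᶜ ∈ (∅ : Set (Set V)))

theorem ComplClosed.ncard_sep_add {𝓐 : Set (Set V)} (h : ComplClosed 𝓐)
    (hf : ∀ x y, (sep 𝓐 x y).Finite) {x y m : V} (hm : ∀ A ∈ 𝓐, x ∈ A → y ∈ A → m ∈ A) :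
    (sep 𝓐 x y).ncard = (sep 𝓐 x m).ncard + (sep 𝓐 m y).ncard := by
  rw [← Set.ncard_union_eq _ (hf _ _) (hf _ _)]
  · congr 1
    apply (sep_subset_union _ _ _ _).antisymm
    rintro A (⟨h1, h2, h3⟩ | ⟨h1, h2, h3⟩)
    · exact ⟨h1, h2, fun hy => h3 (hm A h1 h2 hy)⟩
    · exact ⟨h1, by_contra fun hx => hm Aᶜ (h A h1) hx h3 h2, h3⟩
  · rw [Set.disjoint_left]
    rintro A h1 h2
    exact h1.2.2 h2.2.1

theorem ncard_sep_triangle {𝓐 : Set (Set V)}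
    (hf : ∀ x y, (sep 𝓐 x y).Finite) (x y z : V) :
    (sep 𝓐 x z).ncard ≤ (sep 𝓐 x y).ncard + (sep 𝓐 y z).ncard :=
  (Set.ncard_le_ncard (sep_subset_union _ _ _ _) ((hf _ _).union (hf _ _))).trans
    (Set.ncard_union_le _ _)

end Sep

/-! ### Medians in a median wallspace -/

namespace IsMedianWallspace

variable {V : Type*} {Γ : SimpleGraph V} {H : Set (Set V)} (hH : IsMedianWallspace Γ H)
include hH

theorem complClosed : ComplClosed H := hH.compl_mem

theorem finite_sep_of_subset {𝓐 : Set (Set V)} (h : 𝓐 ⊆ H) (x y : V) : (sep 𝓐 x y).Finite :=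
  (hH.finite_sep x y).subset (sep_mono h x y)

theorem eq_of_forall {x y : V} (h : ∀ A ∈ H, x ∈ A ↔ y ∈ A) : x = y := by
  rw [← hH.connected.dist_eq_zero_iff, hH.dist_eq]
  have : sep H x y = ∅ := by
    ext A
    simp only [mem_sep, Set.mem_empty_iff_false, iff_false]
    rintro ⟨h1, h2, h3⟩
    exact h3 ((h A h1).1 h2)
  rw [this, Set.ncard_empty]

theorem dist_add_iff {x y m : V} :
    Γ.dist x y = Γ.dist x m + Γ.dist m y ↔ ∀ A ∈ H, x ∈ A → y ∈ A → m ∈ A := by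
  constructor
  · intro h A hA hx hy
    by_contra hm
    simp only [hH.dist_eq] at h
    have hsub : insert A (sep H x y) ⊆ sep H x m ∪ sep H m y :=
      Set.insert_subset (Or.inl ⟨hA, hx, hm⟩) (sep_subset_union _ _ _ _)
    have := Set.ncard_le_ncard hsub ((hH.finite_sep _ _).union (hH.finite_sep _ _))
    rw [Set.ncard_insert_of_notMem (fun h => h.2.2 hy) (hH.finite_sep _ _)] at this
    have := Set.ncard_union_le (sep H x m) (sep H m y)
    omega
  · intro h
    simp only [hH.dist_eq]
    exact hH.complClosed.ncard_sep_add hH.finite_sep h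

/-- The median of three vertices. -/
noncomputable def med (x y z : V) : V := (hH.exists_median x y z).choose

theorem mem_med {x y z : V} {A : Set V} (hA : A ∈ H) :
    hH.med x y z ∈ A ↔ (x ∈ A ∧ y ∈ A) ∨ (y ∈ A ∧ z ∈ A) ∨ (x ∈ A ∧ z ∈ A) :=
  (hH.exists_median x y z).choose_spec A hA

theorem eq_med_iff {x y z m : V} : m = hH.med x y z ↔
    Γ.dist x y = Γ.dist x m + Γ.dist m y ∧ Γ.dist x z = Γ.dist x m + Γ.dist m z ∧
      Γ.dist y z = Γ.dist y m + Γ.dist m z := by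
  simp only [hH.dist_add_iff]
  constructor
  · rintro rfl
    refine ⟨fun A hA => ?_, fun A hA => ?_, fun A hA => ?_⟩ <;> rw [hH.mem_med hA] <;> tauto
  · rintro ⟨h1, h2, h3⟩
    apply hH.eq_of_forall
    intro A hA
    rw [hH.mem_med hA]
    have k1 := h1 A hA
    have k2 := h2 A hA
    have k3 := h3 A hA
    have l1 := h1 Aᶜ (hH.compl_mem A hA)
    have l2 := h2 Aᶜ (hH.compl_mem A hA)
    have l3 := h3 Aᶜ (hH.compl_mem A hA)
    simp only [Set.mem_compl_iff] at l1 l2 l3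
    by_cases hx : x ∈ A <;> by_cases hy : y ∈ A <;> by_cases hz : z ∈ A <;> simp_all

theorem sep_of_adj {x y : V} (h : Γ.Adj x y) : ∃ A, sep H x y = {A} := by
  rw [← Set.ncard_eq_one, ← hH.dist_eq]
  exact SimpleGraph.dist_eq_one_iff_adj.2 h

/-! ### The Helly property -/

omit hH in
/-- `C` contains the median of any two of its points and of a third point. -/
theorem _root_.helly_of_ternary {V : Type*} (μ : V → V → V → V) (D : Set (Set V)) (hD : D.Finite) :
    ∀ C : Set V, C.Nonempty →
    (∀ x ∈ C, ∀ y ∈ C, ∀ z, μ x y z ∈ C ∧ μ x z y ∈ C ∧ μ z x y ∈ C) →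
    (∀ A ∈ D, ∀ x ∈ A, ∀ y ∈ A, ∀ z, μ x y z ∈ A ∧ μ x z y ∈ A ∧ μ z x y ∈ A) →
    (∀ A ∈ D, (C ∩ A).Nonempty) → (∀ A ∈ D, ∀ B ∈ D, (A ∩ B).Nonempty) →
    ∃ v ∈ C, ∀ A ∈ D, v ∈ A := by
  induction D, hD using Set.Finite.induction_on with
  | empty => exact fun C ⟨v, hv⟩ _ _ _ _ => ⟨v, hv, by simp⟩
  | @insert A D hAD hD ih =>
    intro C hC hCc hDc hCD hDD
    have hA := hDc A (by simp)
    have hCA : ∀ B ∈ D, ((C ∩ A) ∩ B).Nonempty := by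
      intro B hB
      have hB' := hDc B (by simp [hB])
      obtain ⟨x, hx⟩ := hCD A (by simp)
      obtain ⟨y, hy⟩ := hCD B (by simp [hB])
      obtain ⟨z, hz⟩ := hDD A (by simp) B (by simp [hB])
      -- Each of `C`, `A`, `B` contains two of the three points `x`, `y`, `z`, hence their median.
      exact ⟨μ x y z, ⟨(hCc x hx.1 y hy.1 z).1, (hA x hx.2 z hz.1 y).2.1⟩, (hB' y hy.2 z hz.2 x).2.2⟩
    obtain ⟨v, hv, hv'⟩ := ih (C ∩ A) (hCD A (by simp))
      (fun x hx y hy z => ⟨⟨(hCc x hx.1 y hy.1 z).1, (hA x hx.2 y hy.2 z).1⟩,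
        ⟨(hCc x hx.1 y hy.1 z).2.1, (hA x hx.2 y hy.2 z).2.1⟩,
        ⟨(hCc x hx.1 y hy.1 z).2.2, (hA x hx.2 y hy.2 z).2.2⟩⟩)
      (fun B hB => hDc B (by simp [hB])) hCA
      (fun B hB B' hB' => hDD B (by simp [hB]) B' (by simp [hB']))
    refine ⟨v, hv.1, ?_⟩
    rintro B (rfl | hB)
    · exact hv.2
    · exact hv' B hB

theorem med_mem {A : Set V} (hA : A ∈ H) : ∀ x ∈ A, ∀ y ∈ A, ∀ z,
    hH.med x y z ∈ A ∧ hH.med x z y ∈ A ∧ hH.med z x y ∈ A := by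
  intro x hx y hy z
  simp only [hH.mem_med hA]; tauto

theorem exists_mem_of_finite {C : Set V} (hC : C.Nonempty)
    (hCc : ∀ x ∈ C, ∀ y ∈ C, ∀ z, hH.med x y z ∈ C ∧ hH.med x z y ∈ C ∧ hH.med z x y ∈ C)
    {D : Set (Set V)} (hD : D.Finite) (hDH : D ⊆ H) (hCD : ∀ A ∈ D, (C ∩ A).Nonempty)
    (hDD : ∀ A ∈ D, ∀ B ∈ D, (A ∩ B).Nonempty) : ∃ v ∈ C, ∀ A ∈ D, v ∈ A :=
  helly_of_ternary hH.med D hD C hC hCc (fun _ hA => hH.med_mem (hDH hA)) hCD hDD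

/-- An orientation of a subset of walls that differs from a principal one on finitely many walls
is itself principal. -/
theorem exists_of_orientation {𝓐 Y : Set (Set V)} (h𝓐 : 𝓐 ⊆ H) (hc : ComplClosed 𝓐) (hY : Y ⊆ 𝓐)
    (hxor : ∀ A ∈ 𝓐, A ∈ Y ↔ Aᶜ ∉ Y) (hup : ∀ A ∈ Y, ∀ B ∈ 𝓐, A ⊆ B → B ∈ Y) {x : V}
    (hfin : {A ∈ Y | x ∉ A}.Finite) : ∃ v, ∀ A ∈ 𝓐, v ∈ A ↔ A ∈ Y := by
  have hpair : ∀ A ∈ Y, ∀ B ∈ Y, (A ∩ B).Nonempty := by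
    intro A hA B hB
    by_contra h
    rw [Set.not_nonempty_iff_eq_empty] at h
    refine (hxor B (hY hB)).1 hB (hup A hA _ (hc B (hY hB)) fun a ha hb => ?_)
    exact (h ▸ (⟨ha, hb⟩ : a ∈ A ∩ B) : a ∈ (∅ : Set V))
  -- Only the finitely many chosen halfspaces that miss `x` are real constraints; the Helly property
  -- meets them all, together with any single `B`.
  have hne : ∀ B ∈ Y, ∃ v, v ∈ B ∧ ∀ A ∈ {A ∈ Y | x ∉ A}, v ∈ A := by
    intro B hB
    exact hH.exists_mem_of_finite (hH.nonempty B (h𝓐 (hY hB))) (hH.med_mem (h𝓐 (hY hB))) hfin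
      (fun A hA => h𝓐 (hY hA.1)) (fun A hA => hpair _ hB _ hA.1) (fun A hA B hB => hpair _ hA.1 _ hB.1)
  have hne' : {v | ∀ A ∈ {A ∈ Y | x ∉ A}, v ∈ A}.Nonempty := by
    obtain ⟨v, -, hv⟩ := hH.exists_mem_of_finite (C := Set.univ) ⟨x, trivial⟩ (by simp) hfin
      (fun A hA => h𝓐 (hY hA.1)) (fun A hA => by
        rw [Set.univ_inter]; exact hH.nonempty A (h𝓐 (hY hA.1)))
      (fun A hA B hB => hpair _ hA.1 _ hB.1)
    exact ⟨v, hv⟩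
  obtain ⟨v, hv, hmin⟩ : ∃ v ∈ {v | ∀ A ∈ {A ∈ Y | x ∉ A}, v ∈ A},
      ∀ w ∈ {v | ∀ A ∈ {A ∈ Y | x ∉ A}, v ∈ A}, Γ.dist x v ≤ Γ.dist x w :=
    ⟨_, Function.argminOn_mem (fun v => Γ.dist x v) _ hne',
      fun w hw => Function.argminOn_le (fun v => Γ.dist x v) _ hw⟩
  -- The point `v` is the closest to `x` satisfying the finite constraints. If it missed some `B`,
  -- then `x` would lie in `B`, and the median of `x`, `v` and an admissible `w` in `B` would be
  -- admissible, in `B`, and no farther from `x` on a geodesic to `v`; minimality makes it equal to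
  -- `v`.
  have key : ∀ B ∈ Y, v ∈ B := by
    intro B hB
    by_contra hvB
    have hxB : x ∈ B := by_contra fun h => hvB (hv B ⟨hB, h⟩)
    obtain ⟨w, hwB, hw⟩ := hne B hB
    set m := hH.med x v w with hm
    have hmv : ∀ A ∈ {A ∈ Y | x ∉ A}, m ∈ A := by
      intro A hA
      rw [hH.mem_med (h𝓐 (hY hA.1))]
      exact Or.inr (Or.inl ⟨hv A hA, hw A hA⟩)
    have h1 := hmin m hmv
    have h2 := (hH.eq_med_iff.1 hm).1
    have h3 : Γ.dist m v = 0 := by omega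
    rw [hH.connected.dist_eq_zero_iff] at h3
    have : m ∈ B := by
      rw [hH.mem_med (h𝓐 (hY hB))]
      exact Or.inr (Or.inr ⟨hxB, hwB⟩)
    exact hvB (h3 ▸ this)
  refine ⟨v, fun A hA => ⟨fun h => ?_, key A⟩⟩
  rw [hxor A hA]
  exact fun h' => key _ h' h

end IsMedianWallspace

/-! ### Powers of an isometry acting on halfspaces -/

section Shift

variable {V : Type*} (f : Equiv.Perm V)

/-- The preimage of `A` under the `n`-th power of `f`. -/
def shift (n : ℤ) (A : Set V) : Set V := {x | (f ^ n) x ∈ A}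

variable {f}

theorem mem_shift {n : ℤ} {A : Set V} {x : V} : x ∈ shift f n A ↔ (f ^ n) x ∈ A := Iff.rfl

theorem zpow_add_apply (m n : ℤ) (x : V) : (f ^ (m + n)) x = (f ^ m) ((f ^ n) x) := by
  rw [zpow_add, Equiv.Perm.mul_apply]

theorem zpow_add_one_apply (n : ℤ) (x : V) : (f ^ (n + 1)) x = (f ^ n) (f x) := by
  rw [zpow_add_apply, zpow_one]

theorem shift_shift (m n : ℤ) (A : Set V) : shift f m (shift f n A) = shift f (m + n) A := by
  ext x
  rw [mem_shift, mem_shift, mem_shift, add_comm, zpow_add_apply]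

theorem shift_zero (A : Set V) : shift f 0 A = A := by
  ext x; simp [mem_shift]

theorem shift_compl (n : ℤ) (A : Set V) : shift f n Aᶜ = (shift f n A)ᶜ := rfl

theorem shift_mono {A B : Set V} (n : ℤ) (h : A ⊆ B) : shift f n A ⊆ shift f n B :=
  fun _ hx => h hx

theorem shift_neg_shift (n : ℤ) (A : Set V) : shift f (-n) (shift f n A) = A := by
  rw [shift_shift, neg_add_cancel, shift_zero]

theorem shift_injective (n : ℤ) : Function.Injective (shift f n) := by
  intro A B h
  rw [← shift_neg_shift (f := f) n A, h, shift_neg_shift]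

variable (f)

/-- The set of halfspaces `𝓐` is invariant under the powers of `f`. -/
def ShiftInvariant (𝓐 : Set (Set V)) : Prop := ∀ n, ∀ A ∈ 𝓐, shift f n A ∈ 𝓐

/-- Some nontrivial power of `f` stabilises `A`. -/
def IsPeriodic (A : Set V) : Prop := ∃ n : ℤ, n ≠ 0 ∧ shift f n A = A

variable {f}

theorem ShiftInvariant.shift_mem_iff {𝓐 : Set (Set V)} (h : ShiftInvariant f 𝓐) {n : ℤ}
    {A : Set V} : shift f n A ∈ 𝓐 ↔ A ∈ 𝓐 :=
  ⟨fun h' => by simpa only [shift_neg_shift] using h (-n) _ h', h n A⟩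

theorem shift_mul_of_eq {p : ℤ} {A : Set V} (h : shift f p A = A) (q : ℤ) :
    shift f (p * q) A = A := by
  have key : ∀ n : ℕ, shift f (p * n) A = A := by
    intro n
    induction n with
    | zero => simp [shift_zero]
    | succ n ih =>
      rw [Nat.cast_succ, mul_add, mul_one, ← shift_shift, h, ih]
  obtain ⟨n, rfl | rfl⟩ := q.eq_nat_or_neg
  · exact key n
  · rw [mul_neg]
    conv_lhs => rw [← key n]
    exact shift_neg_shift _ _

theorem IsPeriodic.exists_nat {A : Set V} (h : IsPeriodic f A) :
    ∃ n : ℕ, 0 < n ∧ shift f n A = A := by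
  obtain ⟨p, hp, h⟩ := h
  refine ⟨p.natAbs, Int.natAbs_pos.2 hp, ?_⟩
  have := shift_mul_of_eq h p.sign
  rwa [Int.mul_sign_self] at this

theorem IsPeriodic.finite_range {A : Set V} (h : IsPeriodic f A) :
    (Set.range fun n : ℤ => shift f n A).Finite := by
  obtain ⟨p, hp, h⟩ := h.exists_nat
  refine ((Set.finite_Ico (0 : ℤ) p).image fun n => shift f n A).subset ?_
  rintro _ ⟨n, rfl⟩
  refine ⟨n % p, ⟨Int.emod_nonneg _ (by omega), Int.emod_lt_of_pos _ (by omega)⟩, ?_⟩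
  conv_rhs => rw [← Int.emod_add_mul_ediv n p]
  simp only
  rw [← shift_shift, shift_mul_of_eq h]

theorem IsPeriodic.shift {A : Set V} (h : IsPeriodic f A) (n : ℤ) : IsPeriodic f (shift f n A) := by
  obtain ⟨p, hp, h⟩ := h
  exact ⟨p, hp, by rw [shift_shift, add_comm, ← shift_shift, h]⟩

theorem IsPeriodic.compl {A : Set V} (h : IsPeriodic f A) : IsPeriodic f Aᶜ := by
  obtain ⟨p, hp, h⟩ := h
  exact ⟨p, hp, by rw [shift_compl, h]⟩

theorem shift_family_injective {A : Set V} (h : ¬ IsPeriodic f A) :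
    Function.Injective fun n : ℤ => shift f n A := by
  intro m n hmn
  by_contra hne
  refine h ⟨n - m, sub_ne_zero.2 (Ne.symm hne), ?_⟩
  have := congrArg (_root_.shift f (-m)) hmn
  simp only at this
  rw [shift_neg_shift, shift_shift] at this
  rw [show n - m = -m + n by ring, ← this]

/-- A finite invariant set of walls, none of which is inverted by a power of `f`, has an
invariant orientation. -/
theorem exists_invariant_orientation {P : Set (Set V)} (hfin : P.Finite) (hc : ComplClosed P)
    (hs : ShiftInvariant f P) (hper : ∀ A ∈ P, IsPeriodic f A)
    (hinv : ∀ A ∈ P, ∀ n, shift f n A ≠ Aᶜ) :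
    ∃ σ ⊆ P, ShiftInvariant f σ ∧ (∀ A ∈ P, A ∈ σ ↔ Aᶜ ∉ σ) ∧
      ∀ A ∈ σ, ∀ B ∈ P, A ⊆ B → B ∈ σ := by
  -- Partial invariant orientations. There are finitely many, so a maximal one exists.
  let 𝓢 : Set (Set (Set V)) := {σ | σ ⊆ P ∧ ShiftInvariant f σ ∧ (∀ A ∈ σ, Aᶜ ∉ σ) ∧
    ∀ A ∈ σ, ∀ B ∈ P, A ⊆ B → B ∈ σ}
  have h𝓢 : 𝓢.Finite := hfin.finite_subsets.subset fun σ h => h.1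
  have h𝓢' : 𝓢.Nonempty := ⟨∅, by simp, fun n A hA => hA.elim, by simp, by simp⟩
  obtain ⟨σ, hσ⟩ := h𝓢.exists_maximal h𝓢'
  obtain ⟨h1, h2, h3, h4⟩ := hσ.1
  -- If neither side of `A` is chosen, adding all the halfspaces of `P` that contain a translate of
  -- `A` would enlarge `σ`. The only obstruction is that a translate of `A` is contained in the
  -- complement of another one.
  have key : ∀ A ∈ P, A ∉ σ → Aᶜ ∉ σ → ∃ i, A ⊆ shift f i Aᶜ := by
    intro A hA hA1 hA2
    by_contra hcon
    push Not at hcon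
    refine hA1 (hσ.2 (y := σ ∪ {B ∈ P | ∃ k, shift f k A ⊆ B}) ⟨?_, ?_, ?_, ?_⟩
      Set.subset_union_left (Or.inr ⟨hA, 0, by rw [shift_zero]⟩))
    · rintro B (hB | hB)
      · exact h1 hB
      · exact hB.1
    · rintro n B (hB | ⟨hB, k, hk⟩)
      · exact Or.inl (h2 n B hB)
      · exact Or.inr ⟨hs n B hB, n + k, by rw [← shift_shift]; exact shift_mono n hk⟩
    · have aux : ∀ B ∈ σ, ∀ k, ¬ shift f k A ⊆ Bᶜ := by
        intro B hB k hk
        have := h4 B hB (shift f k Aᶜ) (hs k _ (hc A hA)) (by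
          rw [shift_compl]; exact Set.subset_compl_comm.1 hk)
        exact hA2 (h2.shift_mem_iff.1 this)
      rintro B (hB | ⟨hB, k, hk⟩) (hB' | ⟨hB', j, hj⟩)
      · exact h3 B hB hB'
      · exact aux B hB j hj
      · exact aux _ hB' k (by rwa [compl_compl])
      · apply hcon (-k + j)
        rw [← shift_shift]
        conv_lhs => rw [← shift_neg_shift (f := f) k A]
        apply shift_mono
        rw [shift_compl]
        exact hk.trans (Set.subset_compl_comm.1 hj)
    · rintro B (hB | ⟨hB, k, hk⟩) C hC hBC
      · exact Or.inl (h4 B hB C hC hBC)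
      · exact Or.inr ⟨hC, k, hk.trans hBC⟩
  refine ⟨σ, h1, h2, fun A hA => ⟨h3 A, fun hA' => ?_⟩, h4⟩
  by_contra hA''
  obtain ⟨i, hi⟩ := key A hA hA'' hA'
  obtain ⟨j, hj⟩ := key Aᶜ (hc A hA) hA' (by rwa [compl_compl])
  rw [compl_compl] at hj
  -- The obstructions for `A` and for its complement combine into this inclusion. Periodicity turns
  -- it into an equality, whence `shift f i A` is the complement of `A`, which is excluded.
  have h5 : A ⊆ shift f (i + j) A := by
    rw [← shift_shift]; exact hi.trans (shift_mono i hj)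
  have h6 : ∀ n : ℕ, A ⊆ shift f ((i + j) * n) A := by
    intro n
    induction n with
    | zero => simp [shift_zero]
    | succ n ih =>
      rw [Nat.cast_succ, mul_add, mul_one, ← shift_shift]
      exact ih.trans (shift_mono _ h5)
  obtain ⟨p, hp, hpA⟩ := (hper A hA).exists_nat
  have h7 : shift f (i + j) A ⊆ A := by
    have := shift_mono (f := f) (i + j) (h6 (p - 1))
    rw [shift_shift] at this
    have e : (i + j) + (i + j) * ((p - 1 : ℕ) : ℤ) = p * (i + j) := by
      rw [Nat.cast_pred hp]; ring
    rwa [e, shift_mul_of_eq hpA] at this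
  have h8 : shift f i Aᶜ ⊆ A := by
    have := shift_mono (f := f) i hj
    rw [shift_shift] at this
    exact this.trans h7
  apply hinv A hA i
  have h9 := hi.antisymm h8
  rw [shift_compl] at h9
  rw [← compl_compl (shift f i A), ← h9]

theorem or_and_not_iff {p q r s : Prop} (h : ¬ (q ∧ s)) (h' : q ∨ s) (h'' : ¬ (p ∧ r)) :
    (p ∨ (q ∧ ¬ r)) ↔ ¬ (r ∨ (s ∧ ¬ p)) := by tauto

/-- Discrete intermediate value principle: an orbit that changes side does so at some step, so that
some translate of `A` separates `x` from `f x`. -/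
theorem exists_step_mem {x : V} {A : Set V} {a b : ℤ} (hab : a ≤ b)
    (h : ¬ ((f ^ a) x ∈ A ↔ (f ^ b) x ∈ A)) :
    ∃ k, a ≤ k ∧ k < b ∧ ¬ ((f ^ k) x ∈ A ↔ (f ^ k) (f x) ∈ A) := by
  by_contra hcon
  push Not at hcon
  apply h
  revert hcon
  clear h
  induction b, hab using Int.leInduction with
  | base => simp
  | succ b hb ih =>
    intro hcon
    rw [ih (fun k h1 h2 => hcon k h1 (by omega)), hcon b hb (by omega), zpow_add_one_apply]

end Shift

/-! ### The median set in terms of halfspaces, and its non-emptiness -/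

/-- The elements of `H` that separate `x` from `y`. -/
def diffs {V : Type*} (H : Set (Set V)) (x y : V) : Set (Set V) := {A ∈ H | ¬ (x ∈ A ↔ y ∈ A)}

/-- The halfspaces in `H` that are inverted by a power of `f`. -/
def invertedHalfspaces {V : Type*} (H : Set (Set V)) (f : Equiv.Perm V) : Set (Set V) :=
  {A ∈ H | ∃ n : ℤ, shift f n A = Aᶜ}

/-- The halfspaces in `H` that are not inverted by powers of `f`. -/
def stableHalfspaces {V : Type*} (H : Set (Set V)) (f : Equiv.Perm V) : Set (Set V) :=
  H \ invertedHalfspaces H f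

/-- The vertices whose orbit under `f` crosses each wall at most once, the walls inverted by powers
of `f` being ignored. -/
def medSet {V : Type*} (H : Set (Set V)) (f : Equiv.Perm V) : Set V :=
  {x | ∀ A ∈ stableHalfspaces H f, ∀ a b c : ℤ, a ≤ b → b ≤ c →
    (f ^ a) x ∈ A → (f ^ c) x ∈ A → (f ^ b) x ∈ A}

namespace IsMedianWallspace

variable {V : Type*} {Γ : SimpleGraph V} {H : Set (Set V)} (hH : IsMedianWallspace Γ H)
  {f : Equiv.Perm V} (hf : ShiftInvariant f H)

include hf in
omit hH in
theorem shiftInvariant_inverted : ShiftInvariant f (invertedHalfspaces H f) := by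
  rintro n A ⟨hA, k, hk⟩
  exact ⟨hf n A hA, k, by rw [shift_shift, add_comm, ← shift_shift, hk, shift_compl]⟩

include hf in
omit hH in
theorem shiftInvariant_stable : ShiftInvariant f (stableHalfspaces H f) :=
  fun n A hA => ⟨hf n A hA.1, fun h => hA.2 ((shiftInvariant_inverted hf).shift_mem_iff.1 h)⟩

include hH

theorem complClosed_inverted : ComplClosed (invertedHalfspaces H f) := by
  rintro A ⟨hA, k, hk⟩
  exact ⟨hH.compl_mem A hA, k, by rw [shift_compl, hk]⟩

theorem complClosed_stable : ComplClosed (stableHalfspaces H f) := by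
  intro A hA
  refine ⟨hH.compl_mem A hA.1, fun h => hA.2 ?_⟩
  have := hH.complClosed_inverted _ h
  rwa [compl_compl] at this

theorem finite_diffs {𝓐 : Set (Set V)} (h : 𝓐 ⊆ H) (x y : V) : (diffs 𝓐 x y).Finite := by
  refine ((hH.finite_sep x y).union (hH.finite_sep y x)).subset ?_
  rintro A ⟨hA, hd⟩
  by_cases hx : x ∈ A
  · exact Or.inl ⟨h hA, hx, fun hy => hd (by tauto)⟩
  · exact Or.inr ⟨h hA, by tauto, hx⟩

include hf

/-- A halfspace crossed by the orbit of `x` is a translate of one of the finitely many that separate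
`x` from `f x`, and a periodic halfspace has finitely many translates. -/
theorem finite_periodic (x : V) :
    {A ∈ H | IsPeriodic f A ∧ ∃ a b : ℤ, (f ^ a) x ∈ A ∧ (f ^ b) x ∉ A}.Finite := by
  have hfin := hH.finite_diffs subset_rfl x (f x)
  refine ((hfin.subset (Set.sep_subset _ fun B => IsPeriodic f B)).biUnion
    (t := fun B => Set.range fun n : ℤ => shift f n B) fun B hB => hB.2.finite_range).subset ?_
  rintro A ⟨hA, hp, a, b, ha, hb⟩
  have : ∃ k : ℤ, ¬ ((f ^ k) x ∈ A ↔ (f ^ k) (f x) ∈ A) := by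
    rcases le_total a b with hab | hab
    · obtain ⟨k, -, -, h⟩ := exists_step_mem (f := f) (x := x) (A := A) hab (by tauto)
      exact ⟨k, h⟩
    · obtain ⟨k, -, -, h⟩ := exists_step_mem (f := f) (x := x) (A := A) hab (by tauto)
      exact ⟨k, h⟩
  obtain ⟨k, hk⟩ := this
  exact Set.mem_biUnion (x := shift f k A) ⟨⟨hf k A hA, hk⟩, hp.shift k⟩ ⟨-k, shift_neg_shift k A⟩

omit hf in
theorem isPeriodic_of_inverted {A : Set V} (hA : A ∈ invertedHalfspaces H f) : IsPeriodic f A := by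
  obtain ⟨hA, n, hn⟩ := hA
  refine ⟨n + n, ?_, by rw [← shift_shift, hn, shift_compl, hn, compl_compl]⟩
  intro h
  obtain rfl : n = 0 := by omega
  rw [shift_zero] at hn
  obtain ⟨x, hx⟩ := hH.nonempty A hA
  exact (hn ▸ hx : x ∈ Aᶜ) hx

/-- Inverted halfspaces are periodic and crossed by every orbit. -/
theorem finite_inverted : (invertedHalfspaces H f).Finite := by
  obtain ⟨x⟩ := hH.connected.nonempty
  refine (hH.finite_periodic hf x).subset fun A hA => ⟨hA.1, hH.isPeriodic_of_inverted hA, ?_⟩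
  obtain ⟨hA, n, hn⟩ := hA
  have h : (f ^ n) x ∈ A ↔ x ∉ A := by rw [← mem_shift, hn]; rfl
  by_cases hx : x ∈ A
  · exact ⟨0, n, by simpa using hx, by tauto⟩
  · exact ⟨n, 0, by tauto, by simpa using hx⟩

/-- The translates of a non-periodic halfspace are distinct, and only finitely many halfspaces
separate `x` from `y`. -/
theorem finite_diff_times {A : Set V} (hA : A ∈ H) (hp : ¬ IsPeriodic f A) (x y : V) :
    {n : ℤ | ¬ ((f ^ n) x ∈ A ↔ (f ^ n) y ∈ A)}.Finite := by
  refine ((hH.finite_diffs subset_rfl x y).preimage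
    ((shift_family_injective hp).injOn)).subset fun n hn => ?_
  exact ⟨hf n A hA, hn⟩

theorem exists_bound {A : Set V} (hA : A ∈ H) (hp : ¬ IsPeriodic f A) (x y : V) :
    ∃ N : ℤ, 0 ≤ N ∧ ∀ n, N ≤ |n| → ((f ^ n) x ∈ A ↔ (f ^ n) y ∈ A) := by
  obtain ⟨N, hN⟩ := ((hH.finite_diff_times hf hA hp x y).image abs).bddAbove
  refine ⟨|N| + 1, by positivity, fun n hn => ?_⟩
  by_contra h
  have := hN ⟨n, h, rfl⟩
  have := le_abs_self N
  omega

/-- Comparing the orbits of `x` and `f x` shows that the wall is not crossed in the distant past. -/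
theorem dichotomy_neg {A : Set V} (hA : A ∈ H) (hp : ¬ IsPeriodic f A) (x : V) :
    (∃ N : ℤ, ∀ n ≤ N, (f ^ n) x ∈ A) ∨ (∃ N : ℤ, ∀ n ≤ N, (f ^ n) x ∉ A) := by
  obtain ⟨N, hN0, hN⟩ := hH.exists_bound hf hA hp x (f x)
  have key : ∀ n ≤ -N, ((f ^ n) x ∈ A ↔ (f ^ (-N)) x ∈ A) := by
    intro n hn
    by_contra h
    obtain ⟨k, hk, hk', h⟩ := exists_step_mem hn h
    exact h (hN k (by rw [abs_of_nonpos] <;> omega))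
  by_cases h : (f ^ (-N)) x ∈ A
  · exact Or.inl ⟨-N, fun n hn => (key n hn).2 h⟩
  · exact Or.inr ⟨-N, fun n hn h' => h ((key n hn).1 h')⟩

set_option maxHeartbeats 1000000 in
-- The orbit of an arbitrary `x` is straightened: an orientation `Y` of the stable walls is defined
-- from the orbit of `x` so that its translates cross each wall at most once, and differs from that
-- of `x` on finitely many walls. It is therefore realised by a vertex.
theorem medSet_nonempty : (medSet H f).Nonempty := by
  obtain ⟨x⟩ := hH.connected.nonempty
  set S := stableHalfspaces H f with hS
  have hSH : S ⊆ H := fun A hA => hA.1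
  have hSc : ComplClosed S := hH.complClosed_stable
  have hSs : ShiftInvariant f S := shiftInvariant_stable hf
  -- On the periodic walls crossed by the orbit there is no preferred side; an invariant orientation
  -- of these finitely many walls is used instead.
  let P : Set (Set V) := {A ∈ S | IsPeriodic f A ∧ ∃ a b : ℤ, (f ^ a) x ∈ A ∧ (f ^ b) x ∉ A}
  have hPS : P ⊆ S := fun A hA => hA.1
  have hPfin : P.Finite := (hH.finite_periodic hf x).subset fun A hA => ⟨hSH hA.1, hA.2⟩
  have hPc : ComplClosed P := by
    rintro A ⟨h1, h2, a, b, ha, hb⟩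
    exact ⟨hSc A h1, h2.compl, b, a, hb, fun h => h ha⟩
  have hPs : ShiftInvariant f P := by
    rintro n A ⟨h1, h2, a, b, ha, hb⟩
    refine ⟨hSs n A h1, h2.shift n, a - n, b - n, ?_, ?_⟩
    · rw [mem_shift, ← zpow_add_apply]; convert ha using 3; ring
    · rw [mem_shift, ← zpow_add_apply]; convert hb using 4; ring
  obtain ⟨σ, hσP, hσs, hσx, hσu⟩ := exists_invariant_orientation hPfin hPc hPs (fun A hA => hA.2.1)
    (fun A hA n h => hA.1.2 ⟨hA.1.1, n, h⟩)
  -- The side chosen is the one containing the orbit of `x` in the distant past, unless the whole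
  -- forward orbit lies on the other side.
  let rule : Set V → Prop := fun A => (∀ n : ℤ, 0 ≤ n → (f ^ n) x ∈ A) ∨
    ((∃ N : ℤ, ∀ n ≤ N, (f ^ n) x ∈ A) ∧ ∃ n : ℤ, 0 ≤ n ∧ (f ^ n) x ∈ A)
  have dich : ∀ A ∈ S, A ∉ P →
      (∃ N : ℤ, ∀ n ≤ N, (f ^ n) x ∈ A) ∨ (∃ N : ℤ, ∀ n ≤ N, (f ^ n) x ∉ A) := by
    intro A hA hAP
    by_cases hp : IsPeriodic f A
    · by_contra hcon
      push Not at hcon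
      obtain ⟨a, -, ha⟩ := hcon.1 0
      obtain ⟨b, -, hb⟩ := hcon.2 0
      exact hAP ⟨hA, hp, b, a, hb, ha⟩
    · exact hH.dichotomy_neg hf (hSH hA) hp x
  let Y : Set (Set V) := {A ∈ S | (A ∈ P ∧ A ∈ σ) ∨ (A ∉ P ∧ rule A)}
  have hYP : ∀ A ∈ P, A ∈ Y ↔ A ∈ σ := fun A hA =>
    ⟨fun h => h.2.elim (fun h => h.2) fun h => absurd hA h.1, fun h => ⟨hPS hA, Or.inl ⟨hA, h⟩⟩⟩
  have hYN : ∀ A ∈ S, A ∉ P → (A ∈ Y ↔ rule A) := fun A hA hAP =>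
    ⟨fun h => h.2.elim (fun h => absurd h.1 hAP) fun h => h.2, fun h => ⟨hA, Or.inr ⟨hAP, h⟩⟩⟩
  have hxor : ∀ A ∈ S, A ∈ Y ↔ Aᶜ ∉ Y := by
    intro A hA
    have hcP : Aᶜ ∈ P ↔ A ∈ P :=
      ⟨fun h => by simpa using hPc _ h, hPc A⟩
    by_cases hAP : A ∈ P
    · rw [hYP A hAP, hYP _ (hPc A hAP), hσx A hAP]
    · rw [hYN A hA hAP, hYN _ (hSc A hA) (fun h => hAP (hcP.1 h))]
      · simp only [rule, Set.mem_compl_iff]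
        have hnot : ¬ ((∃ N : ℤ, ∀ n ≤ N, (f ^ n) x ∈ A) ∧ (∃ N : ℤ, ∀ n ≤ N, (f ^ n) x ∉ A)) := by
          rintro ⟨⟨N, hN⟩, M, hM⟩
          exact hM (min N M) (min_le_right _ _) (hN _ (min_le_left _ _))
        have h0 : ¬ ((∀ n : ℤ, 0 ≤ n → (f ^ n) x ∈ A) ∧ (∀ n : ℤ, 0 ≤ n → (f ^ n) x ∉ A)) :=
          fun h => h.2 0 le_rfl (h.1 0 le_rfl)
        have h1 : (∃ n : ℤ, 0 ≤ n ∧ (f ^ n) x ∈ A) ↔ ¬ (∀ n : ℤ, 0 ≤ n → (f ^ n) x ∉ A) := by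
          push Not; rfl
        have h2 : (∃ n : ℤ, 0 ≤ n ∧ (f ^ n) x ∉ A) ↔ ¬ (∀ n : ℤ, 0 ≤ n → (f ^ n) x ∈ A) := by
          push Not; rfl
        have h3 := dich A hA hAP
        rw [h1, h2]
        exact or_and_not_iff hnot h3 h0
  -- The orbit visits these halfspaces arbitrarily far in both directions, so a halfspace outside
  -- `P` that contains one of them is selected by the rule.
  have often : ∀ A ∈ P, ∀ n : ℤ, (∃ m ≤ n, (f ^ m) x ∈ A) ∧ ∃ m, n ≤ m ∧ (f ^ m) x ∈ A := by
    rintro A ⟨-, hp, a, -, ha, -⟩ n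
    obtain ⟨p, hp0, hp⟩ := hp.exists_nat
    have : ∀ q : ℤ, (f ^ (p * q + a)) x ∈ A := by
      intro q
      rw [zpow_add_apply, ← mem_shift, shift_mul_of_eq hp]
      exact ha
    have hp1 : (1 : ℤ) ≤ p := by exact_mod_cast hp0
    have h1 : |a| + |n| ≤ p * (|a| + |n|) := le_mul_of_one_le_left (by positivity) hp1
    refine ⟨⟨_, ?_, this (-(|a| + |n|))⟩, ⟨_, ?_, this (|a| + |n|)⟩⟩
    · have := le_abs_self a
      have := neg_abs_le n
      rw [mul_neg]; omega
    · have := neg_abs_le a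
      have := le_abs_self n
      omega
  have hup' : ∀ A ∈ P, ∀ B ∈ S, B ∉ P → A ⊆ B → rule B := by
    intro A hA B hB hBP hAB
    obtain ⟨-, m, hm, hmA⟩ := often A hA 0
    refine Or.inr ⟨?_, m, hm, hAB hmA⟩
    rcases dich B hB hBP with h | ⟨N, hN⟩
    · exact h
    · obtain ⟨⟨k, hk, hkA⟩, -⟩ := often A hA N
      exact absurd (hAB hkA) (hN k hk)
  have hup : ∀ A ∈ Y, ∀ B ∈ S, A ⊆ B → B ∈ Y := by
    rintro A ⟨hA, ⟨hAP, hAσ⟩ | ⟨hAP, hAr⟩⟩ B hB hAB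
    · by_cases hBP : B ∈ P
      · exact ⟨hB, Or.inl ⟨hBP, hσu A hAσ B hBP hAB⟩⟩
      · exact ⟨hB, Or.inr ⟨hBP, hup' A hAP B hB hBP hAB⟩⟩
    · by_cases hBP : B ∈ P
      · have h1 : Aᶜ ∈ Y := by
          refine ⟨hSc A hA, Or.inr ⟨fun h => hAP (by simpa using hPc _ h), ?_⟩⟩
          exact hup' Bᶜ (hPc B hBP) _ (hSc A hA) (fun h => hAP (by simpa using hPc _ h))
            (Set.compl_subset_compl.2 hAB)
        exact absurd h1 ((hxor A hA).1 ⟨hA, Or.inr ⟨hAP, hAr⟩⟩)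
      · refine ⟨hB, Or.inr ⟨hBP, ?_⟩⟩
        rcases hAr with h | ⟨⟨N, hN⟩, n, hn, h⟩
        · exact Or.inl fun n hn => hAB (h n hn)
        · exact Or.inr ⟨⟨N, fun n hn => hAB (hN n hn)⟩, n, hn, hAB h⟩
  -- A non-periodic `A` chosen against `x` contains the past and a later point of the orbit, so its
  -- wall is crossed at a time `a < 0` and a time `b ≥ 0`. Its translate `B` by `b` separates `x`
  -- from `f x` and is also crossed at time `a - b`; there are finitely many such `B` and crossing
  -- times, and they bound `b`.
  have hfin : {A ∈ Y | x ∉ A}.Finite := by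
    let K : Set V → Set ℤ := fun B => {k | ¬ ((f ^ k) x ∈ B ↔ (f ^ k) (f x) ∈ B)}
    have hfin1 : {B ∈ diffs H x (f x) | ¬ IsPeriodic f B}.Finite :=
      (hH.finite_diffs subset_rfl x (f x)).subset (Set.sep_subset _ _)
    have hfin2 : (⋃ B ∈ {B ∈ diffs H x (f x) | ¬ IsPeriodic f B}, ⋃ k ∈ K B,
        (fun b : ℤ => shift f (-b) B) '' Set.Icc 0 (-k)).Finite := by
      refine hfin1.biUnion fun B hB => Set.Finite.biUnion ?_ fun k _ => (Set.finite_Icc _ _).image _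
      exact hH.finite_diff_times hf hB.1.1 hB.2 x (f x)
    refine (hPfin.union hfin2).subset ?_
    rintro A ⟨⟨hA, ⟨hAP, -⟩ | ⟨hAP, hAr⟩⟩, hxA⟩
    · exact Or.inl hAP
    · right
      have hx0 : (f ^ (0 : ℤ)) x ∉ A := by simpa using hxA
      rcases hAr with h | ⟨⟨N, hN⟩, n, hn, h⟩
      · exact absurd (h 0 le_rfl) hx0
      · have hneg := hN (min N 0) (min_le_left _ _)
        obtain ⟨a, -, ha0, ha⟩ := exists_step_mem (f := f) (x := x) (A := A)
          (min_le_right N 0) (by tauto)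
        obtain ⟨b, hb0, -, hb⟩ := exists_step_mem (f := f) (x := x) (A := A) hn (by tauto)
        have hper : ¬ IsPeriodic f A := fun hp => hAP ⟨hA, hp, n, 0, h, hx0⟩
        have hmem : shift f b A ∈ {B ∈ diffs H x (f x) | ¬ IsPeriodic f B} := by
          refine ⟨⟨hf b A (hSH hA), hb⟩, fun hp => hper ?_⟩
          have := hp.shift (-b)
          rwa [shift_neg_shift] at this
        refine Set.mem_biUnion hmem (Set.mem_biUnion (x := -b + a) ?_
          ⟨b, ⟨hb0, by omega⟩, shift_neg_shift b A⟩)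
        change ¬ (x ∈ shift f (-b + a) (shift f b A) ↔ f x ∈ shift f (-b + a) (shift f b A))
        rw [shift_shift]
        have e : -b + a + b = a := by ring
        rw [e]; exact ha
  obtain ⟨v, hv⟩ := hH.exists_of_orientation hSH hSc (fun A hA => hA.1) hxor hup hfin
  refine ⟨v, fun A hA a b c hab hbc ha hc => ?_⟩
  have hv' : ∀ n, (f ^ n) v ∈ A ↔ shift f n A ∈ Y := fun n => by
    rw [← hv _ (hSs n A hA), mem_shift]
  rw [hv'] at ha hc ⊢
  by_cases hAP : A ∈ P
  · have : ∀ n, shift f n A ∈ Y ↔ A ∈ σ := by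
      intro n
      rw [hYP _ (hPs n A hAP), hσs.shift_mem_iff]
    rw [this] at ha ⊢
    exact ha
  -- At time `n` the rule is applied to the orbit of `x` from `n` on. If `A` is the side of the
  -- past, membership lasts until the last visit to `A`; otherwise it begins once the orbit stays in
  -- `A` for ever. In both cases the wall is crossed at most once.
  · have hr : ∀ n, shift f n A ∈ Y ↔ (∀ m, n ≤ m → (f ^ m) x ∈ A) ∨
        ((∃ N : ℤ, ∀ n ≤ N, (f ^ n) x ∈ A) ∧ ∃ m, n ≤ m ∧ (f ^ m) x ∈ A) := by
      intro n
      rw [hYN _ (hSs n A hA) (fun h => hAP (hPs.shift_mem_iff.1 h))]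
      simp only [rule, mem_shift, ← zpow_add_apply]
      refine or_congr ⟨fun h m hm => ?_, fun h m hm => h _ (by omega)⟩
        (and_congr ⟨?_, ?_⟩ ⟨?_, ?_⟩)
      · have := h (m - n) (by omega)
        rwa [add_sub_cancel] at this
      · rintro ⟨N, hN⟩
        refine ⟨N + n, fun k hk => ?_⟩
        have := hN (k - n) (by omega)
        rwa [add_sub_cancel] at this
      · rintro ⟨N, hN⟩
        exact ⟨N - n, fun k hk => hN _ (by omega)⟩
      · rintro ⟨k, hk, h⟩
        exact ⟨n + k, by omega, h⟩
      · rintro ⟨k, hk, h⟩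
        exact ⟨k - n, by omega, by rwa [add_sub_cancel]⟩
    rw [hr] at ha hc ⊢
    by_cases hev : ∃ N : ℤ, ∀ n ≤ N, (f ^ n) x ∈ A
    · obtain ⟨m, hm, h⟩ : ∃ m, c ≤ m ∧ (f ^ m) x ∈ A := by
        rcases hc with h | h
        · exact ⟨c, le_rfl, h c le_rfl⟩
        · exact h.2
      exact Or.inr ⟨hev, m, by omega, h⟩
    · rcases ha with h | h
      · exact Or.inl fun m hm => h m (by omega)
      · exact absurd h.1 hev

end IsMedianWallspace

/-! ### Inverted halfspaces and equivariance -/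

section Shift

variable {V : Type*} {f : Equiv.Perm V}

theorem zpow_neg_mul_apply {n : ℤ} (x : V) : (f ^ n) ((f ^ (-n)) x) = x := by
  rw [← zpow_add_apply]; simp

theorem shift_mul_of_eq_compl {n : ℤ} {A : Set V} (h : shift f n A = Aᶜ) (q : ℕ) :
    shift f (n * q) A = if Even q then A else Aᶜ := by
  induction q with
  | zero => simp [shift_zero]
  | succ q ih =>
    rw [Nat.cast_succ, mul_add, mul_one, add_comm, ← shift_shift, ih]
    by_cases hq : Even q
    · rw [if_pos hq, if_neg (by simpa [Nat.even_add_one] using hq), h]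
    · rw [if_neg hq, if_pos (by simpa [Nat.even_add_one] using hq), shift_compl, h, compl_compl]

theorem exists_nat_shift_eq_compl {n : ℤ} {A : Set V} (h : shift f n A = Aᶜ) :
    ∃ m : ℕ, shift f m A = Aᶜ := by
  obtain ⟨m, rfl | rfl⟩ := n.eq_nat_or_neg
  · exact ⟨m, h⟩
  · refine ⟨m, ?_⟩
    have h2 := shift_mul_of_eq_compl h 2
    have h3 := shift_neg_shift (f := f) (-(m : ℤ)) A
    rw [h, neg_neg, shift_compl] at h3
    rw [← compl_compl (shift f m A), h3]

/-- Two distinct hyperplanes inverted by powers of `f` are transverse. -/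
theorem inter_nonempty_of_inverted {A B : Set V} (hA : A.Nonempty) (hB : B.Nonempty)
    (hAB : A ≠ Bᶜ) {n m : ℤ} (hn : shift f n A = Aᶜ) (hm : shift f m B = Bᶜ) :
    (A ∩ B).Nonempty := by
  have key : ∀ {A B : Set V}, A.Nonempty → B.Nonempty → A ≠ Bᶜ → ∀ {n m n' i j m' : ℕ},
      shift f n A = Aᶜ → shift f m B = Bᶜ → n = 2 ^ i * n' → m = 2 ^ j * m' → Odd n' → Odd m' →
      i ≤ j → (A ∩ B).Nonempty := by
    intro A B hA hB hAB n m n' i j m' hn hm hni hmj hn' hm' hij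
    by_contra hcon
    have hsub : A ⊆ Bᶜ := fun x hx hx' => hcon ⟨x, hx, hx'⟩
    -- Since `n'` is odd, this common multiple of `n` and `m` still inverts `B`, while it fixes or
    -- inverts `A` according to parity. Applied to `A ⊆ Bᶜ`, it gives `A ⊆ B` or `Aᶜ ⊆ B`, both
    -- impossible.
    have e1 : (m : ℤ) * n' = n * (2 ^ (j - i) * m' : ℕ) := by
      obtain ⟨k, rfl⟩ := Nat.exists_eq_add_of_le hij
      rw [hni, hmj]; simp [pow_add]; ring
    have h1 := shift_mul_of_eq_compl hm n'
    rw [if_neg (Nat.not_even_iff_odd.2 hn')] at h1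
    have h2 := shift_mul_of_eq_compl hn (2 ^ (j - i) * m')
    rw [← e1] at h2
    have h3 := shift_mono (f := f) (m * n') hsub
    rw [shift_compl, h1, h2, compl_compl] at h3
    split_ifs at h3
    · obtain ⟨x, hx⟩ := hA
      exact hsub hx (h3 hx)
    · exact hAB (hsub.antisymm (Set.compl_subset_comm.1 h3))
  obtain ⟨n, hn⟩ := exists_nat_shift_eq_compl hn
  obtain ⟨m, hm⟩ := exists_nat_shift_eq_compl hm
  have hne : ∀ {A : Set V} {n : ℕ}, A.Nonempty → shift f n A = Aᶜ → n ≠ 0 := by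
    rintro A n ⟨x, hx⟩ h rfl
    rw [Nat.cast_zero, shift_zero] at h
    exact (h ▸ hx : x ∈ Aᶜ) hx
  obtain ⟨i, n', hn', hni⟩ := Nat.exists_eq_two_pow_mul_odd (hne hA hn)
  obtain ⟨j, m', hm', hmj⟩ := Nat.exists_eq_two_pow_mul_odd (hne hB hm)
  rcases le_total i j with hij | hij
  · exact key hA hB hAB hn hm hni hmj hn' hm' hij
  · rw [Set.inter_comm]
    exact key hB hA (fun h => hAB (by rw [h, compl_compl])) hm hn hmj hni hm' hn' hij

theorem ShiftInvariant.ncard_sep_apply {𝓐 : Set (Set V)} (h : ShiftInvariant f 𝓐) (n : ℤ)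
    (x y : V) : (sep 𝓐 ((f ^ n) x) ((f ^ n) y)).ncard = (sep 𝓐 x y).ncard := by
  have : sep 𝓐 x y = shift f n '' sep 𝓐 ((f ^ n) x) ((f ^ n) y) := by
    ext A
    constructor
    · rintro ⟨h1, h2, h3⟩
      have e : shift f n (shift f (-n) A) = A := by
        rw [shift_shift, add_neg_cancel, shift_zero]
      refine ⟨shift f (-n) A, ⟨h _ A h1, ?_, ?_⟩, e⟩
      · rwa [← mem_shift, e]
      · rwa [← mem_shift, e]
    · rintro ⟨B, ⟨h1, h2, h3⟩, rfl⟩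
      exact ⟨h _ B h1, h2, h3⟩
  rw [this, Set.ncard_image_of_injective _ (shift_injective n)]

theorem zpow_comp_eq {f h : Equiv.Perm V} {k : ℤ} (hk : ∀ x, f (h x) = h ((f ^ k) x)) (n : ℤ)
    (x : V) : (f ^ n) (h x) = h ((f ^ (k * n)) x) := by
  have key : ∀ (n : ℕ) (x : V), (f ^ (n : ℤ)) (h x) = h ((f ^ (k * n)) x) := by
    intro n
    induction n with
    | zero => simp
    | succ n ih =>
      intro x
      rw [Nat.cast_succ, zpow_add_one_apply, hk, ih, ← zpow_add_apply, mul_add, mul_one]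
  obtain ⟨m, rfl | rfl⟩ := n.eq_nat_or_neg
  · exact key m x
  · have := key m ((f ^ (k * -(m : ℤ))) x)
    rw [← zpow_add_apply] at this
    have e : k * (m : ℤ) + k * -(m : ℤ) = 0 := by ring
    rw [e, zpow_zero, Equiv.Perm.one_apply] at this
    rw [← this, ← zpow_add_apply]
    simp

end Shift

/-! ### The median set as a subalgebra; axial and transverse halfspaces -/

theorem or_of_majority {p q r : Prop} (h : (p ∧ q) ∨ (q ∧ r) ∨ (p ∧ r)) :
    (p ∨ q) ∧ (q ∨ r) ∧ (p ∨ r) := by tauto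

theorem not_and_of_not_majority {p q r : Prop} (h : ¬ ((p ∧ q) ∨ (q ∧ r) ∨ (p ∧ r))) :
    (¬ p ∧ ¬ q) ∨ (¬ q ∧ ¬ r) ∨ (¬ p ∧ ¬ r) := by tauto

/-- The halfspaces crossed by the orbits of `f` in its median set. -/
def axialHalfspaces {V : Type*} (H : Set (Set V)) (f : Equiv.Perm V) : Set (Set V) :=
  {A ∈ stableHalfspaces H f | ∃ x ∈ medSet H f, ∃ a b : ℤ, (f ^ a) x ∈ A ∧ (f ^ b) x ∉ A}

/-- The remaining halfspaces. -/
def transverseHalfspaces {V : Type*} (H : Set (Set V)) (f : Equiv.Perm V) : Set (Set V) :=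
  stableHalfspaces H f \ axialHalfspaces H f

namespace IsMedianWallspace

variable {V : Type*} {Γ : SimpleGraph V} {H : Set (Set V)} (hH : IsMedianWallspace Γ H)
  {f : Equiv.Perm V} (hf : ShiftInvariant f H)

omit hH in
theorem zpow_mem_medSet {x : V} (hx : x ∈ medSet H f) (n : ℤ) : (f ^ n) x ∈ medSet H f := by
  intro A hA a b c hab hbc ha hc
  rw [← zpow_add_apply] at ha hc ⊢
  exact hx A hA _ _ _ (by omega) (by omega) ha hc

omit hH in
theorem mem_medSet_congr {x y : V} (hx : x ∈ medSet H f) (hf : ShiftInvariant f H)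
    (h : ∀ A ∈ stableHalfspaces H f, x ∈ A ↔ y ∈ A) : y ∈ medSet H f := by
  intro A hA a b c hab hbc ha hc
  have h' : ∀ n : ℤ, (f ^ n) x ∈ A ↔ (f ^ n) y ∈ A := fun n => h _ (shiftInvariant_stable hf n A hA)
  rw [← h'] at ha hc ⊢
  exact hx A hA a b c hab hbc ha hc

omit hH in
-- A periodic halfspace visited once is visited arbitrarily far in both directions, so an orbit that
-- crosses its wall at most once never leaves it.
theorem not_isPeriodic_of_mem {x : V} (hx : x ∈ medSet H f)
    {A : Set V} (hA : A ∈ stableHalfspaces H f) {a b : ℤ} (ha : (f ^ a) x ∈ A)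
    (hb : (f ^ b) x ∉ A) : ¬ IsPeriodic f A := by
  intro hp
  obtain ⟨p, hp0, hp⟩ := hp.exists_nat
  have h : ∀ q : ℤ, (f ^ (p * q + a)) x ∈ A := by
    intro q
    rw [zpow_add_apply, ← mem_shift, shift_mul_of_eq hp]
    exact ha
  have hp1 : (1 : ℤ) ≤ p := by exact_mod_cast hp0
  have h1 : |a| + |b| ≤ p * (|a| + |b|) := le_mul_of_one_le_left (by positivity) hp1
  have h2 := le_abs_self a
  have h3 := neg_abs_le a
  have h4 := le_abs_self b
  have h5 := neg_abs_le b
  refine hb (hx A hA _ _ _ ?_ ?_ (h (-(|a| + |b|))) (h (|a| + |b|)))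
  · rw [mul_neg]; omega
  · omega

include hH

include hf in
-- The two orbits are on the same side of a non-periodic wall at large times, so they cannot cross
-- it in opposite directions.
theorem monotone_coherent {x y : V} (hx : x ∈ medSet H f) (hy : y ∈ medSet H f) {A : Set V}
    (hA : A ∈ stableHalfspaces H f) {a b a' b' : ℤ} (hab : a ≤ b) (hab' : a' ≤ b')
    (h1 : (f ^ a) x ∈ A) (h2 : (f ^ b) x ∉ A) (h3 : (f ^ a') y ∉ A) (h4 : (f ^ b') y ∈ A) :
    False := by
  have hp := not_isPeriodic_of_mem hx hA h1 h2
  obtain ⟨N, hN0, hN⟩ := hH.exists_bound hf hA.1 hp x y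
  have hn := hN (max N (max b b')) (by
    rw [abs_of_nonneg (hN0.trans (le_max_left _ _))]; exact le_max_left _ _)
  have e1 : (f ^ (max N (max b b'))) x ∉ A := fun h =>
    h2 (hx A hA a b _ hab ((le_max_left _ _).trans (le_max_right _ _)) h1 h)
  have e2 : (f ^ (max N (max b b'))) y ∈ A := by
    by_contra h
    exact hy Aᶜ (hH.complClosed_stable A hA) a' b' _ hab'
      ((le_max_right _ _).trans (le_max_right _ _)) h3 h h4
  exact e1 (hn.2 e2)

include hf in
theorem zpow_med_mem {x y z : V} {A : Set V} (hA : A ∈ H) (n : ℤ) :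
    (f ^ n) (hH.med x y z) ∈ A ↔ ((f ^ n) x ∈ A ∧ (f ^ n) y ∈ A) ∨
      ((f ^ n) y ∈ A ∧ (f ^ n) z ∈ A) ∨ ((f ^ n) x ∈ A ∧ (f ^ n) z ∈ A) :=
  hH.mem_med (hf n A hA)

include hf in
-- If the median left `A` and came back, two of the three points would be outside `A` at time `b`,
-- while at least one of these two is in `A` at time `a`, and likewise at time `c`. If it is the
-- same point, its orbit crosses the wall twice; otherwise the two orbits contradict
-- `monotone_coherent`.
theorem med_mem_medSet {x y z : V} (hx : x ∈ medSet H f) (hy : y ∈ medSet H f)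
    (hz : z ∈ medSet H f) : hH.med x y z ∈ medSet H f := by
  have key : ∀ {x y : V}, x ∈ medSet H f → y ∈ medSet H f → ∀ {A}, A ∈ stableHalfspaces H f →
      ∀ {a b c : ℤ}, a ≤ b → b ≤ c → (f ^ b) x ∉ A → (f ^ b) y ∉ A →
      ((f ^ a) x ∈ A ∨ (f ^ a) y ∈ A) → ((f ^ c) x ∈ A ∨ (f ^ c) y ∈ A) → False := by
    intro x y hx hy A hA a b c hab hbc hbx hby ha hc
    rcases ha with ha | ha <;> rcases hc with hc | hc
    · exact hbx (hx A hA a b c hab hbc ha hc)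
    · exact hH.monotone_coherent hf hx hy hA hab hbc ha hbx hby hc
    · exact hH.monotone_coherent hf hy hx hA hab hbc ha hby hbx hc
    · exact hby (hy A hA a b c hab hbc ha hc)
  intro A hA a b c hab hbc ha hc
  rw [hH.zpow_med_mem hf hA.1] at ha hc ⊢
  by_contra hb
  obtain ⟨a1, a2, a3⟩ := or_of_majority ha
  obtain ⟨c1, c2, c3⟩ := or_of_majority hc
  rcases not_and_of_not_majority hb with ⟨b1, b2⟩ | ⟨b1, b2⟩ | ⟨b1, b2⟩
  · exact key hx hy hA hab hbc b1 b2 a1 c1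
  · exact key hy hz hA hab hbc b1 b2 a2 c2
  · exact key hx hz hA hab hbc b1 b2 a3 c3

theorem complClosed_axial : ComplClosed (axialHalfspaces H f) := by
  rintro A ⟨h1, x, hx, a, b, ha, hb⟩
  exact ⟨hH.complClosed_stable A h1, x, hx, b, a, hb, fun h => h ha⟩

include hf in
omit hH in
theorem shiftInvariant_axial : ShiftInvariant f (axialHalfspaces H f) := by
  rintro n A ⟨h1, x, hx, a, b, ha, hb⟩
  refine ⟨shiftInvariant_stable hf n A h1, _, zpow_mem_medSet hx (-n), a, b, ?_, ?_⟩
  · rw [mem_shift, ← zpow_add_apply, ← zpow_add_apply]; convert ha using 3; ring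
  · rw [mem_shift, ← zpow_add_apply, ← zpow_add_apply]; convert hb using 4; ring

include hf in
-- An orbit contained in `A` would force every other orbit into `A` at large positive and negative
-- times, hence at all times for one in the median set. Thus every orbit, even outside the median
-- set, crosses the wall.
theorem axial_crosses {A : Set V} (hA : A ∈ axialHalfspaces H f) (y : V) :
    ∃ a b : ℤ, (f ^ a) y ∈ A ∧ (f ^ b) y ∉ A := by
  have key : ∀ A ∈ axialHalfspaces H f, ¬ ∀ n : ℤ, (f ^ n) y ∈ A := by
    rintro A ⟨h1, x, hx, a, b, ha, hb⟩ hall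
    obtain ⟨N, hN0, hN⟩ := hH.exists_bound hf h1.1
      (not_isPeriodic_of_mem hx h1 ha hb) x y
    have h3 := le_abs_self b
    have h4 := neg_abs_le b
    refine hb (hx A h1 (-(N + |b|)) b (N + |b|) (by omega) (by omega) ?_ ?_)
    · refine (hN _ ?_).2 (hall _)
      rw [abs_neg, abs_of_nonneg] <;> omega
    · refine (hN _ ?_).2 (hall _)
      rw [abs_of_nonneg] <;> omega
  by_contra hcon
  push Not at hcon
  by_cases h0 : ∃ a : ℤ, (f ^ a) y ∈ A
  · obtain ⟨a, ha⟩ := h0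
    exact key A hA fun n => hcon a n ha
  · push Not at h0
    exact key Aᶜ (hH.complClosed_axial A hA) h0

include hf in
/-- The orbit of a point of the median set goes from one side of an axial wall to the other. -/
theorem axial_ends {A : Set V} (hA : A ∈ axialHalfspaces H f) {y : V} (hy : y ∈ medSet H f) :
    ∃ N : ℤ, 0 ≤ N ∧ ((∀ n, N ≤ n → (f ^ n) y ∈ A ∧ (f ^ (-n)) y ∉ A) ∨
      ∀ n, N ≤ n → (f ^ n) y ∉ A ∧ (f ^ (-n)) y ∈ A) := by
  obtain ⟨a, b, ha, hb⟩ := hH.axial_crosses hf hA y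
  have h1 := le_abs_self a
  have h2 := neg_abs_le a
  have h3 := le_abs_self b
  have h4 := neg_abs_le b
  have hc := hH.complClosed_stable A hA.1
  refine ⟨|a| + |b|, by positivity, ?_⟩
  rcases le_total a b with hab | hab
  · refine Or.inr fun n hn => ⟨fun h => ?_, ?_⟩
    · exact hb (hy A hA.1 a b n hab (by omega) ha h)
    · by_contra h
      exact hy Aᶜ hc (-n) a b (by omega) hab h hb ha
  · refine Or.inl fun n hn => ⟨?_, fun h => ?_⟩
    · by_contra h
      exact hy Aᶜ hc b a n hab (by omega) hb h ha
    · exact hb (hy A hA.1 (-n) b a (by omega) hab h ha)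

omit hH in
theorem transverse_constant {A : Set V} (hA : A ∈ transverseHalfspaces H f) {y : V}
    (hy : y ∈ medSet H f) (n : ℤ) : (f ^ n) y ∈ A ↔ y ∈ A := by
  constructor
  · intro h
    by_contra h0
    exact hA.2 ⟨hA.1, y, hy, n, 0, h, by simpa using h0⟩
  · intro h
    by_contra h0
    exact hA.2 ⟨hA.1, y, hy, 0, n, by simpa using h, h0⟩

include hf in
-- The witness is the median of two distant points of the orbit of `x`, one in the future and one in
-- the past, with `y`. Transverse sides are constant along the orbit, so those of `x` win; the axial
-- walls between `x` and `y` separate the two distant points, so there `y` decides.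
theorem exists_transverse_axial {x y : V} (hx : x ∈ medSet H f) (hy : y ∈ medSet H f) :
    ∃ w ∈ medSet H f, (∀ A ∈ transverseHalfspaces H f, w ∈ A ↔ x ∈ A) ∧
      ∀ A ∈ axialHalfspaces H f, w ∈ A ↔ y ∈ A := by
  have hfin : (diffs (axialHalfspaces H f) x y).Finite := hH.finite_diffs (fun A hA => hA.1.1) x y
  have hbd : ∀ A, ∃ N : ℤ, A ∈ axialHalfspaces H f → ∀ n, N ≤ n →
      ¬ ((f ^ n) x ∈ A ↔ (f ^ (-n)) x ∈ A) := by
    intro A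
    by_cases hA : A ∈ axialHalfspaces H f
    · obtain ⟨N, -, h | h⟩ := hH.axial_ends hf hA hx
      · exact ⟨N, fun _ n hn => by have := h n hn; tauto⟩
      · exact ⟨N, fun _ n hn => by have := h n hn; tauto⟩
    · exact ⟨0, fun h => absurd h hA⟩
  choose N hN using hbd
  -- One time works for all the axial halfspaces separating `x` from `y`, which are finitely many.
  -- On the others `x` and `y` agree.
  obtain ⟨M, hM⟩ := (hfin.image N).bddAbove
  set n := max M 0 with hn
  refine ⟨hH.med ((f ^ n) x) ((f ^ (-n)) x) y, hH.med_mem_medSet hf (zpow_mem_medSet hx _)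
    (zpow_mem_medSet hx _) hy, fun A hA => ?_, fun A hA => ?_⟩
  · rw [hH.mem_med hA.1.1, transverse_constant hA hx, transverse_constant hA hx]
    tauto
  · rw [hH.mem_med hA.1.1]
    by_cases hd : (f ^ n) x ∈ A ↔ (f ^ (-n)) x ∈ A
    · have hxy : x ∈ A ↔ y ∈ A := by
        by_contra hcon
        exact hN A hA n ((hM ⟨A, ⟨hA, hcon⟩, rfl⟩).trans (le_max_left _ _)) hd
      have hn0 : 0 ≤ n := le_max_right _ _
      have h1 := hx A hA.1 (-n) 0 n (by omega) hn0
      have h2 := hx Aᶜ (hH.complClosed_stable A hA.1) (-n) 0 n (by omega) hn0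
      simp only [zpow_zero, Equiv.Perm.one_apply, Set.mem_compl_iff] at h1 h2
      tauto
    · tauto

include hf in
-- The Helly property applies: the chosen inverted halfspaces meet pairwise, and the set of vertices
-- with the stable sides of `w` meets each of them.
theorem exists_inverted {w : V} (hw : w ∈ medSet H f) {Y : Set (Set V)}
    (hY : ∀ A ∈ invertedHalfspaces H f, A ∈ Y ↔ Aᶜ ∉ Y) :
    ∃ v ∈ medSet H f, (∀ A ∈ stableHalfspaces H f, w ∈ A ↔ v ∈ A) ∧
      ∀ A ∈ invertedHalfspaces H f, v ∈ A ↔ A ∈ Y := by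
  obtain ⟨v, hv, hv'⟩ := hH.exists_mem_of_finite
    (C := {v | ∀ A ∈ stableHalfspaces H f, w ∈ A ↔ v ∈ A}) (D := invertedHalfspaces H f ∩ Y)
    ⟨w, fun _ _ => Iff.rfl⟩ (fun x hx y hy z => by
      refine ⟨fun A hA => ?_, fun A hA => ?_, fun A hA => ?_⟩ <;>
        (rw [hH.mem_med hA.1, ← hx A hA, ← hy A hA]; tauto))
    ((hH.finite_inverted hf).subset Set.inter_subset_left) (fun A hA => hA.1.1) (by
      rintro A ⟨⟨hA, n, hn⟩, -⟩
      by_cases hwA : w ∈ A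
      · exact ⟨w, fun _ _ => Iff.rfl, hwA⟩
      have h1 : (f ^ n) w ∈ A := by
        rw [← mem_shift, hn]; exact hwA
      have h2 : (f ^ (-n)) w ∈ A := by
        have := shift_neg_shift (f := f) n A
        rw [hn, shift_compl] at this
        by_contra h
        exact hwA (this ▸ (h : w ∈ (shift f (-n) A)ᶜ))
      -- Both `f ^ n` and its inverse move `w` into `A`, so this median is in `A`. On stable walls
      -- `w` is already between its two translates, so the median keeps the sides of `w`.
      refine ⟨hH.med ((f ^ n) w) ((f ^ (-n)) w) w, fun B hB => ?_, ?_⟩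
      · rw [hH.mem_med hB.1]
        have hBc := hH.complClosed_stable B hB
        rcases le_total n 0 with h0 | h0
        · have h3 := hw B hB n 0 (-n) h0 (by omega)
          have h4 := hw Bᶜ hBc n 0 (-n) h0 (by omega)
          simp only [zpow_zero, Equiv.Perm.one_apply, Set.mem_compl_iff] at h3 h4
          tauto
        · have h3 := hw B hB (-n) 0 n (by omega) h0
          have h4 := hw Bᶜ hBc (-n) 0 n (by omega) h0
          simp only [zpow_zero, Equiv.Perm.one_apply, Set.mem_compl_iff] at h3 h4
          tauto
      · rw [hH.mem_med hA]; exact Or.inl ⟨h1, h2⟩)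
    (by
      rintro A ⟨⟨hA, n, hn⟩, hAY⟩ B ⟨hB', hBY⟩
      obtain ⟨hB, m, hm⟩ := id hB'
      refine inter_nonempty_of_inverted (hH.nonempty A hA) (hH.nonempty B hB) ?_ hn hm
      rintro rfl
      exact (hY B hB').1 hBY hAY)
  refine ⟨v, mem_medSet_congr hw hf hv, hv, fun A hA => ⟨fun h => ?_, fun h => hv' A ⟨hA, h⟩⟩⟩
  rw [hY A hA]
  exact fun h' => hv' _ ⟨hH.complClosed_inverted A hA, h'⟩ h

include hf in
theorem ncard_sep_stable_zpow {x : V} (hx : x ∈ medSet H f) (k : ℕ) :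
    (sep (stableHalfspaces H f) x ((f ^ (k : ℤ)) x)).ncard =
      k * (sep (stableHalfspaces H f) x (f x)).ncard := by
  have hfin := fun x y => hH.finite_sep_of_subset (𝓐 := stableHalfspaces H f) (fun A hA => hA.1) x y
  induction k with
  | zero => simp [sep_self]
  | succ k ih =>
    rw [(hH.complClosed_stable (f := f)).ncard_sep_add hfin (m := (f ^ (k : ℤ)) x), ih,
      Nat.cast_succ, zpow_add_one_apply, (shiftInvariant_stable hf).ncard_sep_apply]
    · ring
    · intro A hA h0 h1
      exact hx A hA 0 k (k + 1 : ℕ) (by omega) (by omega) (by simpa using h0) h1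

theorem dist_eq_add (x y : V) : Γ.dist x y = (sep (stableHalfspaces H f) x y).ncard +
    (sep (invertedHalfspaces H f) x y).ncard := by
  have h1 : stableHalfspaces H f ⊆ H := fun A hA => hA.1
  have h2 : invertedHalfspaces H f ⊆ H := fun A hA => hA.1
  rw [hH.dist_eq, ← Set.ncard_union_eq _ (hH.finite_sep_of_subset h1 _ _)
    (hH.finite_sep_of_subset h2 _ _)]
  · congr 1
    ext A
    simp only [mem_sep, Set.mem_union, stableHalfspaces, Set.mem_sdiff]
    have := @h2 A
    tauto
  · rw [Set.disjoint_left]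
    exact fun A hA hA' => hA.1.2 hA'.1

include hf in
theorem dist_zpow_apply (n : ℤ) (x y : V) : Γ.dist ((f ^ n) x) ((f ^ n) y) = Γ.dist x y := by
  rw [hH.dist_eq, hH.dist_eq, hf.ncard_sep_apply]

include hf in
/-- The displacement of `f ^ k` is `k` times the translation length of `f`, up to a constant. -/
theorem exists_displacement_bound {y : V} (hy : y ∈ medSet H f) (x : V) : ∃ C : ℕ, ∀ k : ℕ,
    Γ.dist x ((f ^ (k : ℤ)) x) ≤ k * (sep (stableHalfspaces H f) y (f y)).ncard + C ∧
    k * (sep (stableHalfspaces H f) y (f y)).ncard ≤ Γ.dist x ((f ^ (k : ℤ)) x) + C := by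
  -- Changing the base point costs twice the distance, and the inverted halfspaces contribute at
  -- most their number.
  refine ⟨2 * Γ.dist x y + (invertedHalfspaces H f).ncard, fun k => ?_⟩
  have h1 := hH.ncard_sep_stable_zpow hf hy k
  have h2 := hH.dist_eq_add (f := f) y ((f ^ (k : ℤ)) y)
  have h3 : (sep (invertedHalfspaces H f) y ((f ^ (k : ℤ)) y)).ncard ≤
      (invertedHalfspaces H f).ncard :=
    Set.ncard_le_ncard (fun A hA => hA.1) (hH.finite_inverted hf)
  have h4 := hH.dist_zpow_apply hf k x y
  have h5 := hH.connected.dist_triangle (u := x) (v := y) (w := (f ^ (k : ℤ)) x)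
  have h6 := hH.connected.dist_triangle (u := y) (v := (f ^ (k : ℤ)) y) (w := (f ^ (k : ℤ)) x)
  have h7 := hH.connected.dist_triangle (u := y) (v := x) (w := (f ^ (k : ℤ)) y)
  have h8 := hH.connected.dist_triangle (u := x) (v := (f ^ (k : ℤ)) x) (w := (f ^ (k : ℤ)) y)
  rw [Γ.dist_comm (u := (f ^ (k : ℤ)) y)] at h6
  rw [Γ.dist_comm (u := y) (v := x)] at h7
  omega

end IsMedianWallspace

/-! ### Normalisers -/

/-- `h` conjugates `f` to one of its powers. -/
def Normalizes {V : Type*} (h f : Equiv.Perm V) : Prop := ∃ k : ℤ, ∀ x, f (h x) = h ((f ^ k) x)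

namespace Normalizes

variable {V : Type*} {H : Set (Set V)} {f h : Equiv.Perm V} (hn : Normalizes h f)
  (hn' : Normalizes h.symm f) (hh : ∀ A ∈ H, h ⁻¹' A ∈ H) (hh' : ∀ A ∈ H, h.symm ⁻¹' A ∈ H)

include hn hh

theorem preimage_mem_inverted {A : Set V} (hA : A ∈ invertedHalfspaces H f) :
    h ⁻¹' A ∈ invertedHalfspaces H f := by
  obtain ⟨k, hk⟩ := hn
  obtain ⟨hA, n, hnA⟩ := hA
  refine ⟨hh A hA, k * n, ?_⟩
  ext x
  rw [mem_shift, Set.mem_preimage, ← zpow_comp_eq hk, ← mem_shift, hnA]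
  rfl

include hn' hh'

omit hn in
-- The inverse of `h` preserves inverted halfspaces, so `h` cannot pull a stable one back to an
-- inverted one. This is why both `h` and `h.symm` are assumed to normalise.
theorem preimage_mem_stable {A : Set V} (hA : A ∈ stableHalfspaces H f) :
    h ⁻¹' A ∈ stableHalfspaces H f := by
  refine ⟨hh A hA.1, fun hA' => hA.2 ?_⟩
  have := hn'.preimage_mem_inverted hh' hA'
  rwa [← Set.preimage_comp, Equiv.self_comp_symm, Set.preimage_id] at this

/-- Conjugation multiplies the exponents of `f` by `k`, which preserves or reverses their order;
crossing a wall at most once is insensitive to reversal of time. -/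
theorem apply_mem_medSet {x : V} (hx : x ∈ medSet H f) : h x ∈ medSet H f := by
  have hst := fun A hA => preimage_mem_stable hn' hh hh' (A := A) hA
  obtain ⟨k, hk⟩ := hn
  intro A hA a b c hab hbc ha hc
  rw [zpow_comp_eq hk, ← Set.mem_preimage] at ha hc ⊢
  have hA' := hst A hA
  rcases le_total 0 k with h0 | h0
  · exact hx _ hA' _ _ _ (mul_le_mul_of_nonneg_left hab h0) (mul_le_mul_of_nonneg_left hbc h0) ha hc
  · exact hx _ hA' _ _ _ (mul_le_mul_of_nonpos_left hbc h0) (mul_le_mul_of_nonpos_left hab h0) hc ha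

theorem preimage_mem_axial {A : Set V} (hA : A ∈ axialHalfspaces H f) :
    h ⁻¹' A ∈ axialHalfspaces H f := by
  obtain ⟨hA, x, hx, a, b, ha, hb⟩ := hA
  refine ⟨preimage_mem_stable hn' hh hh' hA, h.symm x,
    hn'.apply_mem_medSet (h := h.symm) hn hh' hh hx, ?_⟩
  obtain ⟨k, hk⟩ := hn
  refine ⟨k * a, k * b, ?_, ?_⟩
  · rwa [Set.mem_preimage, ← zpow_comp_eq hk, Equiv.apply_symm_apply]
  · rwa [Set.mem_preimage, ← zpow_comp_eq hk, Equiv.apply_symm_apply]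

theorem preimage_mem_transverse {A : Set V} (hA : A ∈ transverseHalfspaces H f) :
    h ⁻¹' A ∈ transverseHalfspaces H f := by
  refine ⟨preimage_mem_stable hn' hh hh' hA.1, fun hA' => hA.2 ?_⟩
  have := hn'.preimage_mem_axial (h := h.symm) hn hh' hh hA'
  rwa [← Set.preimage_comp, Equiv.self_comp_symm, Set.preimage_id] at this

end Normalizes

/-! ### Axes in graphs -/

section Lines

variable {W : Type*} {Γ : SimpleGraph W}

theorem SimpleGraph.Connected.exists_adj_closer (hc : Γ.Connected) {x y : W} (h : x ≠ y) :
    ∃ z, Γ.Adj z y ∧ Γ.dist x y = Γ.dist x z + 1 := by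
  obtain ⟨w, hw⟩ := (hc.preconnected y x).exists_walk_length_eq_dist
  cases w with
  | nil => exact absurd rfl h
  | @cons _ z _ hadj w =>
    refine ⟨z, hadj.symm, ?_⟩
    have h1 := SimpleGraph.dist_le w
    have h2 := hc.dist_triangle (u := x) (v := z) (w := y)
    rw [SimpleGraph.dist_eq_one_iff_adj.2 hadj.symm] at h2
    rw [SimpleGraph.Walk.length_cons, SimpleGraph.dist_comm] at hw
    rw [SimpleGraph.dist_comm] at h1
    omega

/-- A criterion to recognise the graph metric, applied below both to median algebras and to cubical
quotients: an integer function that detects adjacency, satisfies the triangle inequality and can be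
decreased one unit at a time. -/
theorem dist_eq_of_steps (d : W → W → ℕ) (hadj : ∀ x y, Γ.Adj x y ↔ d x y = 1)
    (h0 : ∀ x, d x x = 0) (htri : ∀ x y z, d x z ≤ d x y + d y z)
    (hstep : ∀ x y, x ≠ y → ∃ z, d x z = 1 ∧ d x y = d z y + 1) (x y : W) :
    Γ.Reachable x y ∧ Γ.dist x y = d x y := by
  have hub : ∀ n x y, d x y = n → ∃ w : Γ.Walk x y, w.length = n := by
    intro n
    induction n with
    | zero =>
      intro x y h
      by_cases hxy : x = y
      · subst hxy; exact ⟨.nil, rfl⟩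
      · obtain ⟨z, -, hz⟩ := hstep x y hxy
        omega
    | succ n ih =>
      intro x y h
      have hxy : x ≠ y := by rintro rfl; rw [h0] at h; omega
      obtain ⟨z, hz, hz'⟩ := hstep x y hxy
      obtain ⟨w, hw⟩ := ih z y (by omega)
      exact ⟨.cons ((hadj x z).2 hz) w, by simp [hw]⟩
  have hlb : ∀ {x y} (w : Γ.Walk x y), d x y ≤ w.length := by
    intro x y w
    induction w with
    | nil => rw [h0]; simp
    | @cons a b c hab w ih =>
      have h1 := htri a b c
      rw [(hadj a b).1 hab] at h1
      rw [SimpleGraph.Walk.length_cons]; omega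
  obtain ⟨w, hw⟩ := hub _ x y rfl
  refine ⟨w.reachable, le_antisymm (hw ▸ SimpleGraph.dist_le w) ?_⟩
  obtain ⟨w', hw'⟩ := w.reachable.exists_walk_length_eq_dist
  rw [← hw']
  exact hlb w'

theorem dist_zpow_of_dist {f : Equiv.Perm W} (hf : ∀ x y, Γ.dist (f x) (f y) = Γ.dist x y)
    (n : ℤ) (x y : W) : Γ.dist ((f ^ n) x) ((f ^ n) y) = Γ.dist x y := by
  have key : ∀ (n : ℕ) (x y : W), Γ.dist ((f ^ (n : ℤ)) x) ((f ^ (n : ℤ)) y) = Γ.dist x y := by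
    intro n
    induction n with
    | zero => simp
    | succ n ih =>
      intro x y
      rw [Nat.cast_succ, zpow_add_one_apply, zpow_add_one_apply, ih, hf]
  obtain ⟨m, rfl | rfl⟩ := n.eq_nat_or_neg
  · exact key m x y
  · rw [← key m, zpow_neg_mul_apply, zpow_neg_mul_apply]

/-- The line concatenates the translates of one geodesic from `x` to `f x`. -/
theorem exists_line (hc : Γ.Connected) {f : Equiv.Perm W}
    (hf : ∀ x y, Γ.dist (f x) (f y) = Γ.dist x y) {x : W} {l : ℕ} (hl : 0 < l)
    (hx : ∀ k : ℕ, Γ.dist x ((f ^ (k : ℤ)) x) = k * l) :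
    ∃ γ : ℤ → W, IsGeodesicLine Γ γ ∧ γ 0 = x ∧ ∀ n : ℤ, f (γ n) = γ (n + l) := by
  obtain ⟨w, hw⟩ := (hc.preconnected x (f x)).exists_walk_length_eq_dist
  have hwl : w.length = l := by
    have := hx 1
    simp only [Nat.cast_one, zpow_one, one_mul] at this
    rw [hw, this]
  have hl' : (0 : ℤ) < l := by exact_mod_cast hl
  let γ : ℤ → W := fun n => (f ^ (n / l)) (w.getVert (n % l).toNat)
  have hγ : ∀ (q : ℤ) (r : ℕ), r ≤ l → γ (q * l + r) = (f ^ q) (w.getVert r) := by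
    intro q r hr
    rcases hr.lt_or_eq with hr | rfl
    · have h1 : (q * l + r) / (l : ℤ) = q := by
        rw [add_comm, Int.add_mul_ediv_right _ _ hl'.ne',
          Int.ediv_eq_zero_of_lt (by omega) (by omega), zero_add]
      have h2 : (q * l + r) % (l : ℤ) = r := by
        rw [add_comm, Int.add_mul_emod_self_right, Int.emod_eq_of_lt (by omega) (by omega)]
      simp only [γ, h1, h2, Int.toNat_natCast]
    · have h1 : (q * r + r) / (r : ℤ) = q + 1 := by
        rw [← add_one_mul, Int.mul_ediv_cancel _ hl'.ne']
      have h2 : (q * r + r) % (r : ℤ) = 0 := by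
        rw [← add_one_mul, Int.mul_emod_left]
      simp only [γ, h1, h2, Int.toNat_zero, SimpleGraph.Walk.getVert_zero]
      rw [zpow_add_one_apply, ← hwl, SimpleGraph.Walk.getVert_length]
  have hdecomp : ∀ n : ℤ, ∃ (q : ℤ) (r : ℕ), r < l ∧ n = q * l + r := by
    intro n
    refine ⟨n / l, (n % l).toNat, ?_, ?_⟩
    · have := Int.emod_lt_of_pos n hl'
      have := Int.emod_nonneg n hl'.ne'
      omega
    · have := Int.emod_nonneg n hl'.ne'
      rw [Int.toNat_of_nonneg this, mul_comm]
      exact (Int.mul_ediv_add_emod n l).symm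
  have hstep : ∀ n : ℤ, Γ.dist (γ n) (γ (n + 1)) ≤ 1 := by
    intro n
    obtain ⟨q, r, hr, rfl⟩ := hdecomp n
    have e : (q * l + r + 1 : ℤ) = q * l + (r + 1 : ℕ) := by push_cast; ring
    rw [e, hγ q r hr.le, hγ q (r + 1) hr, dist_zpow_of_dist hf]
    exact (SimpleGraph.dist_eq_one_iff_adj.2 (w.adj_getVert_succ (by omega))).le
  have hlip : ∀ (n : ℤ) (k : ℕ), Γ.dist (γ n) (γ (n + k)) ≤ k := by
    intro n k
    induction k with
    | zero => simp
    | succ k ih =>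
      have h1 := hc.dist_triangle (u := γ n) (v := γ (n + k)) (w := γ (n + k + 1))
      have h2 := hstep (n + k)
      push_cast
      rw [← add_assoc]
      omega
  have hmul : ∀ q : ℤ, γ (q * l) = (f ^ q) x := by
    intro q
    have := hγ q 0 (by omega)
    simpa using this
  -- The path is 1-Lipschitz and its length is attained between the translates of `x` that enclose
  -- `m` and `n`, so no shortcut is possible in between.
  have hle : ∀ m n : ℤ, m ≤ n → Γ.dist (γ m) (γ n) = (m - n).natAbs := by
    intro m n hmn
    obtain ⟨a, r, hr, hm⟩ := hdecomp m
    obtain ⟨b, s, hs, hn⟩ := hdecomp n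
    have hab : a ≤ b := by
      by_contra h
      have : (b + 1) * (l : ℤ) ≤ a * l := mul_le_mul_of_nonneg_right (by omega) hl'.le
      rw [add_one_mul] at this
      omega
    obtain ⟨k, hk⟩ := Int.le.dest hab
    have h1 : Γ.dist (γ (a * l)) (γ ((b + 1) * l)) = (k + 1) * l := by
      have e : b + 1 = a + ((k + 1 : ℕ) : ℤ) := by push_cast; omega
      rw [hmul, hmul, e, zpow_add_apply, dist_zpow_of_dist hf, hx]
    have h2 := hlip (a * l) r
    rw [← hm] at h2
    have h3 := hlip n (l - s)
    have e3 : n + ((l - s : ℕ) : ℤ) = (b + 1) * l := by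
      rw [hn, Nat.cast_sub hs.le, add_one_mul]; ring
    rw [e3] at h3
    have h4 := hlip m (n - m).toNat
    have e4 : m + ((n - m).toNat : ℤ) = n := by omega
    rw [e4] at h4
    have h5 := hc.dist_triangle (u := γ (a * l)) (v := γ m) (w := γ ((b + 1) * l))
    have h6 := hc.dist_triangle (u := γ m) (v := γ n) (w := γ ((b + 1) * l))
    have h7 : n - m = ((k * l : ℕ) : ℤ) + s - r := by rw [hn, hm, ← hk]; push_cast; ring
    rw [h1, add_one_mul] at h5
    clear h1 hm hn e3 e4 hmul hlip hstep hdecomp hγ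
    generalize k * l = K at *
    omega
  refine ⟨γ, fun m n => ?_, ?_, fun n => ?_⟩
  · rcases le_total m n with h | h
    · exact hle m n h
    · rw [SimpleGraph.dist_comm, hle n m h]; omega
  · simpa using hmul 0
  · obtain ⟨q, r, hr, rfl⟩ := hdecomp n
    have e : (q * l + r + l : ℤ) = (q + 1) * l + r := by ring
    rw [e, hγ q r hr.le, hγ (q + 1) r hr.le, add_comm q 1, zpow_add_apply, zpow_one]

/-- If the displacements of the powers of `f` at `x` are additive, then `f` moves every vertex at
least as much as `x`. -/
theorem le_displacement (hc : Γ.Connected) {f : Equiv.Perm W}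
    (hf : ∀ x y, Γ.dist (f x) (f y) = Γ.dist x y) {x : W} {l : ℕ}
    (hx : ∀ k : ℕ, Γ.dist x ((f ^ (k : ℤ)) x) = k * l) (y : W) : l ≤ Γ.dist y (f y) := by
  have h1 : ∀ k : ℕ, Γ.dist y ((f ^ (k : ℤ)) y) ≤ k * Γ.dist y (f y) := by
    intro k
    induction k with
    | zero => simp
    | succ k ih =>
      have h2 := hc.dist_triangle (u := y) (v := (f ^ (k : ℤ)) y) (w := (f ^ (k : ℤ)) (f y))
      rw [dist_zpow_of_dist hf] at h2
      rw [Nat.cast_succ, zpow_add_one_apply, add_mul, one_mul]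
      omega
  by_contra hcon
  push Not at hcon
  -- A smaller displacement at `y` would save at least `k` in total, more than the cost of passing
  -- from `x` to `y` and back.
  set k := 2 * Γ.dist x y + 1 with hk
  have h2 := h1 k
  have h3 := hx k
  have h4 := hc.dist_triangle (u := x) (v := y) (w := (f ^ (k : ℤ)) x)
  have h5 := hc.dist_triangle (u := y) (v := (f ^ (k : ℤ)) y) (w := (f ^ (k : ℤ)) x)
  rw [dist_zpow_of_dist hf, Γ.dist_comm (u := y) (v := x)] at h5
  have h6 : k * (Γ.dist y (f y) + 1) ≤ k * l := Nat.mul_le_mul_left _ hcon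
  rw [mul_add, mul_one] at h6
  omega

theorem exists_isAxis (hc : Γ.Connected) {f : Equiv.Perm W}
    (hf : ∀ x y, Γ.dist (f x) (f y) = Γ.dist x y) {x : W} {l : ℕ} (hl : 0 < l)
    (hx : ∀ k : ℕ, Γ.dist x ((f ^ (k : ℤ)) x) = k * l) :
    ∃ γ : ℤ → W, IsAxis Γ f γ ∧ γ 0 = x := by
  obtain ⟨γ, h1, h2, h3⟩ := exists_line hc hf hl hx
  refine ⟨γ, ⟨h1, l, hl, ⟨⟨x, ?_⟩, ?_⟩, h3⟩, h2⟩
  · simpa using hx 1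
  · rintro _ ⟨y, rfl⟩
    exact le_displacement hc hf hx y

end Lines

/-! ### Median algebras with a system of walls -/

/-- `𝓦` is a set of halfspaces of the median algebra `N` for which the associated graph is
connected, and isometric with respect to `𝓦`. -/
structure IsWallSystem (N : Type*) [MedianAlgebra N] (𝓦 : Set (Set N)) : Prop where
  nonempty : ∀ B ∈ 𝓦, B.Nonempty
  compl_mem : ComplClosed 𝓦
  mem_med : ∀ B ∈ 𝓦, ∀ x y z, MedianAlgebra.med x y z ∈ B ↔
    (x ∈ B ∧ y ∈ B) ∨ (y ∈ B ∧ z ∈ B) ∨ (x ∈ B ∧ z ∈ B)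
  finite_sep : ∀ x y, (sep 𝓦 x y).Finite
  exists_step : ∀ x y : N, x ≠ y → ∃ z, (sep 𝓦 x z).ncard = 1 ∧ MedianAlgebra.med x y z = z

namespace IsWallSystem

open MedianAlgebra

variable {N : Type*} [MedianAlgebra N] {𝓦 : Set (Set N)} (h : IsWallSystem N 𝓦)
include h

theorem mem_of_mem_interval {x y z : N} (hz : z ∈ interval x y) {B : Set N} (hB : B ∈ 𝓦)
    (hx : x ∈ B) (hy : y ∈ B) : z ∈ B := by
  have : med x y z = z := hz
  rw [← this, h.mem_med B hB]
  exact Or.inl ⟨hx, hy⟩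

theorem eq_of_forall {x y : N} (hxy : ∀ B ∈ 𝓦, x ∈ B ↔ y ∈ B) : x = y := by
  by_contra hne
  obtain ⟨z, hz, hz'⟩ := h.exists_step x y hne
  obtain ⟨B, hB⟩ := Set.ncard_eq_one.1 hz
  have hB' : B ∈ sep 𝓦 x z := hB ▸ rfl
  exact hB'.2.2 (h.mem_of_mem_interval hz' hB'.1 hB'.2.1 ((hxy B hB'.1).1 hB'.2.1))

theorem ncard_sep_add {x y z : N} (hz : z ∈ interval x y) :
    (sep 𝓦 x y).ncard = (sep 𝓦 x z).ncard + (sep 𝓦 z y).ncard :=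
  h.compl_mem.ncard_sep_add h.finite_sep fun _ hB hx hy => h.mem_of_mem_interval hz hB hx hy

theorem mem_halfspaces {B : Set N} (hB : B ∈ 𝓦) : B ∈ halfspaces N :=
  ⟨h.nonempty B hB, h.nonempty _ (h.compl_mem B hB),
    fun _ hx _ hy _ hz => h.mem_of_mem_interval hz hB hx hy,
    fun _ hx _ hy _ hz => h.mem_of_mem_interval hz (h.compl_mem B hB) hx hy⟩

theorem mem_iff_of_sep_eq_singleton {x y : N} {B C : Set N} (hs : sep 𝓦 x y = {B})
    (hC : C ∈ 𝓦) (h1 : C ≠ B) (h2 : Cᶜ ≠ B) : x ∈ C ↔ y ∈ C := by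
  constructor
  · intro hx
    by_contra hy
    exact h1 (hs ▸ (⟨hC, hx, hy⟩ : C ∈ sep 𝓦 x y) : C ∈ ({B} : Set (Set N)))
  · intro hy
    by_contra hx
    exact h2 (hs ▸ (⟨h.compl_mem C hC, hx, fun h => h hy⟩ : Cᶜ ∈ sep 𝓦 x y) :
      Cᶜ ∈ ({B} : Set (Set N)))

/-- A halfspace `A` separates two points `x`, `y` that differ by a single `B` in `𝓦`. The median of
any `u` with `x` and `y` is then `x` or `y` according to the side of `B` containing `u`, and
convexity of `A` and of its complement gives `A = B`. -/
theorem halfspaces_eq : halfspaces N = 𝓦 := by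
  refine Set.Subset.antisymm ?_ fun B hB => h.mem_halfspaces hB
  rintro A ⟨⟨x₀, hx₀⟩, ⟨y₀, hy₀⟩, hA, hA'⟩
  have key : ∀ n, ∀ x ∈ A, ∀ y ∉ A, (sep 𝓦 x y).ncard = n →
      ∃ x ∈ A, ∃ y ∉ A, (sep 𝓦 x y).ncard = 1 := by
    intro n
    induction n using Nat.strong_induction_on with
    | _ n ih =>
    intro x hx y hy hn
    obtain ⟨z, hz, hz'⟩ := h.exists_step x y (by rintro rfl; exact hy hx)
    by_cases hzA : z ∈ A
    · have := h.ncard_sep_add hz'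
      exact ih (sep 𝓦 z y).ncard (by omega) z hzA y hy rfl
    · exact ⟨x, hx, z, hzA, hz⟩
  obtain ⟨x, hx, y, hy, hn⟩ := key _ x₀ hx₀ y₀ hy₀ rfl
  obtain ⟨B, hB⟩ := Set.ncard_eq_one.1 hn
  have hB' : B ∈ sep 𝓦 x y := hB ▸ rfl
  obtain ⟨hBW, hxB, hyB⟩ := hB'
  have hAB : A = B := by
    ext u
    constructor
    · intro hu
      by_contra huB
      have : med u x y = y := by
        apply h.eq_of_forall
        intro C hC
        rw [h.mem_med C hC]
        by_cases h1 : C = B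
        · subst h1; tauto
        by_cases h2 : Cᶜ = B
        · have h3 : C = Bᶜ := by rw [← h2, compl_compl]
          subst h3
          simp only [Set.mem_compl_iff]; tauto
        have := h.mem_iff_of_sep_eq_singleton hB hC h1 h2
        tauto
      exact hy (hA u hu x hx this)
    · intro hu
      by_contra huA
      have : med u y x = x := by
        apply h.eq_of_forall
        intro C hC
        rw [h.mem_med C hC]
        by_cases h1 : C = B
        · subst h1; tauto
        by_cases h2 : Cᶜ = B
        · have h3 : C = Bᶜ := by rw [← h2, compl_compl]
          subst h3
          simp only [Set.mem_compl_iff]; tauto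
        have := h.mem_iff_of_sep_eq_singleton hB hC h1 h2
        tauto
      exact hA' u huA y hy this hx
  exact hAB ▸ hBW

theorem adj_iff {x y : N} : (graph N).Adj x y ↔ (sep 𝓦 x y).ncard = 1 := by
  rw [Set.ncard_eq_one]
  change (∃! A, A ∈ halfspaces N ∧ x ∈ A ∧ y ∉ A) ↔ _
  rw [h.halfspaces_eq]
  constructor
  · rintro ⟨A, hA, hu⟩
    exact ⟨A, Set.eq_singleton_iff_unique_mem.2 ⟨hA, fun B hB => hu B hB⟩⟩
  · rintro ⟨A, hA⟩
    obtain ⟨h1, h2⟩ := Set.eq_singleton_iff_unique_mem.1 hA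
    exact ⟨A, h1, h2⟩

theorem reachable_and_dist (x y : N) :
    (graph N).Reachable x y ∧ (graph N).dist x y = (sep 𝓦 x y).ncard := by
  refine dist_eq_of_steps (fun x y => (sep 𝓦 x y).ncard) (fun x y => h.adj_iff)
    (fun x => by simp [sep_self]) (ncard_sep_triangle h.finite_sep) (fun x y hxy => ?_) x y
  obtain ⟨z, hz, hz'⟩ := h.exists_step x y hxy
  have := h.ncard_sep_add hz'
  exact ⟨z, hz, by omega⟩

/-- A point of the interval is determined by the members of `𝓦` separating it from `x`, which form a
subset of the finite set separating `x` from `y`. -/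
theorem isDiscrete : IsDiscrete N := by
  intro x y
  refine Set.Finite.of_injOn (f := fun z => sep 𝓦 x z) (t := 𝒫 sep 𝓦 x y) ?_ ?_
    (h.finite_sep x y).finite_subsets
  · intro z hz B hB
    exact ⟨hB.1, hB.2.1, fun hy => hB.2.2 (h.mem_of_mem_interval hz hB.1 hB.2.1 hy)⟩
  · intro z _ z' _ hzz
    apply h.eq_of_forall
    intro B hB
    have key : ∀ B ∈ 𝓦, x ∈ B → (z ∈ B ↔ z' ∈ B) := by
      intro B hB hx
      have := Set.ext_iff.1 hzz B
      simp only [mem_sep] at this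
      tauto
    by_cases hx : x ∈ B
    · exact key B hB hx
    · have := key Bᶜ (h.compl_mem B hB) hx
      simp only [Set.mem_compl_iff] at this
      tauto

end IsWallSystem

/-! ### Spaces of traces -/

theorem mem_principalOrientation {S : Type*} {H : Set (Set S)} {x : S} {A : Set S} :
    A ∈ principalOrientation H x ↔ A ∈ H ∧ x ∈ A := Iff.rfl

/-- The principal orientations of the walls in `𝓐` defined by the points of `M`. -/
def TraceSpace {V : Type*} (𝓐 : Set (Set V)) (M : Set V) : Type _ :=
  {σ : Set (Set V) // ∃ x ∈ M, principalOrientation 𝓐 x = σ}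

/-- The halfspaces of a space of traces. -/
def traceWalls {V : Type*} (𝓐 : Set (Set V)) (M : Set V) : Set (Set (TraceSpace 𝓐 M)) :=
  {B | ∃ A ∈ 𝓐, B = {σ | A ∈ σ.1}}

namespace TraceSpace

variable {V : Type*} {𝓐 : Set (Set V)} {M : Set V}

/-- The trace of a point. -/
def mk (x : V) (hx : x ∈ M) : TraceSpace 𝓐 M := ⟨principalOrientation 𝓐 x, x, hx, rfl⟩

theorem exists_mk (σ : TraceSpace 𝓐 M) : ∃ x, ∃ hx : x ∈ M, σ = mk x hx := by
  obtain ⟨σ, x, hx, rfl⟩ := σ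
  exact ⟨x, hx, rfl⟩

theorem mk_eq_iff {x y : V} {hx : x ∈ M} {hy : y ∈ M} :
    (mk x hx : TraceSpace 𝓐 M) = mk y hy ↔ ∀ A ∈ 𝓐, x ∈ A ↔ y ∈ A := by
  refine (Subtype.ext_iff.trans Set.ext_iff).trans ?_
  change (∀ A, A ∈ principalOrientation 𝓐 x ↔ A ∈ principalOrientation 𝓐 y) ↔ _
  simp only [mem_principalOrientation, and_congr_right_iff]

/-- The median algebra of traces. -/
abbrev medianAlgebra (hM : ∀ x ∈ M, ∀ y ∈ M, ∀ z ∈ M, ∃ m ∈ M, ∀ A ∈ 𝓐,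
    (m ∈ A ↔ (x ∈ A ∧ y ∈ A) ∨ (y ∈ A ∧ z ∈ A) ∨ (x ∈ A ∧ z ∈ A))) :
    MedianAlgebra (TraceSpace 𝓐 M) where
  med σ τ ρ := ⟨MedianAlgebra.orientationMed σ.1 τ.1 ρ.1, by
    obtain ⟨σ, x, hx, rfl⟩ := σ
    obtain ⟨τ, y, hy, rfl⟩ := τ
    obtain ⟨ρ, z, hz, rfl⟩ := ρ
    obtain ⟨m, hm, h⟩ := hM x hx y hy z hz
    refine ⟨m, hm, ?_⟩
    ext A
    simp only [MedianAlgebra.orientationMed, mem_principalOrientation, Set.mem_union, Set.mem_inter_iff]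
    have := h A
    tauto⟩
  med_self σ τ := Subtype.ext <| by
    ext A; simp only [MedianAlgebra.orientationMed, Set.mem_union, Set.mem_inter_iff]; tauto
  med_rotate σ τ ρ := Subtype.ext <| by
    ext A; simp only [MedianAlgebra.orientationMed, Set.mem_union, Set.mem_inter_iff]; tauto
  med_swap σ τ ρ := Subtype.ext <| by
    ext A; simp only [MedianAlgebra.orientationMed, Set.mem_union, Set.mem_inter_iff]; tauto
  med_assoc σ τ ρ θ := Subtype.ext <| by
    ext A; simp only [MedianAlgebra.orientationMed, Set.mem_union, Set.mem_inter_iff]; tauto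

/-- The action on a space of traces induced by an action preserving `𝓐` and `M`. -/
abbrev mulAction {G : Type*} [Group G] [MulAction G V] (hM : ∀ (h : G), ∀ x ∈ M, h • x ∈ M)
    (h𝓐 : ∀ (h : G), ∀ A ∈ 𝓐, (fun x => h • x) ⁻¹' A ∈ 𝓐) : MulAction G (TraceSpace 𝓐 M) where
  smul h σ := ⟨{A | (fun x => h • x) ⁻¹' A ∈ σ.1}, by
    obtain ⟨σ, x, hx, rfl⟩ := σ
    refine ⟨h • x, hM h x hx, ?_⟩
    ext A
    simp only [mem_principalOrientation, Set.mem_ofPred_eq, Set.mem_preimage]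
    refine and_congr_left fun _ => ⟨h𝓐 h A, fun hA => ?_⟩
    have := h𝓐 h⁻¹ _ hA
    rw [← Set.preimage_comp] at this
    convert this using 1
    ext y; simp⟩
  one_smul σ := Subtype.ext <| by
    change {A | (fun x => (1 : G) • x) ⁻¹' A ∈ σ.1} = σ.1
    simp
  mul_smul g h σ := Subtype.ext <| by
    change {A | (fun x => (g * h) • x) ⁻¹' A ∈ σ.1} =
      {A | (fun x => h • x) ⁻¹' ((fun x => g • x) ⁻¹' A) ∈ σ.1}
    simp only [← Set.preimage_comp, Function.comp_def, mul_smul]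

theorem sep_traceWalls {x y : V} (hx : x ∈ M) (hy : y ∈ M) :
    sep (traceWalls 𝓐 M) (mk x hx) (mk y hy) =
      (fun A => {σ : TraceSpace 𝓐 M | A ∈ σ.1}) '' sep 𝓐 x y := by
  ext B
  constructor
  · rintro ⟨⟨A, hA, rfl⟩, h1, h2⟩
    exact ⟨A, ⟨hA, h1.2, fun h => h2 ⟨hA, h⟩⟩, rfl⟩
  · rintro ⟨A, ⟨hA, h1, h2⟩, rfl⟩
    exact ⟨⟨A, hA, rfl⟩, ⟨hA, h1⟩, fun h => h2 h.2⟩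

end TraceSpace

/-! ### The axial factor is a median flat -/

namespace IsMedianWallspace

variable {V : Type*} {Γ : SimpleGraph V} {H : Set (Set V)} (hH : IsMedianWallspace Γ H)
  {f : Equiv.Perm V} (hf : ShiftInvariant f H)

theorem axial_subset : axialHalfspaces H f ⊆ H := fun _ hA => hA.1.1

include hH

include hf in
theorem exists_med_mem {𝓐 : Set (Set V)} (h𝓐 : 𝓐 ⊆ H) : ∀ x ∈ medSet H f, ∀ y ∈ medSet H f,
    ∀ z ∈ medSet H f, ∃ m ∈ medSet H f, ∀ A ∈ 𝓐,
      (m ∈ A ↔ (x ∈ A ∧ y ∈ A) ∨ (y ∈ A ∧ z ∈ A) ∨ (x ∈ A ∧ z ∈ A)) :=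
  fun x hx y hy z hz => ⟨hH.med x y z, hH.med_mem_medSet hf hx hy hz,
    fun _ hA => hH.mem_med (h𝓐 hA)⟩

include hf in
-- If `f ^ n` moves `p` out of a halfspace, then it does so for `x` at time `n` or `n + 1`. Hence a
-- double crossing by the orbit of `p` gives one by the orbit of `x`.
theorem between_mem_medSet {x p : V} (hx : x ∈ medSet H f)
    (hp : ∀ A ∈ H, x ∈ A → f x ∈ A → p ∈ A) : p ∈ medSet H f := by
  have key : ∀ A ∈ H, ∀ n : ℤ, (f ^ n) p ∉ A → ∃ m, n ≤ m ∧ m ≤ n + 1 ∧ (f ^ m) x ∉ A := by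
    intro A hA n hn
    by_contra hcon
    push Not at hcon
    have h1 := hcon n le_rfl (by omega)
    have h2 := hcon (n + 1) (by omega) le_rfl
    rw [zpow_add_one_apply] at h2
    exact hn (hp _ (hf n A hA) h1 h2)
  intro A hA a b c hab hbc ha hc
  by_contra hb
  have hAc := hH.compl_mem A hA.1
  obtain ⟨a', h1, h2, ha'⟩ := key Aᶜ hAc a (fun h => h ha)
  obtain ⟨c', h3, h4, hc'⟩ := key Aᶜ hAc c (fun h => h hc)
  obtain ⟨b', h5, h6, hb'⟩ := key A hA.1 b hb
  have hab' : a ≠ b := by rintro rfl; exact hb ha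
  have hbc' : b ≠ c := by rintro rfl; exact hb hc
  simp only [Set.mem_compl_iff, not_not] at ha' hc'
  exact hb' (hx A hA a' b' c' (by omega) (by omega) ha' hc')

/-- Adjacency inside the median set. -/
def MedAdj (_ : IsMedianWallspace Γ H) (f : Equiv.Perm V) (x y : V) : Prop :=
  x ∈ medSet H f ∧ y ∈ medSet H f ∧ Γ.Adj x y

include hf in
-- A geodesic from `x` to `f x` stays in the median set, by `between_mem_medSet`.
theorem medAdj_path_apply {x : V} (hx : x ∈ medSet H f) :
    Relation.ReflTransGen (hH.MedAdj f) x (f x) := by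
  have key : ∀ n, ∀ p, Γ.dist x p = n → (∀ A ∈ H, x ∈ A → f x ∈ A → p ∈ A) →
      Relation.ReflTransGen (hH.MedAdj f) x p := by
    intro n
    induction n with
    | zero =>
      intro p hp _
      rw [hH.connected.dist_eq_zero_iff] at hp
      rw [hp]
    | succ n ih =>
      intro p hn hp
      have hne : x ≠ p := by rintro rfl; simp at hn
      obtain ⟨q, hq, hqd⟩ := hH.connected.exists_adj_closer hne
      have hqp : ∀ A ∈ H, x ∈ A → p ∈ A → q ∈ A := by
        rw [← hH.dist_add_iff, SimpleGraph.dist_eq_one_iff_adj.2 hq]; exact hqd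
      have hq' : ∀ A ∈ H, x ∈ A → f x ∈ A → q ∈ A := fun A hA h1 h2 => hqp A hA h1 (hp A hA h1 h2)
      exact (ih q (by omega) hq').tail ⟨hH.between_mem_medSet hf hx hq',
        hH.between_mem_medSet hf hx hp, hq⟩
  exact key _ _ rfl fun _ _ _ h => h

include hf in
theorem medAdj_path {x : V} (hx : x ∈ medSet H f) (n : ℤ) :
    Relation.ReflTransGen (hH.MedAdj f) x ((f ^ n) x) := by
  have pos : ∀ (n : ℕ) (x : V), x ∈ medSet H f →
      Relation.ReflTransGen (hH.MedAdj f) x ((f ^ (n : ℤ)) x) := by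
    intro n
    induction n with
    | zero => intro x _; simp [Relation.ReflTransGen.refl]
    | succ n ih =>
      intro x hx
      rw [Nat.cast_succ, zpow_add_one_apply]
      refine (hH.medAdj_path_apply hf hx).trans (ih _ ?_)
      simpa using zpow_mem_medSet hx 1
  obtain ⟨m, rfl | rfl⟩ := n.eq_nat_or_neg
  · exact pos m x hx
  · have h1 := pos m _ (zpow_mem_medSet hx (-m))
    rw [zpow_neg_mul_apply] at h1
    have hsymm : ∀ {a b}, Relation.ReflTransGen (hH.MedAdj f) a b →
        Relation.ReflTransGen (hH.MedAdj f) b a := by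
      intro a b h
      induction h with
      | refl => exact .refl
      | tail _ h ih => exact .head ⟨h.2.1, h.1, h.2.2.symm⟩ ih
    exact hsymm h1

include hf in
-- The orbit of `x` crosses the wall of `A` along a path inside the median set. Projecting this path
-- to the interval between `x` and `y` by medians, the axial trace changes by one halfspace at a
-- time, and its first change gives `z`.
theorem exists_axial_step {x y : V} (hx : x ∈ medSet H f) (hy : y ∈ medSet H f) {A : Set V}
    (hA : A ∈ axialHalfspaces H f) (hxA : x ∈ A) (hyA : y ∉ A) :
    ∃ z ∈ medSet H f, (∃ C, sep (axialHalfspaces H f) x z = {C}) ∧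
      ∀ B ∈ H, x ∈ B → y ∈ B → z ∈ B := by
  obtain ⟨-, n, -, hn⟩ := hH.axial_crosses hf hA x
  have hcc := hH.complClosed_axial (f := f)
  have key : ∀ w, Relation.ReflTransGen (hH.MedAdj f) x w → w ∈ medSet H f ∧
      ((∀ B ∈ axialHalfspaces H f, hH.med x y w ∈ B ↔ x ∈ B) ∨
      ∃ z ∈ medSet H f, (∃ C, sep (axialHalfspaces H f) x z = {C}) ∧
        ∀ B ∈ H, x ∈ B → y ∈ B → z ∈ B) := by
    intro w hw
    induction hw with
    | refl =>
      refine ⟨hx, Or.inl fun B hB => ?_⟩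
      rw [hH.mem_med hB.1.1]; tauto
    | @tail w w' _ hww' ih =>
      obtain ⟨-, hw', hadj⟩ := hww'
      obtain ⟨-, ih | ih⟩ := ih
      · refine ⟨hw', ?_⟩
        obtain ⟨C, hC⟩ := hH.sep_of_adj hadj
        have hsub : sep (axialHalfspaces H f) x (hH.med x y w') ⊆ {C} := by
          rintro B ⟨hB, h1, h2⟩
          rw [← hC]
          rw [← ih B hB, hH.mem_med hB.1.1] at h1
          rw [hH.mem_med hB.1.1] at h2
          exact ⟨hB.1.1, by tauto, by tauto⟩
        rcases Set.subset_singleton_iff_eq.1 hsub with h | h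
        · exact Or.inl fun B hB => (hcc.mem_iff_of_sep_eq_empty h hB).symm
        · refine Or.inr ⟨_, hH.med_mem_medSet hf hx hy hw', ⟨C, h⟩, fun B hB h1 h2 => ?_⟩
          rw [hH.mem_med hB]
          exact Or.inl ⟨h1, h2⟩
      · exact ⟨hw', Or.inr ih⟩
  obtain ⟨-, h | h⟩ := key _ (hH.medAdj_path hf hx n)
  · have := h A hA
    rw [hH.mem_med hA.1.1] at this
    tauto
  · exact h

include hf in
/-- Distinct axial halfspaces have distinct traces on the median set. -/
theorem axial_trace_injective {A B : Set V} (hA : A ∈ axialHalfspaces H f)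
    (hB : B ∈ axialHalfspaces H f) (h : ∀ x ∈ medSet H f, x ∈ A ↔ x ∈ B) : A = B := by
  obtain ⟨x, hx⟩ := hH.medSet_nonempty hf
  obtain ⟨a, b, ha, hb⟩ := hH.axial_crosses hf hA x
  have hpath := hH.medAdj_path hf (zpow_mem_medSet hx a) (b - a)
  rw [← zpow_add_apply, sub_add_cancel] at hpath
  have key : ∀ w, Relation.ReflTransGen (hH.MedAdj f) ((f ^ a) x) w → w ∈ A ∨ A = B := by
    intro w hw
    induction hw with
    | refl => exact Or.inl ha
    | @tail u v _ huv ih =>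
      rcases ih with ih | ih
      · by_cases hv : v ∈ A
        · exact Or.inl hv
        · obtain ⟨C, hC⟩ := hH.sep_of_adj huv.2.2
          have h1 : A ∈ sep H u v := ⟨hA.1.1, ih, hv⟩
          have h2 : B ∈ sep H u v :=
            ⟨hB.1.1, (h u huv.1).1 ih, fun h' => hv ((h v huv.2.1).2 h')⟩
          rw [hC] at h1 h2
          exact Or.inr (h1.trans h2.symm)
      · exact Or.inr ih
  exact (key _ hpath).resolve_left hb

include hf in
theorem traceWall_injOn : Set.InjOn
    (fun A => {σ : TraceSpace (axialHalfspaces H f) (medSet H f) | A ∈ σ.1})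
    (axialHalfspaces H f) := by
  intro A hA B hB h
  refine hH.axial_trace_injective hf hA hB fun x hx => ?_
  have := Set.ext_iff.1 h (TraceSpace.mk x hx)
  change (A ∈ _ ∧ x ∈ A) ↔ (B ∈ _ ∧ x ∈ B) at this
  tauto

/-- The median algebra of traces of the median set. -/
abbrev traceAlgebra (hf : ShiftInvariant f H) {𝓐 : Set (Set V)} (h𝓐 : 𝓐 ⊆ H) :
    MedianAlgebra (TraceSpace 𝓐 (medSet H f)) :=
  TraceSpace.medianAlgebra (hH.exists_med_mem hf h𝓐)

/-- The median algebra of axial traces. -/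
abbrev axialAlgebra (hf : ShiftInvariant f H) :
    MedianAlgebra (TraceSpace (axialHalfspaces H f) (medSet H f)) :=
  hH.traceAlgebra hf axial_subset

/-- By `IsWallSystem.halfspaces_eq`, the walls of this median algebra are then exactly the axial
ones, which makes its graph and Roller boundary computable. -/
theorem isWallSystem_axial : @IsWallSystem (TraceSpace (axialHalfspaces H f) (medSet H f))
    (hH.axialAlgebra hf) (traceWalls (axialHalfspaces H f) (medSet H f)) := by
  let := hH.axialAlgebra hf
  have hcc := hH.complClosed_axial (f := f)
  refine ⟨?_, ?_, ?_, ?_, ?_⟩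
  · rintro _ ⟨A, hA, rfl⟩
    obtain ⟨x, hx⟩ := hH.medSet_nonempty hf
    obtain ⟨a, -, ha, -⟩ := hH.axial_crosses hf hA x
    exact ⟨TraceSpace.mk _ (zpow_mem_medSet hx a), hA, ha⟩
  · rintro _ ⟨A, hA, rfl⟩
    refine ⟨Aᶜ, hcc A hA, ?_⟩
    ext σ
    obtain ⟨x, hx, rfl⟩ := σ.exists_mk
    change ¬ (A ∈ _ ∧ x ∈ A) ↔ (Aᶜ ∈ _ ∧ x ∉ A)
    have := hcc A hA
    tauto
  · rintro _ ⟨A, hA, rfl⟩ σ τ ρ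
    change A ∈ MedianAlgebra.orientationMed σ.1 τ.1 ρ.1 ↔ _
    simp only [MedianAlgebra.orientationMed, Set.mem_union, Set.mem_inter_iff, Set.mem_ofPred_eq]
    tauto
  · intro σ τ
    obtain ⟨x, hx, rfl⟩ := σ.exists_mk
    obtain ⟨y, hy, rfl⟩ := τ.exists_mk
    rw [TraceSpace.sep_traceWalls]
    exact (hH.finite_sep_of_subset axial_subset x y).image _
  · intro σ τ hne
    obtain ⟨x, hx, rfl⟩ := σ.exists_mk
    obtain ⟨y, hy, rfl⟩ := τ.exists_mk
    have hsep : (sep (axialHalfspaces H f) x y).Nonempty := by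
      rw [Set.nonempty_iff_ne_empty]
      intro h
      exact hne (TraceSpace.mk_eq_iff.2 fun A hA => hcc.mem_iff_of_sep_eq_empty h hA)
    obtain ⟨A, hA, hxA, hyA⟩ := hsep
    obtain ⟨z, hz, ⟨C, hC⟩, hbet⟩ := hH.exists_axial_step hf hx hy hA hxA hyA
    refine ⟨TraceSpace.mk z hz, ?_, ?_⟩
    · rw [TraceSpace.sep_traceWalls, hC, Set.image_singleton, Set.ncard_singleton]
    · refine Subtype.ext ?_
      ext B
      change B ∈ MedianAlgebra.orientationMed (principalOrientation _ x) (principalOrientation _ y)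
        (principalOrientation _ z) ↔ B ∈ principalOrientation _ z
      simp only [MedianAlgebra.orientationMed, Set.mem_union, Set.mem_inter_iff,
        mem_principalOrientation]
      by_cases hB : B ∈ axialHalfspaces H f
      · have h1 := hbet B hB.1.1
        have h2 := hbet Bᶜ (hH.compl_mem B hB.1.1)
        simp only [Set.mem_compl_iff] at h2
        tauto
      · tauto

theorem dist_axial {x y : V} (hx : x ∈ medSet H f) (hy : y ∈ medSet H f) :
    letI := hH.axialAlgebra hf
    (MedianAlgebra.graph (TraceSpace (axialHalfspaces H f) (medSet H f))).dist
      (TraceSpace.mk x hx) (TraceSpace.mk y hy) = (sep (axialHalfspaces H f) x y).ncard := by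
  let := hH.axialAlgebra hf
  rw [((hH.isWallSystem_axial hf).reachable_and_dist _ _).2, TraceSpace.sep_traceWalls,
    ((hH.traceWall_injOn hf).mono fun A hA => hA.1).ncard_image]

omit hH in
theorem sep_axial_zpow {x : V} (hx : x ∈ medSet H f) (n : ℤ) :
    sep (axialHalfspaces H f) x ((f ^ n) x) = sep (stableHalfspaces H f) x ((f ^ n) x) := by
  ext A
  constructor
  · rintro ⟨h1, h2⟩
    exact ⟨h1.1, h2⟩
  · rintro ⟨h1, h2, h3⟩
    exact ⟨⟨h1, x, hx, 0, n, by simpa using h2, h3⟩, h2, h3⟩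

include hf in
/-- Along each orbit of axial halfspaces containing `x`, at most one can be crossed from `x`. -/
theorem eq_of_shift_of_step {x y y' : V} (hy : y ∈ medSet H f)
    (hy' : y' ∈ medSet H f) {A : Set V} {k : ℤ} (hA : A ∈ axialHalfspaces H f)
    (h : sep (axialHalfspaces H f) x y = {A})
    (h' : sep (axialHalfspaces H f) x y' = {shift f k A}) : shift f k A = A := by
  have key : ∀ {A : Set V} {k : ℤ} {y y' : V}, y ∈ medSet H f → y' ∈ medSet H f →
      A ∈ axialHalfspaces H f → sep (axialHalfspaces H f) x y = {A} →
      sep (axialHalfspaces H f) x y' = {shift f k A} → 0 ≤ k → shift f k A = A := by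
    intro A k y y' hy hy' hA h h' hk
    by_contra hne
    have h1 : A ∈ sep (axialHalfspaces H f) x y := h ▸ rfl
    have h2 : shift f k A ∈ sep (axialHalfspaces H f) x y' := h' ▸ rfl
    have h3 : (f ^ k) y ∈ A := by
      by_contra hc
      exact hne (h ▸ (⟨h2.1, h2.2.1, hc⟩ : shift f k A ∈ sep (axialHalfspaces H f) x y) :
        shift f k A ∈ ({A} : Set (Set V)))
    have h4 : y' ∈ A := by
      by_contra hc
      exact hne (h' ▸ (⟨h1.1, h1.2.1, hc⟩ : A ∈ sep (axialHalfspaces H f) x y') :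
        A ∈ ({shift f k A} : Set (Set V))).symm
    -- Between times `0` and `k` the orbit of `y'` leaves `A` while that of `y` enters it.
    exact hH.monotone_coherent hf hy' hy hA.1 (a := 0) (b := k) (a' := 0) (b' := k) hk hk
      (by simpa using h4) h2.2.2 (by simpa using h1.2.2) h3
  rcases le_total 0 k with hk | hk
  · exact key hy hy' hA h h' hk
  · have h1 := key (A := shift f k A) (k := -k) hy' hy
      (shiftInvariant_axial hf k A hA) h' (by rw [shift_neg_shift]; exact h) (by omega)
    rw [shift_neg_shift] at h1
    exact h1.symm

omit hH in
theorem _root_.ComplClosed.mem_iff_of_sep_eq {𝓐 : Set (Set V)} (h : ComplClosed 𝓐) {x y y' : V}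
    (hs : sep 𝓐 x y = sep 𝓐 x y') {A : Set V} (hA : A ∈ 𝓐) : y ∈ A ↔ y' ∈ A := by
  have key : ∀ A ∈ 𝓐, x ∈ A → (y ∈ A ↔ y' ∈ A) := by
    intro A hA hx
    have := Set.ext_iff.1 hs A
    simp only [mem_sep, hA, hx, true_and] at this
    exact not_iff_not.1 this
  by_cases hx : x ∈ A
  · exact key A hA hx
  · exact not_iff_not.1 (key Aᶜ (h A hA) hx)

/-- The edges at a corner of a cube cross halfspaces in distinct orbits of `f`, by
`eq_of_shift_of_step`. Each orbit has a representative separating `x₀` from `f x₀`, whose number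
bounds the dimension. -/
theorem isFiniteDimensional_axial :
    letI := hH.axialAlgebra hf
    MedianAlgebra.IsFiniteDimensional (TraceSpace (axialHalfspaces H f) (medSet H f)) := by
  let := hH.axialAlgebra hf
  have hW := hH.isWallSystem_axial hf
  have hcc := hH.complClosed_axial (f := f)
  obtain ⟨x₀⟩ := hH.connected.nonempty
  refine ⟨(diffs H x₀ (f x₀)).ncard, fun n => ?_⟩
  rintro ⟨c⟩
  let v₀ : Fin n → Bool := fun _ => false
  obtain ⟨x, hx, hcx⟩ := (c v₀).exists_mk
  have h1 : ∀ i, ∃ y, ∃ hy : y ∈ medSet H f, c (flipAt i v₀) = TraceSpace.mk y hy ∧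
      ∃ A, sep (axialHalfspaces H f) x y = {A} := by
    intro i
    obtain ⟨y, hy, hcy⟩ := (c (flipAt i v₀)).exists_mk
    refine ⟨y, hy, hcy, ?_⟩
    have hadj := c.toHom.map_adj (hypercube_adj_iff.2 ⟨i, rfl⟩ : (hypercube n).Adj v₀ (flipAt i v₀))
    change (MedianAlgebra.graph _).Adj (c v₀) (c (flipAt i v₀)) at hadj
    rw [hcx, hcy, hW.adj_iff, TraceSpace.sep_traceWalls,
      ((hH.traceWall_injOn hf).mono fun A hA => hA.1).ncard_image] at hadj
    exact Set.ncard_eq_one.1 hadj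
  choose y hy hcy A hA using h1
  have hAm : ∀ i, A i ∈ axialHalfspaces H f := fun i =>
    ((hA i).symm ▸ rfl : A i ∈ sep (axialHalfspaces H f) x (y i)).1
  have h2 : ∀ i, ∃ k : ℤ, shift f k (A i) ∈ diffs H x₀ (f x₀) := by
    intro i
    obtain ⟨a, b, ha, hb⟩ := hH.axial_crosses hf (hAm i) x₀
    have h3 : ∃ k : ℤ, ¬ ((f ^ k) x₀ ∈ A i ↔ (f ^ k) (f x₀) ∈ A i) := by
      rcases le_total a b with hab | hab
      · obtain ⟨k, -, -, hk⟩ := exists_step_mem (f := f) (x := x₀) (A := A i) hab (by tauto)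
        exact ⟨k, hk⟩
      · obtain ⟨k, -, -, hk⟩ := exists_step_mem (f := f) (x := x₀) (A := A i) hab (by tauto)
        exact ⟨k, hk⟩
    obtain ⟨k, hk⟩ := h3
    exact ⟨k, hf k _ (hAm i).1.1, hk⟩
  choose k hk using h2
  have hinj : Function.Injective fun i => shift f (k i) (A i) := by
    intro i j hij
    simp only at hij
    have h3 : A j = shift f (-k j + k i) (A i) := by
      rw [← shift_shift, hij, shift_neg_shift]
    have h4 := hH.eq_of_shift_of_step hf (hy i) (hy j) (hAm i) (hA i) (h3 ▸ hA j)
    have h5 : c (flipAt i v₀) = c (flipAt j v₀) := by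
      rw [hcy, hcy, TraceSpace.mk_eq_iff]
      refine fun B hB => hcc.mem_iff_of_sep_eq (x := x) ?_ hB
      rw [hA, hA, h3, h4]
    have h6 := congrFun (c.injective h5) i
    by_contra hne
    rw [flipAt_same, flipAt_of_ne hne] at h6
    simp [v₀] at h6
  have h7 := Set.ncard_le_ncard (s := Set.range fun i => shift f (k i) (A i))
    (Set.range_subset_iff.2 hk) (hH.finite_diffs subset_rfl x₀ (f x₀))
  rwa [← Set.image_univ, Set.ncard_image_of_injective _ hinj, Set.ncard_univ, Nat.card_fin] at h7

/-- The predicate `p` stands for containing one end of an orbit; `hnp` prevents the orientation from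
being principal. -/
theorem axialOrientation_mem_rollerBoundary {p : Set V → Prop}
    (hxor : ∀ A ∈ axialHalfspaces H f, p A ↔ ¬ p Aᶜ)
    (hup : ∀ A ∈ axialHalfspaces H f, ∀ B ∈ axialHalfspaces H f,
      (∀ x ∈ medSet H f, x ∈ A → x ∈ B) → p A → p B)
    (hnp : ∀ x ∈ medSet H f, ∃ A ∈ axialHalfspaces H f, p A ∧ x ∉ A) :
    letI := hH.axialAlgebra hf
    {B | ∃ A ∈ axialHalfspaces H f, p A ∧
      B = {σ : TraceSpace (axialHalfspaces H f) (medSet H f) | A ∈ σ.1}} ∈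
        MedianAlgebra.rollerBoundary (TraceSpace (axialHalfspaces H f) (medSet H f)) := by
  let := hH.axialAlgebra hf
  have hW := hH.isWallSystem_axial hf
  have hcc := hH.complClosed_axial (f := f)
  have htr : ∀ A ∈ axialHalfspaces H f, ∀ B ∈ axialHalfspaces H f,
      ({σ : TraceSpace (axialHalfspaces H f) (medSet H f) | A ∈ σ.1} ⊆ {σ | B ∈ σ.1}) →
      ∀ x ∈ medSet H f, x ∈ A → x ∈ B := by
    intro A hA B hB h x hx hxA
    exact (h (show TraceSpace.mk x hx ∈ {σ : TraceSpace (axialHalfspaces H f) (medSet H f) |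
      A ∈ σ.1} from ⟨hA, hxA⟩)).2
  have hmem : ∀ A ∈ axialHalfspaces H f,
      ({σ : TraceSpace (axialHalfspaces H f) (medSet H f) | A ∈ σ.1} ∈
        {B | ∃ A ∈ axialHalfspaces H f, p A ∧
          B = {σ : TraceSpace (axialHalfspaces H f) (medSet H f) | A ∈ σ.1}} ↔ p A) := by
    intro A hA
    constructor
    · rintro ⟨B, hB, hpB, h⟩
      rwa [hH.traceWall_injOn hf hA hB h]
    · exact fun h => ⟨A, hA, h, rfl⟩
  have hcompl : ∀ A ∈ axialHalfspaces H f,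
      {σ : TraceSpace (axialHalfspaces H f) (medSet H f) | A ∈ σ.1}ᶜ = {σ | Aᶜ ∈ σ.1} := by
    intro A hA
    ext σ
    obtain ⟨x, hx, rfl⟩ := σ.exists_mk
    change ¬ (A ∈ _ ∧ x ∈ A) ↔ (Aᶜ ∈ _ ∧ x ∉ A)
    have := hcc A hA
    tauto
  refine ⟨⟨?_, ?_, ?_⟩, ?_⟩
  · rintro _ ⟨A, hA, -, rfl⟩
    rw [hW.halfspaces_eq]
    exact ⟨A, hA, rfl⟩
  · rw [hW.halfspaces_eq]
    rintro _ ⟨A, hA, rfl⟩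
    rw [hcompl A hA, hmem A hA, hmem _ (hcc A hA), hxor A hA, xor_iff_not_iff]
    tauto
  · rw [hW.halfspaces_eq]
    rintro _ ⟨A, hA, rfl⟩ _ ⟨B, hB, rfl⟩ hAB h
    rw [hmem A hA] at h
    rw [hmem B hB]
    exact hup A hA B hB (htr A hA B hB hAB) h
  · rintro ⟨σ, hσ⟩
    obtain ⟨x, hx, rfl⟩ := σ.exists_mk
    obtain ⟨A, hA, hpA, hxA⟩ := hnp x hx
    have := (hmem A hA).2 hpA
    rw [← hσ] at this
    exact hxA this.2.2

include hf in
-- Each axial halfspace contains exactly one of the two ends of the orbit of `x`.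
theorem axial_end_iff {x : V} (hx : x ∈ medSet H f) {A : Set V} (hA : A ∈ axialHalfspaces H f) :
    ((∃ N : ℤ, ∀ n ≥ N, (f ^ n) x ∈ A) ↔ ¬ ∃ N : ℤ, ∀ n ≥ N, (f ^ n) x ∉ A) ∧
    ((∃ N : ℤ, ∀ n ≥ N, (f ^ (-n)) x ∈ A) ↔ ¬ ∃ N : ℤ, ∀ n ≥ N, (f ^ (-n)) x ∉ A) ∧
    ((∃ N : ℤ, ∀ n ≥ N, (f ^ (-n)) x ∈ A) ↔ ¬ ∃ N : ℤ, ∀ n ≥ N, (f ^ n) x ∈ A) := by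
  have hex : ∀ p q : ℤ → Prop, (∀ n, p n → q n → False) → (∃ N : ℤ, ∀ n ≥ N, p n) →
      ¬ ∃ N : ℤ, ∀ n ≥ N, q n := by
    rintro p q h ⟨N, hN⟩ ⟨M, hM⟩
    exact h _ (hN (max N M) (le_max_left _ _)) (hM (max N M) (le_max_right _ _))
  obtain ⟨N, -, h | h⟩ := hH.axial_ends hf hA hx
  · have h1 : ∃ N : ℤ, ∀ n ≥ N, (f ^ n) x ∈ A := ⟨N, fun n hn => (h n hn).1⟩
    have h2 : ∃ N : ℤ, ∀ n ≥ N, (f ^ (-n)) x ∉ A := ⟨N, fun n hn => (h n hn).2⟩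
    have h3 := hex _ (fun n => (f ^ n) x ∉ A) (fun n h h' => h' h) h1
    have h4 := hex _ (fun n => (f ^ (-n)) x ∈ A) (fun n h h' => h h') h2
    exact ⟨iff_of_true h1 h3, iff_of_false h4 (not_not.2 h2), iff_of_false h4 (not_not.2 h1)⟩
  · have h1 : ∃ N : ℤ, ∀ n ≥ N, (f ^ n) x ∉ A := ⟨N, fun n hn => (h n hn).1⟩
    have h2 : ∃ N : ℤ, ∀ n ≥ N, (f ^ (-n)) x ∈ A := ⟨N, fun n hn => (h n hn).2⟩
    have h3 := hex _ (fun n => (f ^ n) x ∈ A) (fun n h h' => h h') h1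
    have h4 := hex _ (fun n => (f ^ (-n)) x ∉ A) (fun n h h' => h' h) h2
    exact ⟨iff_of_false h3 (not_not.2 h1), iff_of_true h2 h4, iff_of_true h2 h3⟩

/-- The two boundary points are the ends of the orbit of a point `x₀` of the median set. They are
opposite on every axial wall, so their median with any point is that point. -/
theorem isMedianFlat_axial (hne : (axialHalfspaces H f).Nonempty) :
    letI := hH.axialAlgebra hf
    MedianAlgebra.IsMedianFlat (TraceSpace (axialHalfspaces H f) (medSet H f)) := by
  let := hH.axialAlgebra hf
  have hW := hH.isWallSystem_axial hf
  have hcc := hH.complClosed_axial (f := f)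
  obtain ⟨x₀, hx₀⟩ := hH.medSet_nonempty hf
  obtain ⟨A₀, hA₀⟩ := hne
  have hend := fun {A} (hA : A ∈ axialHalfspaces H f) => hH.axial_end_iff hf hx₀ hA
  refine ⟨⟨TraceSpace.mk x₀ hx₀⟩, hH.isFiniteDimensional_axial hf, hW.isDiscrete,
    _, hH.axialOrientation_mem_rollerBoundary hf (p := fun A => ∃ N : ℤ, ∀ n ≥ N, (f ^ n) x₀ ∈ A)
      ?_ ?_ ?_,
    _, hH.axialOrientation_mem_rollerBoundary hf
      (p := fun A => ∃ N : ℤ, ∀ n ≥ N, (f ^ (-n)) x₀ ∈ A) ?_ ?_ ?_, ?_⟩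
  · exact fun A hA => (hend hA).1
  · rintro A - B - h ⟨N, hN⟩
    exact ⟨N, fun n hn => h _ (zpow_mem_medSet hx₀ n) (hN n hn)⟩
  · intro x hx
    have key : ∀ A ∈ axialHalfspaces H f, (∃ N : ℤ, ∀ n ≥ N, (f ^ n) x₀ ∈ A) →
        ∃ A ∈ axialHalfspaces H f, (∃ N : ℤ, ∀ n ≥ N, (f ^ n) x₀ ∈ A) ∧ x ∉ A := by
      rintro A hA ⟨N, hN⟩
      obtain ⟨-, b, -, hb⟩ := hH.axial_crosses hf hA x
      -- Translating `A` keeps the end of the orbit inside; the translate by a time at which the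
      -- orbit of `x` is outside `A` misses `x`.
      refine ⟨shift f b A, shiftInvariant_axial hf b A hA, ⟨N - b, fun n hn => ?_⟩, hb⟩
      rw [mem_shift, ← zpow_add_apply]
      exact hN _ (by omega)
    by_cases h : ∃ N : ℤ, ∀ n ≥ N, (f ^ n) x₀ ∈ A₀
    · exact key A₀ hA₀ h
    · exact key A₀ᶜ (hcc A₀ hA₀) ((not_iff_comm.1 (hend hA₀).1.symm).1 h)
  · exact fun A hA => (hend hA).2.1
  · rintro A - B - h ⟨N, hN⟩
    exact ⟨N, fun n hn => h _ (zpow_mem_medSet hx₀ (-n)) (hN n hn)⟩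
  · intro x hx
    have key : ∀ A ∈ axialHalfspaces H f, (∃ N : ℤ, ∀ n ≥ N, (f ^ (-n)) x₀ ∈ A) →
        ∃ A ∈ axialHalfspaces H f, (∃ N : ℤ, ∀ n ≥ N, (f ^ (-n)) x₀ ∈ A) ∧ x ∉ A := by
      rintro A hA ⟨N, hN⟩
      obtain ⟨-, b, -, hb⟩ := hH.axial_crosses hf hA x
      refine ⟨shift f b A, shiftInvariant_axial hf b A hA, ⟨N + b, fun n hn => ?_⟩, hb⟩
      rw [mem_shift, ← zpow_add_apply]
      have := hN (n - b) (by omega)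
      rwa [neg_sub, sub_eq_add_neg] at this
    by_cases h : ∃ N : ℤ, ∀ n ≥ N, (f ^ (-n)) x₀ ∈ A₀
    · exact key A₀ hA₀ h
    · exact key A₀ᶜ (hcc A₀ hA₀) ((not_iff_comm.1 (hend hA₀).2.1.symm).1 h)
  · intro σ
    obtain ⟨x, hx, rfl⟩ := σ.exists_mk
    ext B
    simp only [MedianAlgebra.orientationMed, Set.mem_union, Set.mem_inter_iff,
      mem_principalOrientation]
    rw [hW.halfspaces_eq]
    by_cases hB : B ∈ traceWalls (axialHalfspaces H f) (medSet H f)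
    · obtain ⟨A, hA, rfl⟩ := hB
      have hmem : ∀ p : Set V → Prop,
          ({σ : TraceSpace (axialHalfspaces H f) (medSet H f) | A ∈ σ.1} ∈
            {B | ∃ A ∈ axialHalfspaces H f, p A ∧
              B = {σ : TraceSpace (axialHalfspaces H f) (medSet H f) | A ∈ σ.1}} ↔ p A) := by
        intro p
        constructor
        · rintro ⟨B, hB, hpB, h⟩
          rwa [hH.traceWall_injOn hf hA hB h]
        · exact fun h => ⟨A, hA, h, rfl⟩
      rw [hmem, hmem, (hend hA).2.2]
      tauto
    · have hno : ∀ p : Set V → Prop, B ∉ {B | ∃ A ∈ axialHalfspaces H f, p A ∧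
          B = {σ : TraceSpace (axialHalfspaces H f) (medSet H f) | A ∈ σ.1}} := by
        rintro p ⟨A, hA, -, h⟩
        exact hB ⟨A, hA, h⟩
      have h1 := hno fun A => ∃ N : ℤ, ∀ n ≥ N, (f ^ n) x₀ ∈ A
      have h2 := hno fun A => ∃ N : ℤ, ∀ n ≥ N, (f ^ (-n)) x₀ ∈ A
      tauto

include hf in
/-- The translation length does not depend on the point of the median set. -/
theorem ncard_sep_stable_eq {x y : V} (hx : x ∈ medSet H f) (hy : y ∈ medSet H f) :
    (sep (stableHalfspaces H f) x (f x)).ncard = (sep (stableHalfspaces H f) y (f y)).ncard := by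
  have key : ∀ {x y : V}, x ∈ medSet H f → y ∈ medSet H f →
      (sep (stableHalfspaces H f) x (f x)).ncard ≤
        (sep (stableHalfspaces H f) y (f y)).ncard := by
    intro x y hx hy
    obtain ⟨C, hC⟩ := hH.exists_displacement_bound hf hx x
    obtain ⟨D, hD⟩ := hH.exists_displacement_bound hf hy x
    by_contra hlt
    push Not at hlt
    have h1 := (hC (C + D + 1)).2
    have h2 := (hD (C + D + 1)).1
    have h3 := Nat.mul_le_mul_left (C + D + 1) hlt
    rw [Nat.succ_eq_add_one, mul_add, mul_one] at h3
    omega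
  exact le_antisymm (key hx hy) (key hy hx)

/-- Along an orbit in the median set, the stable halfspaces crossed are all axial, so displacements
in this factor are the additive stable ones and `exists_line` applies. -/
theorem actsByTranslations_axial
    (φ : Equiv.Perm (TraceSpace (axialHalfspaces H f) (medSet H f)))
    (hφ : ∀ x (hx : x ∈ medSet H f) (hx' : f x ∈ medSet H f),
      φ (TraceSpace.mk x hx) = TraceSpace.mk (f x) hx')
    {l : ℕ} (hl : 0 < l)
    (hx : ∀ x ∈ medSet H f, (sep (stableHalfspaces H f) x (f x)).ncard = l) :
    letI := hH.axialAlgebra hf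
    MedianAlgebra.ActsByTranslations (TraceSpace (axialHalfspaces H f) (medSet H f)) φ l := by
  let := hH.axialAlgebra hf
  have hW := hH.isWallSystem_axial hf
  have hc : (MedianAlgebra.graph (TraceSpace (axialHalfspaces H f) (medSet H f))).Connected := by
    obtain ⟨x₀, hx₀⟩ := hH.medSet_nonempty hf
    have : Nonempty (TraceSpace (axialHalfspaces H f) (medSet H f)) := ⟨TraceSpace.mk x₀ hx₀⟩
    exact ⟨fun x y => (hW.reachable_and_dist x y).1⟩
  have hfM : ∀ {x}, x ∈ medSet H f → f x ∈ medSet H f := fun hx => by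
    simpa using zpow_mem_medSet hx 1
  have hφd : ∀ σ τ, (MedianAlgebra.graph _).dist (φ σ) (φ τ) = (MedianAlgebra.graph _).dist σ τ := by
    intro σ τ
    obtain ⟨x, hx, rfl⟩ := σ.exists_mk
    obtain ⟨y, hy, rfl⟩ := τ.exists_mk
    rw [hφ x hx (hfM hx), hφ y hy (hfM hy), hH.dist_axial hf, hH.dist_axial hf]
    simpa using (shiftInvariant_axial hf).ncard_sep_apply 1 x y
  have hφk : ∀ (k : ℕ) (x : V) (hx : x ∈ medSet H f),
      (φ ^ (k : ℤ)) (TraceSpace.mk x hx) = TraceSpace.mk ((f ^ (k : ℤ)) x) (zpow_mem_medSet hx k) := by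
    intro k
    induction k with
    | zero => intro x hx; simp
    | succ k ih =>
      intro x hx
      simp only [Nat.cast_succ, zpow_add_one_apply]
      rw [hφ x hx (hfM hx), ih]
  intro σ
  obtain ⟨x, hxM, rfl⟩ := σ.exists_mk
  refine exists_line hc hφd hl fun k => ?_
  rw [hφk, hH.dist_axial hf, sep_axial_zpow hxM, hH.ncard_sep_stable_zpow hf hxM, hx x hxM]

end IsMedianWallspace

/-! ### Cubes and their halfspaces -/

/-- `A` lists the walls of `𝓐`, choosing one halfspace of each of them. -/
structure IsWallEnum {V : Type*} (𝓐 : Set (Set V)) {d : ℕ} (A : Fin d → Set V) : Prop where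
  mem : ∀ i, A i ∈ 𝓐
  exists_eq : ∀ B ∈ 𝓐, ∃ i, B = A i ∨ B = (A i)ᶜ
  eq_of_eq : ∀ i j, A i = A j ∨ A i = (A j)ᶜ → i = j

namespace CubeComplex

variable {V : Type*} {X : CubeComplex V}

theorem exists_crossing_flipAt {n : ℕ} (P : (Fin n → Bool) → Prop) {u u' : Fin n → Bool}
    (hu : P u) (hu' : ¬ P u') :
    ∃ w i, P w ∧ ¬ P (flipAt i w) ∧ u i ≠ u' i := by
  have key : ∀ m, ∀ u, P u → (Finset.univ.filter fun i => u i ≠ u' i).card = m →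
      ∃ w i, P w ∧ ¬ P (flipAt i w) ∧ u i ≠ u' i := by
    intro m
    induction m using Nat.strong_induction_on with
    | _ m ih =>
    intro u hu hm
    obtain ⟨i, hi⟩ : ∃ i, u i ≠ u' i := by
      by_contra h
      push Not at h
      exact hu' (funext h ▸ hu)
    by_cases h : P (flipAt i u)
    · have hlt : (Finset.univ.filter fun j => flipAt i u j ≠ u' j) ⊂
          Finset.univ.filter fun j => u j ≠ u' j := by
        refine (Finset.ssubset_iff_of_subset fun j hj => ?_).2 ⟨i, by simpa using hi, ?_⟩
        · simp only [Finset.mem_filter, Finset.mem_univ, true_and] at hj ⊢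
          by_cases hji : j = i
          · exact hji ▸ hi
          · rwa [flipAt_of_ne hji] at hj
        · simp only [Finset.mem_filter, Finset.mem_univ, true_and, not_not, flipAt_same]
          revert hi
          cases u i <;> cases u' i <;> simp
      obtain ⟨w, j, h1, h2, h3⟩ := ih _ (hm ▸ Finset.card_lt_card hlt) _ h rfl
      refine ⟨w, j, h1, h2, ?_⟩
      by_cases hji : j = i
      · exact hji ▸ hi
      · rwa [flipAt_of_ne hji] at h3
    · exact ⟨u, i, hu, h, hi⟩
  exact key _ u hu rfl

/-- The edges of a cube in a given direction are parallel and define one halfspace. Changing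
coordinates one at a time, any halfspace separating two vertices of the cube cuts one of its edges,
hence is of this form up to complement. -/
theorem IsCAT0.exists_cube_walls (hX : X.IsCAT0) {C : Set V} (hC : C ∈ X.cubes) {n : ℕ}
    (e : hypercube n ≃g X.graph.induce C) :
    ∃ B : Fin n → Set V, (∀ j, B j ∈ X.allHalfspaces) ∧ (∀ j u, (e u : V) ∈ B j ↔ u j = true) ∧
      ∀ A ∈ X.allHalfspaces, ∀ u u', (e u : V) ∈ A → (e u' : V) ∉ A →
        ∃ j, u j ≠ u' j ∧ (A = B j ∨ A = (B j)ᶜ) := by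
  let B : Fin n → Set V := fun j =>
    nearer X.graph (e (flipAt j fun _ => false)) (e fun _ => false)
  have hN : ∀ m, ∀ j u, u j = false → (Finset.univ.filter fun i => u i = true).card = m →
      nearer X.graph (e (flipAt j u)) (e u) = B j := by
    intro m
    induction m using Nat.strong_induction_on with
    | _ m ih =>
    intro j u huj hm
    by_cases h : ∃ i, u i = true
    · obtain ⟨i, hi⟩ := h
      have hij : i ≠ j := by rintro rfl; rw [huj] at hi; exact absurd hi (by simp)
      have hsub : (Finset.univ.filter fun k => flipAt i u k = true) ⊂
          Finset.univ.filter fun k => u k = true := by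
        refine (Finset.ssubset_iff_of_subset fun k hk => ?_).2 ⟨i, by simpa using hi, ?_⟩
        · simp only [Finset.mem_filter, Finset.mem_univ, true_and] at hk ⊢
          by_cases hki : k = i
          · exact hki ▸ hi
          · rwa [flipAt_of_ne hki] at hk
        · simp [flipAt_same, hi]
      rw [← ih _ (hm ▸ Finset.card_lt_card hsub) j (flipAt i u)
        (by rw [flipAt_of_ne hij.symm, huj]) rfl]
      have h1 := congrArg compl (hX.nearer_eq_of_sq (sq_flipAt hC e u hij.symm))
      rw [hX.compl_nearer (adj_flipAt e _ _), flipAt_comm hij,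
        hX.compl_nearer (adj_flipAt e _ _)] at h1
      rw [h1]
    · push Not at h
      have : u = fun _ => false := funext fun i => by simpa using h i
      rw [this]
  have hB : ∀ j, B j ∈ X.allHalfspaces := fun j => nearer_mem (adj_flipAt e _ _).symm
  have hmem : ∀ j u, (e u : V) ∈ B j ↔ u j = true := by
    intro j u
    cases huj : u j
    · rw [← hN _ j u huj rfl]
      simp only [Bool.false_eq_true, iff_false]
      exact right_notMem_nearer
    · have := hN _ j (flipAt j u) (by rw [flipAt_same, huj]; rfl) rfl
      rw [flipAt_flipAt] at this
      rw [← this]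
      simp only [iff_true]
      exact left_mem_nearer (adj_flipAt e _ _)
  refine ⟨B, hB, hmem, fun A hA u u' hu hu' => ?_⟩
  obtain ⟨w, i, h1, h2, h3⟩ := exists_crossing_flipAt (fun u => (e u : V) ∈ A) hu hu'
  refine ⟨i, h3, ?_⟩
  rw [hX.eq_nearer hA (adj_flipAt e w i) h1 h2]
  cases hwi : w i
  · refine Or.inr ?_
    rw [← hN _ i w hwi rfl, hX.compl_nearer (adj_flipAt e _ _).symm]
  · refine Or.inl ?_
    have := hN _ i (flipAt i w) (by rw [flipAt_same, hwi]; rfl) rfl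
    rwa [flipAt_flipAt] at this

/-- Points with the same sides of the halfspaces outside `𝓘` form a cube as soon as they realise
all the orientations of the walls of `𝓘`. -/
theorem IsCAT0.fibre_mem_cubes (hX : X.IsCAT0) {𝓘 : Set (Set V)} (h𝓘 : 𝓘 ⊆ X.allHalfspaces)
    (hc : ComplClosed 𝓘) {d : ℕ} {A : Fin d → Set V} (hA : IsWallEnum 𝓘 A) (w : V)
    (hw : ∀ v : Fin d → Bool, ∃ x, (∀ B ∈ X.allHalfspaces \ 𝓘, w ∈ B ↔ x ∈ B) ∧
      ∀ i, x ∈ A i ↔ v i = true) :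
    {x | ∀ B ∈ X.allHalfspaces \ 𝓘, w ∈ B ↔ x ∈ B} ∈ X.cubes ∧
      X.HasDim {x | ∀ B ∈ X.allHalfspaces \ 𝓘, w ∈ B ↔ x ∈ B} d := by
  classical
  have hH := hX.isMedianWallspace
  choose p hp hpA using hw
  set F := {x | ∀ B ∈ X.allHalfspaces \ 𝓘, w ∈ B ↔ x ∈ B} with hF
  have hext : ∀ {x y}, x ∈ F → y ∈ F → (∀ i, x ∈ A i ↔ y ∈ A i) → x = y := by
    intro x y hx hy h
    refine hH.eq_of_forall fun B hB => ?_
    by_cases hBI : B ∈ 𝓘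
    · obtain ⟨i, rfl | rfl⟩ := hA.exists_eq B hBI
      · exact h i
      · exact not_congr (h i)
    · exact (hx B ⟨hB, hBI⟩).symm.trans (hy B ⟨hB, hBI⟩)
  have hadj : ∀ v v', X.graph.Adj (p v) (p v') ↔ (hypercube d).Adj v v' := by
    intro v v'
    rw [hypercube_adj_iff]
    constructor
    · intro h
      obtain ⟨B, hB⟩ := hH.sep_of_adj h
      obtain ⟨i, hi⟩ : ∃ i, v i ≠ v' i := by
        by_contra hcon
        push Not at hcon
        rw [funext hcon] at h
        exact h.ne rfl
      have hsep : ∀ j, v j ≠ v' j → B = A j ∨ B = (A j)ᶜ := by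
        intro j hj
        have h1 := hpA v j
        have h2 := hpA v' j
        by_cases hvj : v j = true
        · have : A j ∈ sep X.allHalfspaces (p v) (p v') :=
            ⟨h𝓘 (hA.mem j), h1.2 hvj, fun h3 => hj (hvj.trans (h2.1 h3).symm)⟩
          rw [hB] at this
          exact Or.inl this.symm
        · have : (A j)ᶜ ∈ sep X.allHalfspaces (p v) (p v') := by
            refine ⟨hH.compl_mem _ (h𝓘 (hA.mem j)), fun h3 => hvj (h1.1 h3), fun h3 => h3 ?_⟩
            rw [h2]
            revert hj hvj
            cases v j <;> cases v' j <;> simp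
          rw [hB] at this
          exact Or.inr this.symm
      refine ⟨i, funext fun j => ?_⟩
      by_cases hji : j = i
      · subst hji
        rw [flipAt_same]
        revert hi
        cases v j <;> cases v' j <;> simp
      · rw [flipAt_of_ne hji]
        by_contra hne
        have h1 := hsep i hi
        have h2 := hsep j (Ne.symm hne)
        refine hji (hA.eq_of_eq j i ?_)
        rcases h1 with h1 | h1 <;> rcases h2 with h2 | h2
        · exact Or.inl (h2.symm.trans h1)
        · exact Or.inr (by rw [← h1, h2, compl_compl])
        · exact Or.inr (h2.symm.trans h1)
        · exact Or.inl (compl_injective (h2.symm.trans h1))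
    · rintro ⟨i, rfl⟩
      have hdiff : ∀ B ∈ sep X.allHalfspaces (p v) (p (flipAt i v)), B = A i ∨ B = (A i)ᶜ := by
        rintro B ⟨hB, h1, h2⟩
        by_cases hBI : B ∈ 𝓘
        · obtain ⟨j, hj⟩ := hA.exists_eq B hBI
          by_cases hji : j = i
          · exact hji ▸ hj
          · exfalso
            have h3 : p v ∈ A j ↔ p (flipAt i v) ∈ A j := by
              rw [hpA, hpA, flipAt_of_ne hji]
            rcases hj with rfl | rfl
            · exact h2 (h3.1 h1)
            · exact h2 fun h => h1 (h3.2 h)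
        · exact absurd (((hp v B ⟨hB, hBI⟩).symm.trans (hp _ B ⟨hB, hBI⟩)).1 h1) h2
      have hne : p v ≠ p (flipAt i v) := by
        intro h
        have h1 := hpA v i
        rw [h, hpA, flipAt_same] at h1
        revert h1
        cases v i <;> simp
      rw [← SimpleGraph.dist_eq_one_iff_adj]
      refine le_antisymm ?_ (hH.connected.pos_dist_of_ne hne)
      rw [hH.dist_eq, Set.ncard_le_one (hH.finite_sep _ _)]
      intro B hB B' hB'
      rcases hdiff B hB with h1 | h1 <;> rcases hdiff B' hB' with h2 | h2
      · rw [h1, h2]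
      · exact absurd hB.2.1 (by rw [h1]; exact fun h => (h2 ▸ hB'.2.1) h)
      · exact absurd hB'.2.1 (by rw [h2]; exact fun h => (h1 ▸ hB.2.1) h)
      · rw [h1, h2]
  have hpinj : Function.Injective p := by
    intro v v' h
    funext i
    have h1 := hpA v i
    rw [h, hpA v' i] at h1
    revert h1
    cases v i <;> cases v' i <;> simp
  have hsurj : ∀ x ∈ F, p (fun i => decide (x ∈ A i)) = x := by
    intro x hx
    exact hext (hp _) hx fun i => by rw [hpA]; simp
  have hdim : X.HasDim F d := by
    refine ⟨⟨Equiv.ofBijective (fun v => (⟨p v, hp v⟩ : F)) ⟨fun v v' h => ?_, fun x => ?_⟩, ?_⟩⟩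
    · exact hpinj (congrArg Subtype.val h)
    · exact ⟨_, Subtype.ext (hsurj x x.2)⟩
    · exact hadj _ _
  refine ⟨?_, hdim⟩
  let v₀ : Fin d → Bool := fun _ => false
  have hdist2 : ∀ i j, i ≠ j → X.graph.dist (p (flipAt j (flipAt i v₀))) (p v₀) = 2 := by
    intro i j hij
    have h1 : X.graph.Adj (p (flipAt j (flipAt i v₀))) (p (flipAt i v₀)) :=
      ((hadj _ _).2 (hypercube_adj_iff.2 ⟨j, rfl⟩)).symm
    have h2 : X.graph.Adj (p v₀) (p (flipAt i v₀)) := (hadj _ _).2 (hypercube_adj_iff.2 ⟨i, rfl⟩)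
    have h3 := hX.dist_of_adj (p (flipAt j (flipAt i v₀))) h2
    rw [SimpleGraph.dist_eq_one_iff_adj.2 h1] at h3
    have h4 : X.graph.dist (p (flipAt j (flipAt i v₀))) (p v₀) ≠ 0 := by
      rw [Ne, hH.connected.dist_eq_zero_iff]
      intro h
      have := congrFun (hpinj h) i
      rw [flipAt_of_ne hij, flipAt_same] at this
      simp [v₀] at this
    omega
  -- By the quadrangle condition the neighbours of `p v₀` in `F` span squares pairwise, so flagness
  -- puts them in a cube `D`, possibly of larger dimension.
  obtain ⟨D, hD, hcD, hsD⟩ := hX.1.exists_cube (c := p v₀)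
    (s := Finset.univ.image fun i => p (flipAt i v₀)) (by
      simp only [Finset.mem_image, Finset.mem_univ, true_and, forall_exists_index,
        forall_apply_eq_imp_iff]
      exact fun i => (hadj _ _).2 (hypercube_adj_iff.2 ⟨i, rfl⟩)) (by
      simp only [Finset.mem_image, Finset.mem_univ, true_and, forall_exists_index,
        forall_apply_eq_imp_iff]
      intro i j hne
      have hij : i ≠ j := by rintro rfl; exact hne rfl
      obtain ⟨m, hm, -⟩ := hX.quadrangle (x := p (flipAt j (flipAt i v₀))) (y := p v₀) (n := 1)
        ((hadj _ _).2 (hypercube_adj_iff.2 ⟨i, rfl⟩)).symm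
        ((hadj _ _).2 (hypercube_adj_iff.2 ⟨j, rfl⟩)).symm hne (hdist2 i j hij)
        (SimpleGraph.dist_eq_one_iff_adj.2 ((hadj _ _).2 (hypercube_adj_iff.2 ⟨j, rfl⟩)).symm)
        (SimpleGraph.dist_eq_one_iff_adj.2 ((hadj _ _).2 (hypercube_adj_iff.2
          ⟨i, flipAt_comm hij.symm _⟩)).symm)
      exact ⟨m, hm⟩)
  obtain ⟨n, ⟨e⟩⟩ := X.exists_dim D hD
  obtain ⟨B, hB, heB, hsepB⟩ := hX.exists_cube_walls hD e
  obtain ⟨u₀, hu₀⟩ : ∃ u, (e u : V) = p v₀ := by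
    obtain ⟨u, hu⟩ := e.surjective ⟨p v₀, hcD⟩
    exact ⟨u, congrArg Subtype.val hu⟩
  have hκ : ∀ i, ∃ j, A i = B j ∨ A i = (B j)ᶜ := by
    intro i
    obtain ⟨u, hu⟩ := e.surjective ⟨p (flipAt i v₀), hsD (by simp)⟩
    have hu : (e u : V) = p (flipAt i v₀) := congrArg Subtype.val hu
    obtain ⟨j, -, hj⟩ := hsepB (A i) (h𝓘 (hA.mem i)) u u₀
      (by rw [hu, hpA, flipAt_same]; rfl) (by rw [hu₀, hpA]; simp [v₀])
    exact ⟨j, hj⟩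
  choose κ hκ using hκ
  have hBI : ∀ j, B j ∈ 𝓘 ∨ (B j)ᶜ ∈ 𝓘 → j ∈ Set.range κ := by
    intro j hj
    have h1 : ∃ i, B j = A i ∨ B j = (A i)ᶜ := by
      rcases hj with hj | hj
      · exact hA.exists_eq _ hj
      · obtain ⟨i, hi | hi⟩ := hA.exists_eq _ hj
        · exact ⟨i, Or.inr (by rw [← hi, compl_compl])⟩
        · exact ⟨i, Or.inl (compl_injective hi)⟩
    obtain ⟨i, hi⟩ := h1
    refine ⟨i, ?_⟩
    have h2 : B j = B (κ i) ∨ B j = (B (κ i))ᶜ := by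
      rcases hi with hi | hi <;> rcases hκ i with h | h <;> rw [h] at hi
      · exact Or.inl hi
      · exact Or.inr hi
      · exact Or.inr hi
      · exact Or.inl (by rw [hi, compl_compl])
    by_contra hne
    have h3 := heB j (flipAt j fun _ => false)
    have h4 := heB (κ i) (flipAt j fun _ => false)
    have h5 := heB j fun _ => false
    have h6 := heB (κ i) fun _ => false
    rw [flipAt_same] at h3
    rw [flipAt_of_ne hne] at h4
    rcases h2 with h2 | h2
    · rw [h2] at h3
      simp [h4] at h3
    · rw [h2] at h5
      simp [h6] at h5
  -- The walls of `𝓘` are the directions of `D` in the range of `κ`; fixing the other coordinates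
  -- cuts out `F`.
  have hface : F = {x | ∃ u : Fin n → Bool, (∀ j ∈ (Set.range κ)ᶜ, u j = u₀ j) ∧ (e u : V) = x} := by
    have hsub : ∀ u : Fin n → Bool, (∀ j ∈ (Set.range κ)ᶜ, u j = u₀ j) → (e u : V) ∈ F := by
      intro u hu
      have key : ∀ u u', (∀ j ∈ (Set.range κ)ᶜ, u j = u' j) → ∀ C ∈ X.allHalfspaces \ 𝓘,
          (e u : V) ∈ C → (e u' : V) ∈ C := by
        intro u u' huu' C hC h1
        by_contra h2
        obtain ⟨j, hj, hjC⟩ := hsepB C hC.1 u u' h1 h2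
        obtain ⟨i, rfl⟩ : j ∈ Set.range κ := by
          by_contra h3
          exact hj (huu' j h3)
        apply hC.2
        have h4 : C = A i ∨ C = (A i)ᶜ := by
          rcases hjC with h | h <;> rcases hκ i with h' | h' <;> rw [h, h']
          · exact Or.inl rfl
          · exact Or.inr (by rw [compl_compl])
          · exact Or.inr rfl
          · exact Or.inl rfl
        rcases h4 with h | h
        · exact h ▸ hA.mem i
        · exact h ▸ hc _ (hA.mem i)
      intro C hC
      rw [hp v₀ C hC, ← hu₀]
      exact ⟨key _ _ (fun j hj => (hu j hj).symm) C hC, key _ _ hu C hC⟩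
    refine Set.Subset.antisymm (fun x hx => ?_) ?_
    · refine ⟨fun j => decide (x ∈ B j), fun j hj => ?_, ?_⟩
      · have h1 : B j ∉ 𝓘 := fun h => hj (hBI j (Or.inl h))
        have h2 := (hx (B j) ⟨hB j, h1⟩).symm.trans (hp v₀ (B j) ⟨hB j, h1⟩)
        rw [← hu₀, heB] at h2
        rw [Bool.eq_iff_iff, decide_eq_true_iff, h2]
      · refine hext (hsub _ fun j hj => ?_) hx fun i => ?_
        · have h1 : B j ∉ 𝓘 := fun h => hj (hBI j (Or.inl h))
          have h2 := (hx (B j) ⟨hB j, h1⟩).symm.trans (hp v₀ (B j) ⟨hB j, h1⟩)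
          rw [← hu₀, heB] at h2
          rw [Bool.eq_iff_iff, decide_eq_true_iff, h2]
        · rcases hκ i with h | h <;> rw [h]
          · rw [heB, decide_eq_true_iff]
          · rw [Set.mem_compl_iff, Set.mem_compl_iff, heB, decide_eq_true_iff]
    · rintro _ ⟨u, hu, rfl⟩
      exact hsub u hu
  rw [hface]
  exact X.face_mem D hD _ ⟨n, e, (Set.range κ)ᶜ, u₀, rfl⟩

end CubeComplex

/-! ### Automorphisms of a CAT(0) cube complex -/

theorem SimpleGraph.dist_apply_of_adj {V : Type*} {Γ : SimpleGraph V} (hc : Γ.Connected)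
    {f : Equiv.Perm V} (hf : ∀ x y, Γ.Adj (f x) (f y) ↔ Γ.Adj x y) (x y : V) :
    Γ.dist (f x) (f y) = Γ.dist x y := by
  have key : ∀ {f : Equiv.Perm V}, (∀ x y, Γ.Adj (f x) (f y) ↔ Γ.Adj x y) → ∀ x y,
      Γ.dist (f x) (f y) ≤ Γ.dist x y := by
    intro f hf x y
    obtain ⟨w, hw⟩ := (hc.preconnected x y).exists_walk_length_eq_dist
    rw [← hw]
    have := SimpleGraph.dist_le (w.map (⟨f, fun h => (hf _ _).2 h⟩ : Γ →g Γ))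
    rwa [SimpleGraph.Walk.length_map] at this
  refine le_antisymm (key hf x y) ?_
  have := key (f := f.symm) (fun x y => by rw [← hf]; simp) (f x) (f y)
  simpa using this

theorem adj_zpow_apply_iff {V : Type*} {Γ : SimpleGraph V} {f : Equiv.Perm V}
    (hf : ∀ x y, Γ.Adj (f x) (f y) ↔ Γ.Adj x y) (n : ℤ) (x y : V) :
    Γ.Adj ((f ^ n) x) ((f ^ n) y) ↔ Γ.Adj x y := by
  have key : ∀ (n : ℕ) (x y : V), Γ.Adj ((f ^ (n : ℤ)) x) ((f ^ (n : ℤ)) y) ↔ Γ.Adj x y := by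
    intro n
    induction n with
    | zero => simp
    | succ n ih =>
      intro x y
      rw [Nat.cast_succ, zpow_add_one_apply, zpow_add_one_apply, ih, hf]
  obtain ⟨m, rfl | rfl⟩ := n.eq_nat_or_neg
  · exact key m x y
  · rw [← key m, zpow_neg_mul_apply, zpow_neg_mul_apply]

namespace CubeComplex

variable {V : Type*} {X : CubeComplex V} (hX : X.IsCAT0) {f : Equiv.Perm V}
  (hf : ∀ x y, X.graph.Adj (f x) (f y) ↔ X.graph.Adj x y)

include hX

include hf in
theorem IsCAT0.preimage_mem_allHalfspaces {A : Set V} (hA : A ∈ X.allHalfspaces) :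
    f ⁻¹' A ∈ X.allHalfspaces := by
  obtain ⟨a, b, hab, rfl⟩ := hA
  refine ⟨f.symm a, f.symm b, by rw [← hf]; simpa using hab, ?_⟩
  ext x
  rw [Set.mem_preimage, mem_nearer, mem_nearer,
    ← SimpleGraph.dist_apply_of_adj hX.2.1 hf x (f.symm a),
    ← SimpleGraph.dist_apply_of_adj hX.2.1 hf x (f.symm b)]
  simp

include hf in
theorem IsCAT0.shiftInvariant : ShiftInvariant f X.allHalfspaces := fun n _ hA =>
  hX.preimage_mem_allHalfspaces (f := f ^ n) (adj_zpow_apply_iff hf n) hA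

theorem IsCAT0.cutEdges_eq_iff {A B : Set V} (hA : A ∈ X.allHalfspaces)
    (hB : B ∈ X.allHalfspaces) : X.cutEdges A = X.cutEdges B ↔ A = B ∨ A = Bᶜ := by
  constructor
  · intro h
    have h1 := hX.halfspaces_cutEdges hA
    rw [h, hX.halfspaces_cutEdges hB] at h1
    have : A ∈ ({B, Bᶜ} : Set (Set V)) := by rw [h1]; exact Set.mem_insert _ _
    simpa using this
  · rintro (rfl | rfl)
    · rfl
    · rw [cutEdges_compl]

include hf in
theorem IsCAT0.inverts_cutEdges_iff {A : Set V} (hA : A ∈ X.allHalfspaces) :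
    X.Inverts f (X.cutEdges A) ↔ f '' A = Aᶜ := by
  constructor
  · rintro ⟨-, h⟩
    refine h A ?_
    rw [hX.halfspaces_cutEdges hA]
    exact Set.mem_insert _ _
  · intro h
    refine ⟨?_, ?_⟩
    · rw [← cutEdges_compl A, ← h]
      ext e
      constructor
      · rintro ⟨_, ⟨u, v, huv, hu, hv, rfl⟩, rfl⟩
        rw [h] at hu hv
        refine ⟨f v, f u, (hf _ _).2 huv.symm, Set.mem_image_of_mem _ (not_not.1 hv), ?_, ?_⟩
        · rw [f.injective.mem_set_image]; exact hu
        · rw [Sym2.map_mk, Sym2.eq_swap]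
      · rintro ⟨_, v', hadj, ⟨u, hu, rfl⟩, hv, rfl⟩
        obtain ⟨v, rfl⟩ := f.surjective v'
        rw [f.injective.mem_set_image] at hv
        refine ⟨s(u, v), ⟨v, u, ((hf _ _).1 hadj).symm, ?_, ?_, Sym2.eq_swap⟩, by rw [Sym2.map_mk]⟩
        · rw [h]; exact hv
        · rw [h]; exact fun h => h hu
    · rw [hX.halfspaces_cutEdges hA]
      rintro D (rfl | rfl)
      · exact h
      · rw [Set.image_compl_eq f.bijective, h]

include hf in
theorem IsCAT0.cutEdges_mem_invertedHyperplanes_iff {A : Set V} (hA : A ∈ X.allHalfspaces) :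
    X.cutEdges A ∈ X.invertedHyperplanes f ↔ A ∈ invertedHalfspaces X.allHalfspaces f := by
  have key : ∀ n : ℤ, (f ^ n) '' A = shift f (-n) A := by
    intro n
    ext x
    rw [mem_shift]
    constructor
    · rintro ⟨y, hy, rfl⟩
      rw [← zpow_add_apply]
      simpa using hy
    · intro hx
      exact ⟨_, hx, zpow_neg_mul_apply x⟩
  constructor
  · rintro ⟨-, n, hn⟩
    rw [hX.inverts_cutEdges_iff (adj_zpow_apply_iff hf n) hA, key] at hn
    exact ⟨hA, -n, hn⟩
  · rintro ⟨-, n, hn⟩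
    refine ⟨hX.isHyperplane_iff.2 ⟨A, hA, rfl⟩, -n, ?_⟩
    rw [hX.inverts_cutEdges_iff (adj_zpow_apply_iff hf _) hA, key, neg_neg, hn]

include hf in
theorem IsCAT0.invertedHyperplanes_eq : X.invertedHyperplanes f =
    X.cutEdges '' invertedHalfspaces X.allHalfspaces f := by
  ext J
  constructor
  · intro hJ
    obtain ⟨A, hA, rfl⟩ := hX.isHyperplane_iff.1 hJ.1
    exact ⟨A, (hX.cutEdges_mem_invertedHyperplanes_iff hf hA).1 hJ, rfl⟩
  · rintro ⟨A, hA, rfl⟩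
    exact (hX.cutEdges_mem_invertedHyperplanes_iff hf hA.1).2 hA

include hf in
theorem IsCAT0.quotientHalfspaces_eq : X.quotientHalfspaces (X.invertedHyperplanes f) =
    stableHalfspaces X.allHalfspaces f := by
  have hcc := hX.isMedianWallspace.complClosed_stable (f := f)
  ext D
  constructor
  · rintro ⟨J, hJ, hJ', hD⟩
    obtain ⟨A, hA, rfl⟩ := hX.isHyperplane_iff.1 hJ
    rw [hX.halfspaces_cutEdges hA] at hD
    have hAs : A ∈ stableHalfspaces X.allHalfspaces f :=
      ⟨hA, fun h => hJ' ((hX.cutEdges_mem_invertedHyperplanes_iff hf hA).2 h)⟩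
    rcases hD with rfl | rfl
    · exact hAs
    · exact hcc _ hAs
  · intro hD
    refine ⟨X.cutEdges D, hX.isHyperplane_iff.2 ⟨D, hD.1, rfl⟩,
      fun h => hD.2 ((hX.cutEdges_mem_invertedHyperplanes_iff hf hD.1).1 h), ?_⟩
    rw [hX.halfspaces_cutEdges hD.1]
    exact Set.mem_insert _ _

include hf in
theorem IsCAT0.finite_invertedHyperplanes : (X.invertedHyperplanes f).Finite := by
  rw [hX.invertedHyperplanes_eq hf]
  exact (hX.isMedianWallspace.finite_inverted (hX.shiftInvariant hf)).image _

include hf in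
theorem IsCAT0.exists_wallEnum :
    ∃ A : Fin (X.invertedHyperplanes f).ncard → Set V,
      IsWallEnum (invertedHalfspaces X.allHalfspaces f) A := by
  have : Finite (X.invertedHyperplanes f) := (hX.finite_invertedHyperplanes hf).to_subtype
  have e : Fin (X.invertedHyperplanes f).ncard ≃ X.invertedHyperplanes f :=
    (Finite.equivFinOfCardEq (Nat.card_coe_set_eq _)).symm
  have h : ∀ i, ∃ A ∈ invertedHalfspaces X.allHalfspaces f, X.cutEdges A = e i := by
    intro i
    exact (hX.invertedHyperplanes_eq hf).subset (e i).2
  choose A hA hAe using h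
  refine ⟨A, hA, fun B hB => ?_, fun i j hij => ?_⟩
  · obtain ⟨i, hi⟩ := e.surjective ⟨X.cutEdges B,
      (hX.cutEdges_mem_invertedHyperplanes_iff hf hB.1).2 hB⟩
    refine ⟨i, (hX.cutEdges_eq_iff hB.1 (hA i).1).1 ?_⟩
    rw [hAe, hi]
  · apply e.injective
    apply Subtype.ext
    rw [← hAe, ← hAe]
    exact (hX.cutEdges_eq_iff (hA i).1 (hA j).1).2 hij

include hf in
theorem IsCAT0.exists_mem_medSet_of_wallEnum {d : ℕ} {A : Fin d → Set V}
    (hA : IsWallEnum (invertedHalfspaces X.allHalfspaces f) A) {w : V}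
    (hw : w ∈ medSet X.allHalfspaces f) (v : Fin d → Bool) :
    ∃ x ∈ medSet X.allHalfspaces f, (∀ B ∈ stableHalfspaces X.allHalfspaces f, w ∈ B ↔ x ∈ B) ∧
      ∀ i, x ∈ A i ↔ v i = true := by
  have hH := hX.isMedianWallspace
  have hne : ∀ i, A i ≠ (A i)ᶜ := fun i h => by
    have := Set.ext_iff.1 h w
    simp at this
  let Y : Set (Set V) := {B | ∃ i, (B = A i ∧ v i = true) ∨ (B = (A i)ᶜ ∧ v i = false)}
  have hY1 : ∀ i, A i ∈ Y ↔ v i = true := by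
    intro i
    constructor
    · rintro ⟨j, ⟨h, hj⟩ | ⟨h, hj⟩⟩
      · rwa [hA.eq_of_eq i j (Or.inl h)]
      · have := hA.eq_of_eq i j (Or.inr h)
        subst this
        exact absurd h (hne i)
    · exact fun h => ⟨i, Or.inl ⟨rfl, h⟩⟩
  have hY2 : ∀ i, (A i)ᶜ ∈ Y ↔ v i = false := by
    intro i
    constructor
    · rintro ⟨j, ⟨h, hj⟩ | ⟨h, hj⟩⟩
      · have := hA.eq_of_eq i j (Or.inr (by rw [← h, compl_compl]))
        subst this
        exact absurd h.symm (hne i)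
      · rwa [hA.eq_of_eq i j (Or.inl (compl_injective h))]
    · exact fun h => ⟨i, Or.inr ⟨rfl, h⟩⟩
  obtain ⟨x, hx, hxs, hxi⟩ := hH.exists_inverted (hX.shiftInvariant hf) hw (Y := Y) (by
    intro B hB
    obtain ⟨i, rfl | rfl⟩ := hA.exists_eq B hB
    · rw [hY1, hY2]; simp
    · rw [compl_compl, hY1, hY2]; simp)
  exact ⟨x, hx, hxs, fun i => by rw [hxi _ (hA.mem i), hY1]⟩

end CubeComplex

/-! ### Median sets of elliptic and loxodromic isometries -/

theorem zpow_apply_mem_iff {V : Type*} {f : Equiv.Perm V} {C : Set V}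
    (h : ∀ x, f x ∈ C ↔ x ∈ C) (n : ℤ) (x : V) : (f ^ n) x ∈ C ↔ x ∈ C := by
  have key : ∀ (n : ℕ) (x : V), (f ^ (n : ℤ)) x ∈ C ↔ x ∈ C := by
    intro n
    induction n with
    | zero => simp
    | succ n ih =>
      intro x
      rw [Nat.cast_succ, zpow_add_one_apply, ih, h]
  obtain ⟨m, rfl | rfl⟩ := n.eq_nat_or_neg
  · exact key m x
  · rw [← key m, zpow_neg_mul_apply]

theorem image_eq_self_iff {V : Type*} {f : Equiv.Perm V} {C : Set V} :
    f '' C = C ↔ ∀ x, f x ∈ C ↔ x ∈ C := by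
  constructor
  · intro h x
    conv_lhs => rw [← h]
    exact f.injective.mem_set_image
  · intro h
    ext x
    constructor
    · rintro ⟨y, hy, rfl⟩
      exact (h y).2 hy
    · intro hx
      refine ⟨f.symm x, (h _).1 ?_, f.apply_symm_apply x⟩
      rwa [f.apply_symm_apply]

theorem zpow_apply_of_translation {W : Type*} {f : Equiv.Perm W} {γ : ℤ → W} {l : ℤ}
    (h : ∀ n, f (γ n) = γ (n + l)) (k n : ℤ) : (f ^ k) (γ n) = γ (n + k * l) := by
  have key : ∀ (k : ℕ) (n : ℤ), (f ^ (k : ℤ)) (γ n) = γ (n + k * l) := by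
    intro k
    induction k with
    | zero => simp
    | succ k ih =>
      intro n
      rw [Nat.cast_succ, zpow_add_one_apply, h, ih]
      congr 1; ring
  obtain ⟨m, rfl | rfl⟩ := k.eq_nat_or_neg
  · exact key m n
  · have h1 := key m (n + -m * l)
    rw [show n + -(m : ℤ) * l + m * l = n by ring] at h1
    rw [← h1, ← zpow_add_apply]
    simp

/-- The iterates of a point of an axis are aligned. -/
theorem IsAxis.dist_add {W : Type*} {Γ : SimpleGraph W} {f : Equiv.Perm W} {γ : ℤ → W}
    (h : IsAxis Γ f γ) (n : ℤ) {a b c : ℤ} (hab : a ≤ b) (hbc : b ≤ c) :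
    Γ.dist ((f ^ a) (γ n)) ((f ^ c) (γ n)) =
      Γ.dist ((f ^ a) (γ n)) ((f ^ b) (γ n)) + Γ.dist ((f ^ b) (γ n)) ((f ^ c) (γ n)) := by
  obtain ⟨hγ, l, hl, -, hf⟩ := h
  simp only [zpow_apply_of_translation hf, hγ _ _]
  have h1 : a * (l : ℤ) ≤ b * l := mul_le_mul_of_nonneg_right hab (by positivity)
  have h2 : b * (l : ℤ) ≤ c * l := mul_le_mul_of_nonneg_right hbc (by positivity)
  omega

theorem IsAxis.dist_zpow {W : Type*} {Γ : SimpleGraph W} {f : Equiv.Perm W} {γ : ℤ → W}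
    (h : IsAxis Γ f γ) (n : ℤ) : ∃ l : ℕ, 0 < l ∧ ∀ k : ℕ,
      Γ.dist (γ n) ((f ^ (k : ℤ)) (γ n)) = k * l := by
  obtain ⟨hγ, l, hl, -, hf⟩ := h
  refine ⟨l, hl, fun k => ?_⟩
  rw [zpow_apply_of_translation hf, hγ, sub_add_cancel_left, Int.natAbs_neg, Int.natAbs_mul]
  simp

namespace CubeComplex

variable {V : Type*} {X : CubeComplex V} (hX : X.IsCAT0) {f : Equiv.Perm V}
  (hf : ∀ x y, X.graph.Adj (f x) (f y) ↔ X.graph.Adj x y)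

include hX

include hf in
-- The displacement of the `k`-th power is `k` times this number up to a constant, so orbits are
-- bounded exactly when it vanishes.
theorem IsCAT0.isElliptic_iff {w : V} (hw : w ∈ medSet X.allHalfspaces f) :
    X.IsElliptic f ↔ (sep (stableHalfspaces X.allHalfspaces f) w (f w)).ncard = 0 := by
  have hH := hX.isMedianWallspace
  have hs := hX.shiftInvariant hf
  constructor
  · intro h
    obtain ⟨N, hN⟩ := h w
    obtain ⟨C, hC⟩ := hH.exists_displacement_bound hs hw w
    by_contra hne
    have h1 := (hC (N + C + 1)).2
    have h2 := hN ((N + C + 1 : ℕ) : ℤ)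
    have h3 := Nat.mul_le_mul_left (N + C + 1) (Nat.pos_of_ne_zero hne)
    omega
  · intro h x
    obtain ⟨C, hC⟩ := hH.exists_displacement_bound hs hw x
    refine ⟨C, fun n => ?_⟩
    have h1 : ∀ k : ℕ, X.graph.dist x ((f ^ (k : ℤ)) x) ≤ C := by
      intro k
      have := (hC k).1
      rw [h] at this
      omega
    obtain ⟨m, rfl | rfl⟩ := n.eq_nat_or_neg
    · exact h1 m
    · rw [← hH.dist_zpow_apply hs m, zpow_neg_mul_apply, SimpleGraph.dist_comm]
      exact h1 m

include hf in
/-- The points of the median set with the same stable halfspaces as a given one form a cube. -/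
theorem IsCAT0.medFibre_mem_cubes {w : V} (hw : w ∈ medSet X.allHalfspaces f) :
    {x | ∀ B ∈ stableHalfspaces X.allHalfspaces f, w ∈ B ↔ x ∈ B} ∈ X.cubes ∧
      X.HasDim {x | ∀ B ∈ stableHalfspaces X.allHalfspaces f, w ∈ B ↔ x ∈ B}
        (X.invertedHyperplanes f).ncard := by
  obtain ⟨A, hA⟩ := hX.exists_wallEnum hf
  refine hX.fibre_mem_cubes (fun B hB => hB.1) hX.isMedianWallspace.complClosed_inverted hA w
    fun v => ?_
  obtain ⟨x, -, hx⟩ := hX.exists_mem_medSet_of_wallEnum hf hA hw v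
  exact ⟨x, hx⟩

include hf in
theorem IsCAT0.image_medFibre {w : V}
    (hw : (sep (stableHalfspaces X.allHalfspaces f) w (f w)).ncard = 0) :
    f '' {x | ∀ B ∈ stableHalfspaces X.allHalfspaces f, w ∈ B ↔ x ∈ B} =
      {x | ∀ B ∈ stableHalfspaces X.allHalfspaces f, w ∈ B ↔ x ∈ B} := by
  have hH := hX.isMedianWallspace
  have hst := IsMedianWallspace.shiftInvariant_stable (hX.shiftInvariant hf)
  rw [Set.ncard_eq_zero (hH.finite_sep_of_subset (fun B hB => hB.1) _ _)] at hw
  have hw' := fun B hB => (hH.complClosed_stable (f := f)).mem_iff_of_sep_eq_empty hw (A := B) hB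
  refine image_eq_self_iff.2 fun x => ⟨fun hx B hB => ?_, fun hx B hB => ?_⟩
  · have h1 := hst (-1) B hB
    have h2 := hx _ h1
    have h3 := hw' _ h1
    have h4 : ∀ y, (f ^ (-1 : ℤ)) (f y) = y := fun y => by rw [← zpow_add_one_apply]; simp
    rw [mem_shift, mem_shift, h4] at h2 h3
    rw [← h2, h3]
  · have h1 := hst 1 B hB
    have h2 := hx _ h1
    simp only [mem_shift, zpow_one] at h2
    rw [hw' B hB, h2]

include hf in
/-- The hyperplanes inverted by powers of `f` cross all the cubes stabilised by `f`. -/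
theorem IsCAT0.ncard_invertedHyperplanes_le {C : Set V} (hC : C ∈ X.cubes) {n : ℕ}
    (hn : X.HasDim C n) (hfC : f '' C = C) : (X.invertedHyperplanes f).ncard ≤ n ∧
      ((X.invertedHyperplanes f).ncard = n → C ⊆ medSet X.allHalfspaces f) := by
  obtain ⟨e⟩ := hn
  have hH := hX.isMedianWallspace
  have hfC' := zpow_apply_mem_iff (image_eq_self_iff.1 hfC)
  obtain ⟨A, hA⟩ := hX.exists_wallEnum hf
  obtain ⟨B, hB, heB, hsep⟩ := hX.exists_cube_walls hC e
  -- A stabilised cube contains whole orbits, hence points on both sides of each inverted wall,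
  -- which must be one of its directions.
  have hκ : ∀ i, ∃ j, A i = B j ∨ A i = (B j)ᶜ := by
    intro i
    obtain ⟨m, hm⟩ := (hA.mem i).2
    let x : V := e fun _ => false
    have hxC : x ∈ C := (e fun _ => false).2
    have key : ∃ y ∈ C, ∃ y' ∈ C, y ∈ A i ∧ y' ∉ A i := by
      have h1 : (f ^ m) x ∈ A i ↔ x ∉ A i := by rw [← mem_shift, hm]; rfl
      by_cases hx : x ∈ A i
      · exact ⟨x, hxC, _, (hfC' m x).2 hxC, hx, fun h => h1.1 h hx⟩
      · exact ⟨_, (hfC' m x).2 hxC, x, hxC, h1.2 hx, hx⟩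
    obtain ⟨y, hy, y', hy', h1, h2⟩ := key
    obtain ⟨u, hu⟩ := e.surjective ⟨y, hy⟩
    obtain ⟨u', hu'⟩ := e.surjective ⟨y', hy'⟩
    obtain ⟨j, -, hj⟩ := hsep (A i) (hA.mem i).1 u u' (by rw [hu]; exact h1) (by rw [hu']; exact h2)
    exact ⟨j, hj⟩
  choose κ hκ using hκ
  have hinj : Function.Injective κ := by
    intro i i' h
    apply hA.eq_of_eq
    rcases hκ i with h1 | h1 <;> rcases hκ i' with h2 | h2 <;> rw [h1, h2, h]
    · exact Or.inl rfl
    · exact Or.inr (by rw [compl_compl])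
    · exact Or.inr rfl
    · exact Or.inl rfl
  refine ⟨by simpa using Fintype.card_le_of_injective κ hinj, fun hdn => ?_⟩
  -- In the case of equality all the directions are inverted, so no stable halfspace separates two
  -- vertices of the cube.
  have hsurj : Function.Surjective κ :=
    ((Fintype.bijective_iff_injective_and_card κ).2 ⟨hinj, by simpa using hdn⟩).2
  have hcc := hH.complClosed_inverted (f := f)
  have hconst : ∀ D ∈ stableHalfspaces X.allHalfspaces f, ∀ x ∈ C, ∀ y ∈ C, x ∈ D → y ∈ D := by
    intro D hD x hx y hy hxD
    by_contra hyD
    obtain ⟨u, hu⟩ := e.surjective ⟨x, hx⟩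
    obtain ⟨u', hu'⟩ := e.surjective ⟨y, hy⟩
    obtain ⟨j, -, hj⟩ := hsep D hD.1 u u' (by rw [hu]; exact hxD) (by rw [hu']; exact hyD)
    obtain ⟨i, rfl⟩ := hsurj j
    have : D = A i ∨ D = (A i)ᶜ := by
      rcases hj with h1 | h1 <;> rcases hκ i with h2 | h2 <;> rw [h1, h2]
      · exact Or.inl rfl
      · exact Or.inr (by rw [compl_compl])
      · exact Or.inr rfl
      · exact Or.inl rfl
    rcases this with rfl | rfl
    · exact hD.2 (hA.mem i)
    · exact hD.2 (hcc _ (hA.mem i))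
  intro x hx D hD a b c _ _ ha _
  exact hconst D hD _ ((hfC' a x).2 hx) _ ((hfC' b x).2 hx) ha

include hf in
-- In the elliptic case `f` does not change the stable sides of points of the median set, so it
-- stabilises the cubes of `medFibre_mem_cubes`; these attain the lower bound.
theorem IsCAT0.isLeast_stableCubeDims (hell : X.IsElliptic f) :
    IsLeast (X.stableCubeDims f) (X.invertedHyperplanes f).ncard := by
  obtain ⟨w, hw⟩ := hX.isMedianWallspace.medSet_nonempty (hX.shiftInvariant hf)
  refine ⟨⟨_, (hX.medFibre_mem_cubes hf hw).1, (hX.medFibre_mem_cubes hf hw).2,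
    hX.image_medFibre hf ((hX.isElliptic_iff hf hw).1 hell)⟩, ?_⟩
  rintro n ⟨C, hC, hn, hfC⟩
  exact (hX.ncard_invertedHyperplanes_le hf hC hn hfC).1

include hf in
theorem IsCAT0.minimalStableCubes_eq (hell : X.IsElliptic f) :
    X.minimalStableCubes f = medSet X.allHalfspaces f := by
  have hleast := hX.isLeast_stableCubeDims hf hell
  ext x
  constructor
  · rintro ⟨C, hC, n, hn, hfC, hl, hx⟩
    exact (hX.ncard_invertedHyperplanes_le hf hC hn hfC).2 (hleast.unique hl) hx
  · intro hx
    exact ⟨_, (hX.medFibre_mem_cubes hf hx).1, _, (hX.medFibre_mem_cubes hf hx).2,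
      hX.image_medFibre hf ((hX.isElliptic_iff hf hx).1 hell), hleast, fun _ _ => Iff.rfl⟩

omit hX in
theorem not_isElliptic_of_isLoxodromic (hlox : X.IsLoxodromic f) : ¬ X.IsElliptic f := by
  intro hell
  obtain ⟨γ, hγ⟩ := hlox
  obtain ⟨l, hl, h⟩ := hγ.dist_zpow 0
  obtain ⟨N, hN⟩ := hell (γ 0)
  have h1 := hN ((N + 1 : ℕ) : ℤ)
  rw [h] at h1
  have h2 := Nat.mul_le_mul_left (N + 1) (Nat.succ_le_of_lt hl)
  omega

/-- If the `m`-th power swaps the two sides of a wall, a point of the axis and its image under the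
square of this power are on one side while the intermediate image is on the other; but these three
points are aligned. -/
theorem IsCAT0.invertedHalfspaces_eq_empty (hlox : X.IsLoxodromic f) :
    invertedHalfspaces X.allHalfspaces f = ∅ := by
  have hH := hX.isMedianWallspace
  rw [Set.eq_empty_iff_forall_notMem]
  rintro A ⟨hA, n, hn⟩
  obtain ⟨γ, hγ⟩ := hlox
  have h0 : ∃ m : ℕ, shift f m A = Aᶜ := exists_nat_shift_eq_compl hn
  obtain ⟨m, hm⟩ := h0
  have hswap : ∀ x, (f ^ (m : ℤ)) x ∈ A ↔ x ∉ A := fun x => by rw [← mem_shift, hm]; rfl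
  have hswap2 : ∀ x, (f ^ ((m : ℤ) + m)) x ∈ A ↔ x ∈ A := fun x => by
    rw [zpow_add_apply, hswap, hswap, not_not]
  have hal := hH.dist_add_iff.1 (hγ.dist_add 0 (a := 0) (b := m) (c := m + m) (by omega) (by omega))
  have h1 := hal A hA
  have h2 := hal Aᶜ (hH.compl_mem A hA)
  simp only [zpow_zero, Equiv.Perm.one_apply, Set.mem_compl_iff, hswap, hswap2] at h1 h2
  tauto

include hf in
-- Without inverted walls the distance counts stable halfspaces, so the displacements of the powers
-- of `f` at `x` are additive.
theorem IsCAT0.exists_isAxis_of_mem (hinv : invertedHalfspaces X.allHalfspaces f = ∅)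
    (hell : ¬ X.IsElliptic f) {x : V} (hx : x ∈ medSet X.allHalfspaces f) :
    ∃ γ : ℤ → V, IsAxis X.graph f γ ∧ γ 0 = x := by
  have hH := hX.isMedianWallspace
  have hs := hX.shiftInvariant hf
  have hl := mt (hX.isElliptic_iff hf hx).2 hell
  refine exists_isAxis hH.connected (fun x y => by simpa using hH.dist_zpow_apply hs 1 x y)
    (Nat.pos_of_ne_zero hl) fun k => ?_
  rw [hH.dist_eq_add (f := f), hH.ncard_sep_stable_zpow hs hx, hinv]
  simp [sep]

include hf in
theorem IsCAT0.isLoxodromic_of_empty (hinv : invertedHalfspaces X.allHalfspaces f = ∅)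
    (hell : ¬ X.IsElliptic f) : X.IsLoxodromic f := by
  obtain ⟨w, hw⟩ := hX.isMedianWallspace.medSet_nonempty (hX.shiftInvariant hf)
  obtain ⟨γ, hγ, -⟩ := hX.exists_isAxis_of_mem hf hinv hell hw
  exact ⟨γ, hγ⟩

include hf in
theorem IsCAT0.unionOfAxes_eq (hlox : X.IsLoxodromic f) :
    X.unionOfAxes f = medSet X.allHalfspaces f := by
  have hH := hX.isMedianWallspace
  ext x
  constructor
  · rintro ⟨γ, hγ, n, rfl⟩
    intro A hA a b c hab hbc ha hc
    exact hH.dist_add_iff.1 (hγ.dist_add n hab hbc) A hA.1 ha hc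
  · intro hx
    obtain ⟨γ, hγ, h0⟩ := hX.exists_isAxis_of_mem hf (hX.invertedHalfspaces_eq_empty hlox)
      (not_isElliptic_of_isLoxodromic hlox) hx
    exact ⟨γ, hγ, 0, h0⟩

end CubeComplex

/-! ### Cubical quotients -/

namespace IsMedianWallspace

variable {V : Type*} {Γ : SimpleGraph V} {H : Set (Set V)} (hH : IsMedianWallspace Γ H)
  {S : Set (Set V)} (hS : S ⊆ H) (hc : ComplClosed S)

include hH hS hc

/-- The point `z` follows the first edge, on a geodesic from `x` to `y`, that crosses a wall of `S`.
-/
theorem exists_sep_eq_one {x y : V} (hxy : (sep S x y).Nonempty) :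
    ∃ z, (sep S x z).ncard = 1 ∧ ∀ B ∈ H, x ∈ B → y ∈ B → z ∈ B := by
  have key : ∀ n, ∀ x, Γ.dist x y = n → (sep S x y).Nonempty →
      ∃ z, (sep S x z).ncard = 1 ∧ ∀ B ∈ H, x ∈ B → y ∈ B → z ∈ B := by
    intro n
    induction n using Nat.strong_induction_on with
    | _ n ih =>
    intro x hn hxy
    have hne : y ≠ x := by
      rintro rfl
      rw [sep_self] at hxy
      exact Set.not_nonempty_empty hxy
    obtain ⟨x', hadj, hd⟩ := hH.connected.exists_adj_closer hne
    have hbet := (hH.dist_add_iff (x := x) (y := y) (m := x')).1 (by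
      rw [SimpleGraph.dist_eq_one_iff_adj.2 hadj.symm, Γ.dist_comm, hd, Γ.dist_comm (u := y),
        add_comm])
    obtain ⟨A, hA⟩ := hH.sep_of_adj hadj.symm
    by_cases hAS : A ∈ S
    · refine ⟨x', ?_, hbet⟩
      have : sep S x x' = {A} := by
        have h : A ∈ sep H x x' := hA ▸ rfl
        exact Set.Subset.antisymm (hA ▸ sep_mono hS x x') (Set.singleton_subset_iff.2 ⟨hAS, h.2⟩)
      rw [this, Set.ncard_singleton]
    · have h0 : sep S x x' = ∅ := by
        refine Set.eq_empty_of_forall_notMem fun B hB => hAS ?_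
        have h : B ∈ sep H x x' := sep_mono hS x x' hB
        rw [hA] at h
        exact h ▸ hB.1
      have h1 := fun B hB => hc.mem_iff_of_sep_eq_empty h0 (A := B) hB
      have h2 : ∀ z, sep S x z = sep S x' z := by
        intro z
        ext B
        rw [mem_sep, mem_sep]
        exact and_congr_right fun hB => by rw [h1 B hB]
      have hlt : Γ.dist x' y < n := by
        rw [← hn, Γ.dist_comm, Γ.dist_comm (u := x) (v := y)]; omega
      obtain ⟨z, hz, hzb⟩ := ih _ hlt x' rfl (h2 y ▸ hxy)
      exact ⟨z, by rw [h2, hz], fun B hB hx hy => hzb B hB (hbet B hB hx hy) hy⟩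
  exact key _ x rfl hxy

omit hH hS in
/-- The vertex of the cubulation defined by a point. -/
def toCubulation (hc : ComplClosed S) (x : V) : CubulationVertex S :=
  ⟨principalOrientation S x, ⟨fun _ h => h.1, fun A hA => by
    have := hc A hA
    by_cases hx : x ∈ A
    · exact Or.inl ⟨⟨hA, hx⟩, fun h => h.2 hx⟩
    · exact Or.inr ⟨⟨this, hx⟩, fun h => hx h.2⟩,
    fun _ _ _ hB hAB h => ⟨hB, hAB h.2⟩⟩, x, by simp⟩

/-- Every vertex of the quotient is principal, so the quotient consists of the vertices of the
complex up to having the same sides in `S`. -/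
theorem exists_toCubulation (σ : CubulationVertex S) : ∃ x, σ = toCubulation hc x := by
  obtain ⟨σ, ⟨hσS, hxor, hup⟩, x, hx⟩ := σ
  obtain ⟨v, hv⟩ := hH.exists_of_orientation hS hc hσS (x := x)
    (fun A hA => by
      have := hxor A hA
      rw [xor_iff_not_iff] at this
      tauto)
    (fun A hA B hB hAB => hup A (hσS hA) B hB hAB hA)
    (hx.subset fun A hA => Or.inl ⟨hA.1, fun h => hA.2 h.2⟩)
  refine ⟨v, Subtype.ext ?_⟩
  ext A
  change A ∈ σ ↔ A ∈ S ∧ v ∈ A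
  constructor
  · exact fun h => ⟨hσS h, (hv A (hσS h)).2 h⟩
  · exact fun h => (hv A h.1).1 h.2

omit hH hS in
theorem toCubulation_sdiff (x y : V) :
    (toCubulation hc x).1 \ (toCubulation hc y).1 = sep S x y := by
  ext A
  change ((A ∈ S ∧ x ∈ A) ∧ ¬ (A ∈ S ∧ y ∈ A)) ↔ (A ∈ S ∧ x ∈ A ∧ y ∉ A)
  tauto

theorem reachable_and_dist_toCubulation (x y : V) :
    (cubulationGraph S).Reachable (toCubulation hc x) (toCubulation hc y) ∧
      (cubulationGraph S).dist (toCubulation hc x) (toCubulation hc y) = (sep S x y).ncard := by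
  have hfin := hH.finite_sep_of_subset hS
  have hrep := hH.exists_toCubulation hS hc
  have := dist_eq_of_steps (Γ := cubulationGraph S) (fun σ τ => (σ.1 \ τ.1).ncard) ?_ ?_ ?_ ?_
    (toCubulation hc x) (toCubulation hc y)
  · rwa [toCubulation_sdiff] at this
  · intro σ τ
    obtain ⟨x, rfl⟩ := hrep σ
    obtain ⟨y, rfl⟩ := hrep τ
    -- Each separating wall contributes both of its halfspaces, whence the value two for adjacency.
    change (symmDiff (toCubulation hc x).1 (toCubulation hc y).1).ncard = 2 ↔ _
    rw [Set.symmDiff_def, toCubulation_sdiff, toCubulation_sdiff, Set.ncard_union_eq _ (hfin _ _)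
      (hfin _ _), hc.ncard_sep_comm y x]
    · omega
    · rw [Set.disjoint_left]
      exact fun A h h' => h.2.2 h'.2.1
  · simp
  · intro σ τ ρ
    obtain ⟨x, rfl⟩ := hrep σ
    obtain ⟨y, rfl⟩ := hrep τ
    obtain ⟨z, rfl⟩ := hrep ρ
    simp only [toCubulation_sdiff]
    exact ncard_sep_triangle hfin x y z
  · intro σ τ hne
    obtain ⟨x, rfl⟩ := hrep σ
    obtain ⟨y, rfl⟩ := hrep τ
    have hsep : (sep S x y).Nonempty := by
      rw [Set.nonempty_iff_ne_empty]
      intro h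
      refine hne (Subtype.ext (Set.ext fun A => and_congr_right fun hA => ?_))
      exact hc.mem_iff_of_sep_eq_empty h hA
    obtain ⟨z, hz, hzb⟩ := hH.exists_sep_eq_one hS hc hsep
    refine ⟨toCubulation hc z, ?_⟩
    simp only [toCubulation_sdiff]
    refine ⟨hz, ?_⟩
    rw [hc.ncard_sep_add hfin fun A hA => hzb A (hS hA), hz, add_comm]

theorem connected_cubulationGraph : (cubulationGraph S).Connected := by
  obtain ⟨x⟩ := hH.connected.nonempty
  have : Nonempty (CubulationVertex S) := ⟨toCubulation hc x⟩
  refine ⟨fun σ τ => ?_⟩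
  obtain ⟨x, rfl⟩ := hH.exists_toCubulation hS hc σ
  obtain ⟨y, rfl⟩ := hH.exists_toCubulation hS hc τ
  exact (hH.reachable_and_dist_toCubulation hS hc x y).1

omit hS hc in
theorem mem_of_ncard_sep_add (hS : S ⊆ H) {x y m : V}
    (h : (sep S x y).ncard = (sep S x m).ncard + (sep S m y).ncard) {A : Set V} (hA : A ∈ S)
    (hx : x ∈ A) (hy : y ∈ A) : m ∈ A := by
  have hfin := hH.finite_sep_of_subset hS
  by_contra hm
  have hsub : insert A (sep S x y) ⊆ sep S x m ∪ sep S m y :=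
    Set.insert_subset (Or.inl ⟨hA, hx, hm⟩) (sep_subset_union _ _ _ _)
  have := Set.ncard_le_ncard hsub ((hfin _ _).union (hfin _ _))
  rw [Set.ncard_insert_of_notMem (fun h => h.2.2 hy) (hfin _ _)] at this
  have := Set.ncard_union_le (sep S x m) (sep S m y)
  omega

/-- The automorphism of the cubulation induced by an automorphism preserving its walls. -/
theorem exists_cubulation_perm {f : Equiv.Perm V} (hf : ShiftInvariant f S) :
    ∃ φ : Equiv.Perm (CubulationVertex S),
      (∀ x, φ (toCubulation hc x) = toCubulation hc (f x)) ∧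
      ∀ σ, (φ σ).1 = (fun D : Set V => f '' D) '' σ.1 := by
  have himage : ∀ D : Set V, f '' D = shift f (-1) D := by
    intro D
    ext x
    rw [mem_shift]
    constructor
    · rintro ⟨y, hy, rfl⟩
      rw [← zpow_add_one_apply]
      simpa using hy
    · intro hx
      exact ⟨_, hx, zpow_neg_mul_apply (f := f) (n := 1) x⟩
  -- This makes the induced map independent of the representatives chosen below.
  have hcongr : ∀ (n : ℤ) x y, toCubulation hc x = toCubulation hc y →
      toCubulation hc ((f ^ n) x) = toCubulation hc ((f ^ n) y) := by
    intro n x y h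
    have h' := Set.ext_iff.1 (congrArg Subtype.val h)
    refine Subtype.ext (Set.ext fun A => and_congr_right fun hA => ?_)
    have := h' (shift f n A)
    change (_ ∧ (f ^ n) x ∈ A ↔ _ ∧ (f ^ n) y ∈ A) at this
    have := hf n A hA
    tauto
  choose rep hrep using hH.exists_toCubulation hS hc
  have hrep' : ∀ (n : ℤ) x, toCubulation hc ((f ^ n) (rep (toCubulation hc x))) =
      toCubulation hc ((f ^ n) x) := fun n x => hcongr n _ _ (hrep _).symm
  let φ : ℤ → CubulationVertex S → CubulationVertex S := fun n σ => toCubulation hc ((f ^ n) (rep σ))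
  have hφ : ∀ n σ, φ (-n) (φ n σ) = σ := by
    intro n σ
    simp only [φ]
    rw [hrep', ← zpow_add_apply, neg_add_cancel, zpow_zero, Equiv.Perm.one_apply, ← hrep]
  have hφx : ∀ x, φ 1 (toCubulation hc x) = toCubulation hc (f x) := fun x => hrep' 1 x
  refine ⟨⟨φ 1, φ (-1), hφ 1, fun σ => by simpa using hφ (-1) σ⟩, hφx, fun σ => ?_⟩
  obtain ⟨x, rfl⟩ := hH.exists_toCubulation hS hc σ
  change (φ 1 _).1 = _
  rw [hφx]
  ext A
  constructor
  · rintro ⟨hA, hx⟩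
    refine ⟨shift f 1 A, ⟨hf 1 A hA, by simpa [mem_shift] using hx⟩, ?_⟩
    change f '' _ = A
    rw [himage, shift_neg_shift]
  · rintro ⟨D, ⟨hD, hx⟩, rfl⟩
    refine ⟨?_, Set.mem_image_of_mem f hx⟩
    change f '' D ∈ S
    rw [himage]
    exact hf _ D hD

end IsMedianWallspace

namespace CubeComplex

variable {V : Type*} {X : CubeComplex V} (hX : X.IsCAT0) {f : Equiv.Perm V}
  (hf : ∀ x y, X.graph.Adj (f x) (f y) ↔ X.graph.Adj x y)

include hX hf

open IsMedianWallspace in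
-- The quotient metric counts stable halfspaces only, so alignment of an orbit in the quotient is
-- the condition defining `medSet`.
theorem IsCAT0.quotientAxes_eq (hell : ¬ X.IsElliptic f) :
    X.quotientAxes f = medSet X.allHalfspaces f := by
  have hH := hX.isMedianWallspace
  have hs := hX.shiftInvariant hf
  have hS : stableHalfspaces X.allHalfspaces f ⊆ X.allHalfspaces := fun B hB => hB.1
  have hc := hH.complClosed_stable (f := f)
  obtain ⟨φ, hφ, hφi⟩ := hH.exists_cubulation_perm hS hc (shiftInvariant_stable hs)
  have hφk : ∀ (k : ℤ) x, (φ ^ k) (toCubulation hc x) = toCubulation hc ((f ^ k) x) := by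
    have key : ∀ (k : ℕ) x, (φ ^ (k : ℤ)) (toCubulation hc x) =
        toCubulation hc ((f ^ (k : ℤ)) x) := by
      intro k
      induction k with
      | zero => simp
      | succ k ih =>
        intro x
        rw [Nat.cast_succ, zpow_add_one_apply, zpow_add_one_apply, hφ, ih]
    intro k x
    obtain ⟨m, rfl | rfl⟩ := k.eq_nat_or_neg
    · exact key m x
    · have h := key m ((f ^ (-(m : ℤ))) x)
      rw [zpow_neg_mul_apply] at h
      rw [← h, ← zpow_add_apply]
      simp
  have hdist := fun x y => (hH.reachable_and_dist_toCubulation hS hc x y).2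
  have hmain : ∀ x, (∃ γ : ℤ → CubulationVertex (stableHalfspaces X.allHalfspaces f),
      IsAxis (cubulationGraph _) φ γ ∧ ∃ n, (γ n).1 =
        principalOrientation (stableHalfspaces X.allHalfspaces f) x) ↔
      x ∈ medSet X.allHalfspaces f := by
    intro x
    constructor
    · rintro ⟨γ, hγ, n, hn⟩
      have hn : γ n = toCubulation hc x := Subtype.ext hn
      intro A hA a b c hab hbc ha hc'
      have h := hγ.dist_add n hab hbc
      rw [hn] at h
      simp only [hφk, hdist] at h
      exact hH.mem_of_ncard_sep_add hS h hA ha hc'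
    · intro hx
      have hφd : ∀ σ τ, (cubulationGraph _).dist (φ σ) (φ τ) = (cubulationGraph _).dist σ τ := by
        intro σ τ
        obtain ⟨x, rfl⟩ := hH.exists_toCubulation hS hc σ
        obtain ⟨y, rfl⟩ := hH.exists_toCubulation hS hc τ
        rw [hφ, hφ, hdist, hdist]
        simpa using (shiftInvariant_stable hs).ncard_sep_apply 1 x y
      obtain ⟨γ, hγ, h0⟩ := exists_isAxis (hH.connected_cubulationGraph hS hc) hφd
        (x := toCubulation hc x) (Nat.pos_of_ne_zero (mt (hX.isElliptic_iff hf hx).2 hell))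
        fun k => by rw [hφk, hdist, hH.ncard_sep_stable_zpow hs hx]
      exact ⟨γ, hγ, 0, by rw [h0]; rfl⟩
  -- The set of walls is generalised so that the equality can be substituted in the type of vertices
  -- of the quotient.
  have hquot : ∀ (T : Set (Set V)), T = stableHalfspaces X.allHalfspaces f → ∀ x,
      (∃ F : CubulationVertex T → CubulationVertex T,
        (∀ σ, (F σ).1 = (fun D : Set V => f '' D) '' σ.1) ∧
        ∃ γ : ℤ → CubulationVertex T, IsAxis (cubulationGraph T) F γ ∧
          ∃ n : ℤ, (γ n).1 = principalOrientation T x) ↔ x ∈ medSet X.allHalfspaces f := by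
    rintro _ rfl x
    rw [← hmain]
    constructor
    · rintro ⟨F, hF, h⟩
      have : F = φ := funext fun σ => Subtype.ext (by rw [hF, hφi])
      rwa [this] at h
    · exact fun h => ⟨φ, hφi, h⟩
  ext x
  exact hquot _ (hX.quotientHalfspaces_eq hf) x

/-- The three cases are exclusive and exhaustive: a loxodromic isometry inverts no wall, and a
non-elliptic one that inverts no wall is loxodromic. -/
theorem IsCAT0.med_eq : X.Med f = medSet X.allHalfspaces f := by
  have hinv : (X.invertedHyperplanes f).Nonempty ↔
      (invertedHalfspaces X.allHalfspaces f).Nonempty := by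
    rw [hX.invertedHyperplanes_eq hf, Set.image_nonempty]
  ext x
  by_cases hell : X.IsElliptic f
  · have h1 : ¬ X.IsLoxodromic f := fun h => not_isElliptic_of_isLoxodromic h hell
    rw [← hX.minimalStableCubes_eq hf hell]
    exact ⟨fun h => h.elim And.right fun h => h.elim (fun h => absurd h.1 h1)
      fun h => absurd hell h.1.1, fun h => Or.inl ⟨hell, h⟩⟩
  · by_cases hlox : X.IsLoxodromic f
    · have h1 : ¬ X.IsInverting f := fun h => by
        have := hinv.1 h.2
        rw [hX.invertedHalfspaces_eq_empty hlox] at this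
        exact Set.not_nonempty_empty this
      rw [← hX.unionOfAxes_eq hf hlox]
      exact ⟨fun h => h.elim (fun h => absurd h.1 hell) fun h => h.elim And.right
        fun h => absurd h.1 h1, fun h => Or.inr (Or.inl ⟨hlox, h⟩)⟩
    · have h1 : X.IsInverting f := by
        refine ⟨hell, hinv.2 ?_⟩
        rw [Set.nonempty_iff_ne_empty]
        exact fun h => hlox (hX.isLoxodromic_of_empty hf h hell)
      rw [← hX.quotientAxes_eq hf hell]
      exact ⟨fun h => h.elim (fun h => absurd h.1 hell) fun h => h.elim
        (fun h => absurd h.1 hlox) And.right, fun h => Or.inr (Or.inr ⟨h1, h⟩)⟩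

end CubeComplex

/-! ### The decomposition of the median set -/

namespace TraceSpace

variable {V : Type*} {𝓐 : Set (Set V)} {M : Set V}

theorem smul_mk {G : Type*} [Group G] [MulAction G V] (hM : ∀ (h : G), ∀ x ∈ M, h • x ∈ M)
    (h𝓐 : ∀ (h : G), ∀ A ∈ 𝓐, (fun x => h • x) ⁻¹' A ∈ 𝓐) (h : G) {x : V} (hx : x ∈ M) :
    letI := mulAction hM h𝓐
    h • (mk x hx : TraceSpace 𝓐 M) = mk (h • x) (hM h x hx) := by
  refine Subtype.ext (Set.ext fun A => ?_)
  change (_ ∈ 𝓐 ∧ h • x ∈ A) ↔ (A ∈ 𝓐 ∧ h • x ∈ A)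
  refine and_congr_left fun _ => ⟨fun hA => ?_, h𝓐 h A⟩
  have := h𝓐 h⁻¹ _ hA
  rw [← Set.preimage_comp] at this
  convert this using 1
  ext y; simp

end TraceSpace

namespace IsMedianWallspace

variable {V : Type*} {Γ : SimpleGraph V} {H : Set (Set V)} (hH : IsMedianWallspace Γ H)
  {f : Equiv.Perm V} (hf : ShiftInvariant f H)

include hH

theorem med_mk {𝓐 : Set (Set V)} (h𝓐 : 𝓐 ⊆ H) {x y z : V} (hx : x ∈ medSet H f)
    (hy : y ∈ medSet H f) (hz : z ∈ medSet H f) :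
    letI := hH.traceAlgebra hf h𝓐
    MedianAlgebra.med (TraceSpace.mk x hx : TraceSpace 𝓐 (medSet H f)) (TraceSpace.mk y hy)
      (TraceSpace.mk z hz) = TraceSpace.mk (hH.med x y z) (hH.med_mem_medSet hf hx hy hz) := by
  refine Subtype.ext (Set.ext fun A => ?_)
  change A ∈ MedianAlgebra.orientationMed (principalOrientation _ x) (principalOrientation _ y)
    (principalOrientation _ z) ↔ A ∈ principalOrientation _ _
  simp only [MedianAlgebra.orientationMed, Set.mem_union, Set.mem_inter_iff,
    mem_principalOrientation]
  by_cases hA : A ∈ 𝓐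
  · rw [hH.mem_med (h𝓐 hA)]
    simp only [hA, true_and, or_assoc]
  · simp only [hA, false_and, or_self]

theorem isMedianAction {𝓐 : Set (Set V)} (h𝓐 : 𝓐 ⊆ H) {G : Type*} [Group G] [MulAction G V]
    (hM : ∀ (h : G), ∀ x ∈ medSet H f, h • x ∈ medSet H f)
    (hG : ∀ (h : G), ∀ A ∈ 𝓐, (fun x => h • x) ⁻¹' A ∈ 𝓐) :
    letI := hH.traceAlgebra hf h𝓐
    letI := TraceSpace.mulAction hM hG
    MedianAlgebra.IsMedianAction (TraceSpace 𝓐 (medSet H f)) G :=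
  fun _ _ _ _ => rfl

include hf in
theorem axial_nonempty_iff {x : V} (hx : x ∈ medSet H f) : (axialHalfspaces H f).Nonempty ↔
    (sep (stableHalfspaces H f) x (f x)).ncard ≠ 0 := by
  have hs := shiftInvariant_stable hf
  rw [Ne, Set.ncard_eq_zero (hH.finite_sep_of_subset (fun B hB => hB.1) _ _),
    ← Ne, ← Set.nonempty_iff_ne_empty]
  constructor
  · rintro ⟨A, hA⟩
    by_contra hemp
    rw [Set.not_nonempty_iff_eq_empty] at hemp
    have h1 : ∀ k : ℤ, (f ^ k) x ∈ A ↔ (f ^ k) (f x) ∈ A := fun k =>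
      hH.complClosed_stable.mem_iff_of_sep_eq_empty hemp (hs k A hA.1)
    obtain ⟨a, b, ha, hb⟩ := hH.axial_crosses hf hA x
    rcases le_total a b with hab | hab
    · obtain ⟨k, -, -, hk⟩ := exists_step_mem (f := f) (x := x) (A := A) hab (by tauto)
      exact hk (h1 k)
    · obtain ⟨k, -, -, hk⟩ := exists_step_mem (f := f) (x := x) (A := A) hab (by tauto)
      exact hk (h1 k)
  · rintro ⟨A, hA, h1, h2⟩
    exact ⟨A, hA, x, hx, 0, 1, by simpa using h1, by simpa using h2⟩

end IsMedianWallspace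

theorem tendsto_div_of_bounded {u : ℕ → ℕ} {l C : ℕ} (h : ∀ n, u n ≤ n * l + C ∧ n * l ≤ u n + C) :
    Tendsto (fun n : ℕ => (u n : ℝ) / n) atTop (𝓝 (l : ℝ)) := by
  have h0 := tendsto_const_div_atTop_nhds_zero_nat (C : ℝ)
  have h1 : Tendsto (fun n : ℕ => (l : ℝ) - C / n) atTop (𝓝 (l : ℝ)) := by
    simpa using tendsto_const_nhds.sub h0
  have h2 : Tendsto (fun n : ℕ => (l : ℝ) + C / n) atTop (𝓝 (l : ℝ)) := by
    simpa using tendsto_const_nhds.add h0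
  refine tendsto_of_tendsto_of_tendsto_of_le_of_le' h1 h2 ?_ ?_
  · filter_upwards [eventually_gt_atTop 0] with n hn
    have hn' : (0 : ℝ) < n := by exact_mod_cast hn
    have h3 : (n * l : ℝ) ≤ u n + C := by exact_mod_cast (h n).2
    rw [sub_le_iff_le_add, ← add_div, le_div_iff₀ hn']
    linarith
  · filter_upwards [eventually_gt_atTop 0] with n hn
    have hn' : (0 : ℝ) < n := by exact_mod_cast hn
    have h3 : (u n : ℝ) ≤ n * l + C := by exact_mod_cast (h n).1
    rw [div_le_iff₀ hn', add_mul, div_mul_cancel₀ _ hn'.ne']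
    linarith

theorem toPerm_zpow_apply {V G : Type*} [Group G] [MulAction G V] (g : G) (n : ℤ) (x : V) :
    ((MulAction.toPerm g : Equiv.Perm V) ^ n) x = g ^ n • x := by
  have := map_zpow (MulAction.toPermHom G V) g n
  exact (congrArg (fun φ : Equiv.Perm V => φ x) this).symm

theorem normalizes_toPerm {V G : Type*} [Group G] [MulAction G V] {g : G}
    (hg : (Subgroup.zpowers g).Normal) (h : G) :
    Normalizes (MulAction.toPerm h : Equiv.Perm V) (MulAction.toPerm g) := by
  -- Normality is applied to `h⁻¹`, which gives `h⁻¹ * g * h` as a power of `g`.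
  obtain ⟨k, hk⟩ := hg.conj_mem g (Subgroup.mem_zpowers g) h⁻¹
  refine ⟨k, fun x => ?_⟩
  rw [toPerm_zpow_apply]
  simp only at hk
  simp only [MulAction.toPerm_apply, smul_smul]
  rw [hk]
  congr 1
  group

namespace CubeComplex

variable {V : Type*} {X : CubeComplex V} (hX : X.IsCAT0) {f : Equiv.Perm V}
  (hf : ∀ x y, X.graph.Adj (f x) (f y) ↔ X.graph.Adj x y)

/-- The coordinates are the sides of the enumerated inverted walls. All of them are realised in the
median set, by `exists_mem_medSet_of_wallEnum`. -/
theorem IsCAT0.isCube_inverted :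
    letI := hX.isMedianWallspace.traceAlgebra (hX.shiftInvariant hf)
      (𝓐 := invertedHalfspaces X.allHalfspaces f) fun _ hA => hA.1
    MedianAlgebra.IsCube (TraceSpace (invertedHalfspaces X.allHalfspaces f)
      (medSet X.allHalfspaces f)) (X.invertedHyperplanes f).ncard := by
  classical
  let := hX.isMedianWallspace.traceAlgebra (hX.shiftInvariant hf)
      (𝓐 := invertedHalfspaces X.allHalfspaces f) fun _ hA => hA.1
  obtain ⟨w, hw⟩ := hX.isMedianWallspace.medSet_nonempty (hX.shiftInvariant hf)
  obtain ⟨A, hA⟩ := hX.exists_wallEnum hf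
  have hmem : ∀ i x (hx : x ∈ medSet X.allHalfspaces f), A i ∈ (TraceSpace.mk x hx :
      TraceSpace (invertedHalfspaces X.allHalfspaces f) (medSet X.allHalfspaces f)).1 ↔ x ∈ A i :=
    fun i x hx => and_iff_right (hA.mem i)
  refine ⟨Equiv.ofBijective (fun σ i => decide (A i ∈ σ.1)) ⟨fun σ τ h => ?_, fun v => ?_⟩,
    fun σ τ ρ => funext fun i => ?_⟩
  · obtain ⟨x, hx, rfl⟩ := σ.exists_mk
    obtain ⟨y, hy, rfl⟩ := τ.exists_mk
    have h' : ∀ i, x ∈ A i ↔ y ∈ A i := by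
      intro i
      have := congrFun h i
      simpa only [decide_eq_decide, hmem] using this
    refine TraceSpace.mk_eq_iff.2 fun B hB => ?_
    obtain ⟨i, rfl | rfl⟩ := hA.exists_eq B hB
    · exact h' i
    · exact not_congr (h' i)
  · obtain ⟨x, hx, -, hxA⟩ := hX.exists_mem_medSet_of_wallEnum hf hA hw v
    refine ⟨TraceSpace.mk x hx, funext fun i => ?_⟩
    rw [Bool.eq_iff_iff, decide_eq_true_iff, hmem, hxA]
  · change decide (A i ∈ MedianAlgebra.orientationMed σ.1 τ.1 ρ.1) =
      ((decide (A i ∈ σ.1) && decide (A i ∈ τ.1)) || (decide (A i ∈ τ.1) && decide (A i ∈ ρ.1)) ||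
        (decide (A i ∈ σ.1) && decide (A i ∈ ρ.1)))
    simp only [MedianAlgebra.orientationMed, Set.mem_union, Set.mem_inter_iff, Bool.decide_or,
      Bool.decide_and]

end CubeComplex

/-! ### The main theorem -/

theorem mainTheorem1 {V : Type u} (X : CubeComplex V) (hX : X.IsCAT0)
    {G : Type v} [Group G] [MulAction G V]
    (hG : ∀ (h : G) (x y : V), X.graph.Adj (h • x) (h • y) ↔ X.graph.Adj x y)
    (g : G) (hg : (Subgroup.zpowers g).Normal) :
    (X.Med (MulAction.toPerm g)).Nonempty ∧
    X.IsMedianSubalgebra (X.Med (MulAction.toPerm g)) ∧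
    (∀ (h : G), ∀ x ∈ X.Med (MulAction.toPerm g), h • x ∈ X.Med (MulAction.toPerm g)) ∧
    ∃ (T F Q : Type u) (_ : MedianAlgebra T) (_ : MedianAlgebra F) (_ : MedianAlgebra Q)
      (_ : MulAction G T) (_ : MulAction G F) (_ : MulAction G Q)
      (Φ : X.Med (MulAction.toPerm g) ≃ T × F × Q),
      -- the bijection `Φ` is an isomorphism of median algebras
      (∀ x y z m : X.Med (MulAction.toPerm g),
        X.IsMedianPoint x y z m ↔ Φ m = MedianAlgebra.med (Φ x) (Φ y) (Φ z)) ∧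
      -- the action of `G` is the product of actions on `T`, `F` and `Q`
      MedianAlgebra.IsMedianAction T G ∧ MedianAlgebra.IsMedianAction F G ∧
      MedianAlgebra.IsMedianAction Q G ∧
      (∀ (h : G) (x : X.Med (MulAction.toPerm g)) (hx : h • (x : V) ∈ X.Med (MulAction.toPerm g)),
        Φ ⟨h • (x : V), hx⟩ = (h • (Φ x).1, h • (Φ x).2.1, h • (Φ x).2.2)) ∧
      -- the factor `T`
      (∀ t : T, g • t = t) ∧
      -- the factor `F`
      (X.IsElliptic (MulAction.toPerm g) → Nonempty F ∧ Subsingleton F) ∧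
      (¬ X.IsElliptic (MulAction.toPerm g) → MedianAlgebra.IsMedianFlat F ∧
        ∃ l : ℕ, 0 < l ∧
          (∀ x : V, Tendsto (fun n : ℕ => (X.graph.dist x (g ^ n • x) : ℝ) / n) atTop (𝓝 (l : ℝ))) ∧
          MedianAlgebra.ActsByTranslations F (fun q => g • q) l) ∧
      -- the factor `Q`
      ∃ d : ℕ, MedianAlgebra.IsCube Q d ∧
        (X.IsLoxodromic (MulAction.toPerm g) → d = 0) ∧
        (X.IsElliptic (MulAction.toPerm g) →
          IsLeast (X.stableCubeDims (MulAction.toPerm g)) d) ∧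
        (¬ X.IsElliptic (MulAction.toPerm g) → ¬ X.IsLoxodromic (MulAction.toPerm g) →
          (X.invertedHyperplanes (MulAction.toPerm g)).encard = d) := by
  classical
  set f : Equiv.Perm V := MulAction.toPerm g with hfdef
  have hadj : ∀ x y, X.graph.Adj (f x) (f y) ↔ X.graph.Adj x y := hG g
  have hH := hX.isMedianWallspace
  have hs := hX.shiftInvariant hadj
  have hpre : ∀ (h : G), ∀ A ∈ X.allHalfspaces,
      (MulAction.toPerm h : Equiv.Perm V) ⁻¹' A ∈ X.allHalfspaces := fun h A hA =>
    hX.preimage_mem_allHalfspaces (f := MulAction.toPerm h) (hG h) hA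
  have hn := fun h : G => normalizes_toPerm (V := V) hg h
  have hinv : ∀ (h : G), ∀ A ∈ invertedHalfspaces X.allHalfspaces f,
      (fun x : V => h • x) ⁻¹' A ∈ invertedHalfspaces X.allHalfspaces f := fun h A hA =>
    (hn h).preimage_mem_inverted (hpre h) hA
  have hax : ∀ (h : G), ∀ A ∈ axialHalfspaces X.allHalfspaces f,
      (fun x : V => h • x) ⁻¹' A ∈ axialHalfspaces X.allHalfspaces f := fun h A hA =>
    (hn h).preimage_mem_axial (hn h⁻¹) (hpre h) (hpre h⁻¹) hA
  have htr : ∀ (h : G), ∀ A ∈ transverseHalfspaces X.allHalfspaces f,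
      (fun x : V => h • x) ⁻¹' A ∈ transverseHalfspaces X.allHalfspaces f := fun h A hA =>
    (hn h).preimage_mem_transverse (hn h⁻¹) (hpre h) (hpre h⁻¹) hA
  have hM : ∀ (h : G), ∀ x ∈ medSet X.allHalfspaces f, h • x ∈ medSet X.allHalfspaces f :=
    fun h x hx => (hn h).apply_mem_medSet (hn h⁻¹) (hpre h) (hpre h⁻¹) hx
  obtain ⟨w, hw⟩ := hH.medSet_nonempty hs
  have hl : ∀ x ∈ medSet X.allHalfspaces f,
      (sep (stableHalfspaces X.allHalfspaces f) x (f x)).ncard =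
        (sep (stableHalfspaces X.allHalfspaces f) w (f w)).ncard :=
    fun x hx => hH.ncard_sep_stable_eq hs hx hw
  have hinvH : invertedHalfspaces X.allHalfspaces f ⊆ X.allHalfspaces := fun _ hA => hA.1
  have haxH : axialHalfspaces X.allHalfspaces f ⊆ X.allHalfspaces := IsMedianWallspace.axial_subset
  have htrH : transverseHalfspaces X.allHalfspaces f ⊆ X.allHalfspaces := fun _ hA => hA.1.1
  rw [hX.med_eq hadj]
  refine ⟨⟨w, hw⟩, fun x hx y hy z hz => ⟨hH.med x y z, hH.med_mem_medSet hs hx hy hz,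
    fun m' => hH.eq_med_iff.symm⟩, hM, ?_⟩
  let Φ : medSet X.allHalfspaces f → TraceSpace (transverseHalfspaces X.allHalfspaces f)
      (medSet X.allHalfspaces f) × TraceSpace (axialHalfspaces X.allHalfspaces f)
      (medSet X.allHalfspaces f) × TraceSpace (invertedHalfspaces X.allHalfspaces f)
      (medSet X.allHalfspaces f) :=
    fun x => (TraceSpace.mk x x.2, TraceSpace.mk x x.2, TraceSpace.mk x x.2)
  have hΦ : Function.Bijective Φ := by
    constructor
    · intro x y h
      simp only [Φ, Prod.mk.injEq, TraceSpace.mk_eq_iff] at h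
      refine Subtype.ext (hH.eq_of_forall fun A hA => ?_)
      by_cases h1 : A ∈ invertedHalfspaces X.allHalfspaces f
      · exact h.2.2 A h1
      by_cases h2 : A ∈ axialHalfspaces X.allHalfspaces f
      · exact h.2.1 A h2
      · exact h.1 A ⟨⟨hA, h1⟩, h2⟩
    · rintro ⟨σ, τ, ρ⟩
      obtain ⟨x, hx, rfl⟩ := σ.exists_mk
      obtain ⟨y, hy, rfl⟩ := τ.exists_mk
      obtain ⟨z, hz, rfl⟩ := ρ.exists_mk
      -- Surjectivity: first glue the transverse sides of `x` to the axial sides of `y`, then impose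
      -- the inverted sides of `z` without changing the stable ones.
      obtain ⟨u, hu, hux, huy⟩ := hH.exists_transverse_axial hs hx hy
      obtain ⟨v, hv, hvu, hvz⟩ := hH.exists_inverted hs hu (Y := {A | z ∈ A})
        fun A _ => (not_not (a := z ∈ A)).symm
      refine ⟨⟨v, hv⟩, Prod.ext ?_ (Prod.ext ?_ ?_)⟩
      · exact (TraceSpace.mk_eq_iff (hx := hv) (hy := hx)).2 fun A hA =>
          (hvu A hA.1).symm.trans (hux A hA)
      · exact (TraceSpace.mk_eq_iff (hx := hv) (hy := hy)).2 fun A hA =>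
          (hvu A hA.1).symm.trans (huy A hA)
      · exact (TraceSpace.mk_eq_iff (hx := hv) (hy := hz)).2 hvz
  refine ⟨_, _, _, hH.traceAlgebra hs htrH, hH.axialAlgebra hs, hH.traceAlgebra hs hinvH,
    TraceSpace.mulAction hM htr, TraceSpace.mulAction hM hax, TraceSpace.mulAction hM hinv,
    Equiv.ofBijective Φ hΦ, ?_, hH.isMedianAction hs htrH hM htr, hH.isMedianAction hs haxH hM hax,
    hH.isMedianAction hs hinvH hM hinv, ?_, ?_, ?_, ?_, (X.invertedHyperplanes f).ncard,
    hX.isCube_inverted hadj, ?_, hX.isLeast_stableCubeDims hadj, ?_⟩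
  · intro x y z m
    let := hH.traceAlgebra hs htrH
    let := hH.axialAlgebra hs
    let := hH.traceAlgebra hs hinvH
    have h1 : MedianAlgebra.med (Φ x) (Φ y) (Φ z) =
        Φ ⟨hH.med x y z, hH.med_mem_medSet hs x.2 y.2 z.2⟩ :=
      Prod.ext (hH.med_mk hs htrH x.2 y.2 z.2)
        (Prod.ext (hH.med_mk hs haxH x.2 y.2 z.2) (hH.med_mk hs hinvH x.2 y.2 z.2))
    change _ ↔ Φ m = MedianAlgebra.med (Φ x) (Φ y) (Φ z)
    rw [h1, hΦ.1.eq_iff, Subtype.ext_iff]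
    exact hH.eq_med_iff.symm
  · intro h x hx
    exact Prod.ext (TraceSpace.smul_mk hM htr h x.2).symm
      (Prod.ext (TraceSpace.smul_mk hM hax h x.2).symm (TraceSpace.smul_mk hM hinv h x.2).symm)
  · intro σ
    obtain ⟨x, hx, rfl⟩ := σ.exists_mk
    rw [TraceSpace.smul_mk hM htr g hx, TraceSpace.mk_eq_iff]
    intro A hA
    have := IsMedianWallspace.transverse_constant hA hx 1
    rwa [zpow_one] at this
  · intro hell
    refine ⟨⟨TraceSpace.mk w hw⟩, ⟨fun σ τ => ?_⟩⟩
    obtain ⟨x, hx, rfl⟩ := σ.exists_mk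
    obtain ⟨y, hy, rfl⟩ := τ.exists_mk
    refine TraceSpace.mk_eq_iff.2 fun A hA => ?_
    -- For an elliptic isometry no halfspace is axial, so all axial traces coincide.
    exact absurd ((hX.isElliptic_iff hadj hw).1 hell) ((hH.axial_nonempty_iff hs hw).1 ⟨A, hA⟩)
  · intro hell
    have hl0 := mt (hX.isElliptic_iff hadj hw).2 hell
    refine ⟨hH.isMedianFlat_axial hs ((hH.axial_nonempty_iff hs hw).2 hl0), _,
      Nat.pos_of_ne_zero hl0, fun x => ?_, ?_⟩
    · obtain ⟨C, hC⟩ := hH.exists_displacement_bound hs hw x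
      refine tendsto_div_of_bounded (C := C) fun n => ?_
      have := hC n
      rwa [hfdef, toPerm_zpow_apply, zpow_natCast] at this
    · let := TraceSpace.mulAction hM hax
      exact hH.actsByTranslations_axial hs (MulAction.toPerm g)
        (fun x hx _ => TraceSpace.smul_mk hM hax g hx) (Nat.pos_of_ne_zero hl0) hl
  · intro hlox
    rw [hX.invertedHyperplanes_eq hadj, hX.invertedHalfspaces_eq_empty hlox, Set.image_empty,
      Set.ncard_empty]
  · intro _ _
    exact (hX.finite_invertedHyperplanes hadj).cast_ncard_eq.symm
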